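/- Let $C>0$ and $\beta>0$, and let $P_1=-\frac{d^2}{dx^2}+Cx^{-2}+x^{\beta}$, acting on $L^2((0,+\infty),dx)$, be the Friedrichs extension of this differential operator from the core $C_c^\infty((0,+\infty))$ (it is the unique self-adjoint extension when $C\ge 3/4$). The spectrum of $P_1$ is discrete and consists of eigenvalues $0<\mu_1\le\mu_2\le\mu_3\le\cdots\to+\infty$, repeated according to multiplicity. Let $\gamma=\max(1/\beta,1/2)$. For a smooth nonincreasing function $\chi:[0,+\infty)\to[0,1]$ that is identically $1$ on some interval $[0,a]$ with $a>0$ (the case $\chi\equiv 1$ is included), the operator $e^{-\tau P_1}\chi$ is trace class for every $\tau>0$; set $\mathcal Z_\chi(\tau)=\mathrm{Tr}(e^{-\tau P_1}\chi)$. There is a constant $K$ depending only on $C$ and $\beta$ (not on $\chi$, $a$ or $\tau$) such that, for every such $\chi$, $$\left|\mathcal Z_\chi(\tau)-\frac{1}{\sqrt{4\pi\tau}}\int_0^{+\infty}e^{-\tau x^\beta}\chi(x)\,dx\right|\le K\,\tau^{-\gamma}\qquad(0<\tau\le 1),$$ $$|\mathcal Z_\chi(\tau)|\le K\,e^{-\mu_1\tau}\qquad(\tau\ge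 1).$$ Moreover, the counting function $N_1(\mu)=\#\{j\ge 1 : \mu_j\le\mu\}$ satisfies $$N_1(\mu)\sim A\,\mu^{\frac12+\frac1\beta}\quad(\mu\to+\infty),\qquad A=\frac{1}{\pi\beta}\,B\!\left(\tfrac32,\tfrac1\beta\right),$$ where $B(x,y)=\int_0^1 t^{x-1}(1-t)^{y-1}\,dt$ is the Beta function. -/

import Mathlib

open MeasureTheory Set Filter Topology
open scoped ContDiff Distributions InnerProductSpace

noncomputable section

namespace HalfLine

/-! ### Trace-class operators, functional calculus and discrete spectrum on a Hilbert space -/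

section Abstract

variable {H : Type*} [NormedAddCommGroup H] [InnerProductSpace ℂ H] [CompleteSpace H]

/-- `T` is trace class: it is an absolutely convergent series of operators of rank at most one,
`T u = ∑ₙ ⟪xₙ, u⟫ yₙ` with `∑ₙ ‖xₙ‖ ‖yₙ‖ < ∞`. -/
def IsTraceClass (T : H →L[ℂ] H) : Prop :=
  ∃ x y : ℕ → H, Summable (fun n => ‖x n‖ * ‖y n‖) ∧
    ∀ u : H, HasSum (fun n => ⟪x n, u⟫_ℂ • y n) (T u)

/-- `T` is trace class and its trace is `z`: `∑ᵢ ⟪eᵢ, T eᵢ⟫ = z` in every Hilbert basis. -/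
def HasTrace (T : H →L[ℂ] H) (z : ℂ) : Prop :=
  IsTraceClass T ∧
    ∀ (ι : Type) (e : HilbertBasis ι ℂ H), HasSum (fun i => ⟪e i, T (e i)⟫_ℂ) z

/-- `R` is the everywhere defined bounded two-sided inverse of `1 + A : D(A) → H`. -/
def IsInvOneAdd (A : H →ₗ.[ℂ] H) (R : H →L[ℂ] H) : Prop :=
  (∀ f : H, ∃ u : A.domain, (u : H) = R f ∧ (u : H) + A u = f) ∧
    ∀ u : A.domain, R ((u : H) + A u) = u

open Classical in
/-- The bounded operator `(1 + A)⁻¹` (and `0` if there is none). -/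
def invOneAdd (A : H →ₗ.[ℂ] H) : H →L[ℂ] H :=
  if h : ∃ R : H →L[ℂ] H, IsInvOneAdd A R then h.choose else 0

/-- The function `r ↦ exp (-τ (1 / r - 1))` for `r > 0`, extended by `0` to `r ≤ 0`. It is
continuous on `ℝ` for `τ > 0`, and its value at `r = 1 / (1 + s)`, `s ≥ 0`, is `exp (-τ s)`. -/
def heatSymbol (τ r : ℝ) : ℝ :=
  if r ≤ 0 then 0 else Real.exp (-τ * (1 / r - 1))

/-- The operator `exp (-τ A)`, `τ > 0`, for a non-negative self-adjoint operator `A`, by the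
functional calculus: `exp (-τ A)` is the function `heatSymbol τ` of the bounded self-adjoint
operator `(1 + A)⁻¹`. -/
def heatOperator (A : H →ₗ.[ℂ] H) (τ : ℝ) : H →L[ℂ] H :=
  cfc (heatSymbol τ) (invOneAdd A)

/-- The spectrum of `A` is discrete, and `μ 0 ≤ μ 1 ≤ μ 2 ≤ ⋯` are its eigenvalues repeated
according to their multiplicities: `μ` is monotone, tends to `+∞`, and the space has a Hilbert
basis `(eⱼ)` with `eⱼ ∈ D(A)` and `A eⱼ = μⱼ eⱼ`. -/
def IsEigenvalueSequence (A : H →ₗ.[ℂ] H) (μ : ℕ → ℝ) : Prop :=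
  Monotone μ ∧ Tendsto μ atTop atTop ∧
    ∃ e : HilbertBasis ℕ ℂ H, ∀ j, ∃ u : A.domain, (u : H) = e j ∧ A u = (μ j : ℂ) • e j

end Abstract

/-! ### The Schrödinger operator on the half-line -/

/-- The open half-line `(0, +∞)`. -/
def halfLine : TopologicalSpace.Opens ℝ := ⟨Ioi 0, isOpen_Ioi⟩

/-- Lebesgue measure on `(0, +∞)`. -/
abbrev halfMeasure : Measure ℝ := volume.restrict (Ioi 0)

/-- The Hilbert space `L²((0, +∞), dx)` of complex-valued functions. -/
abbrev L2Half : Type := Lp ℂ 2 halfMeasure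

/-- The potential `q(x) = C x⁻² + x ^ β`. -/
def potential (C β x : ℝ) : ℝ := C / x ^ 2 + x ^ β

theorem continuousOn_potential (C β : ℝ) : ContinuousOn (potential C β) (Ioi 0) := by
  intro x hx
  have hx' : x ≠ 0 := ne_of_gt hx
  refine ContinuousAt.continuousWithinAt ?_
  unfold potential
  exact (continuousAt_const.div (continuousAt_id.pow 2) (pow_ne_zero 2 hx')).add
    (Real.continuousAt_rpow_const x β (Or.inl hx'))

/-- The product of a function continuous on `(0, +∞)` with a continuous function whose compact
support lies in `(0, +∞)` is square integrable. -/
theorem memLp_mul {g : ℝ → ℂ} (hg : ContinuousOn g (Ioi 0)) {φ : ℝ → ℂ} (hφ : Continuous φ)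
    (hc : HasCompactSupport φ) (hs : tsupport φ ⊆ Ioi 0) :
    MemLp (fun x => g x * φ x) 2 halfMeasure := by
  have h1 : Continuous (fun x => g x * φ x) := by
    refine continuous_of_tsupport fun x hx => ?_
    have hx0 : x ∈ Ioi (0 : ℝ) := hs (closure_mono (fun y hy => by
      simp only [Function.mem_support] at hy ⊢
      exact fun h => hy (by simp [h])) hx)
    exact (hg.continuousAt (Ioi_mem_nhds hx0)).mul hφ.continuousAt
  have h2 : HasCompactSupport (fun x => g x * φ x) := hc.mul_left
  exact (h1.memLp_of_hasCompactSupport h2).restrict _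

theorem continuous_deriv (φ : 𝓓(halfLine, ℂ)) : Continuous (deriv φ) :=
  φ.contDiff.continuous_deriv (by simp)

theorem continuous_deriv2 (φ : 𝓓(halfLine, ℂ)) : Continuous (deriv (deriv φ)) := by
  have h : ContDiff ℝ ∞ (deriv φ) := (contDiff_infty_iff_deriv.1 φ.contDiff).2
  exact h.continuous_deriv (by simp)

theorem differentiable_test (φ : 𝓓(halfLine, ℂ)) : Differentiable ℝ φ :=
  φ.contDiff.differentiable (by simp)

theorem differentiable_deriv (φ : 𝓓(halfLine, ℂ)) : Differentiable ℝ (deriv φ) := by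
  have h : ContDiff ℝ ∞ (deriv φ) := (contDiff_infty_iff_deriv.1 φ.contDiff).2
  exact h.differentiable (by simp)

theorem memLp_test {g : ℝ → ℂ} (hg : ContinuousOn g (Ioi 0)) (φ : 𝓓(halfLine, ℂ)) :
    MemLp (fun x => g x * φ x) 2 halfMeasure :=
  memLp_mul hg φ.continuous φ.hasCompactSupport φ.tsupport_subset

theorem memLp_deriv (φ : 𝓓(halfLine, ℂ)) : MemLp (deriv φ) 2 halfMeasure :=
  ((continuous_deriv φ).memLp_of_hasCompactSupport φ.hasCompactSupport.deriv).restrict _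

theorem memLp_deriv2 (φ : 𝓓(halfLine, ℂ)) : MemLp (deriv (deriv φ)) 2 halfMeasure :=
  ((continuous_deriv2 φ).memLp_of_hasCompactSupport φ.hasCompactSupport.deriv.deriv).restrict _

theorem deriv_add_test (φ ψ : 𝓓(halfLine, ℂ)) :
    deriv (φ + ψ : 𝓓(halfLine, ℂ)) = deriv φ + deriv ψ := by
  ext x
  rw [FunLike.coe_add]
  exact deriv_add (differentiable_test φ x) (differentiable_test ψ x)

theorem deriv_smul_test (c : ℂ) (φ : 𝓓(halfLine, ℂ)) :
    deriv (c • φ : 𝓓(halfLine, ℂ)) = c • deriv φ := by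
  ext x
  rw [FunLike.coe_smul]
  exact deriv_const_smul c (differentiable_test φ x)

/-- Multiplication of test functions by a function `g` that is continuous on `(0, +∞)`, with
values in `L²`. -/
def mulTest (g : ℝ → ℂ) (hg : ContinuousOn g (Ioi 0)) : 𝓓(halfLine, ℂ) →ₗ[ℂ] L2Half where
  toFun φ := (memLp_test hg φ).toLp _
  map_add' φ ψ := by
    rw [← MemLp.toLp_add]
    refine MemLp.toLp_congr _ _ (Eventually.of_forall fun x => ?_)
    simp [mul_add]
  map_smul' c φ := by
    rw [RingHom.id_apply, ← MemLp.toLp_const_smul]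
    refine MemLp.toLp_congr _ _ (Eventually.of_forall fun x => ?_)
    simp [mul_left_comm]

/-- The inclusion of the test functions `C_c^∞((0, +∞))` in `L²`. -/
def inclTest : 𝓓(halfLine, ℂ) →ₗ[ℂ] L2Half := mulTest (fun _ => 1) continuousOn_const

/-- The map `φ ↦ φ'` from test functions to `L²`. -/
def derivTest : 𝓓(halfLine, ℂ) →ₗ[ℂ] L2Half where
  toFun φ := (memLp_deriv φ).toLp _
  map_add' φ ψ := by
    rw [← MemLp.toLp_add]
    exact MemLp.toLp_congr _ _ (Eventually.of_forall fun x => by rw [deriv_add_test])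
  map_smul' c φ := by
    rw [RingHom.id_apply, ← MemLp.toLp_const_smul]
    exact MemLp.toLp_congr _ _ (Eventually.of_forall fun x => by rw [deriv_smul_test])

/-- The map `φ ↦ φ''` from test functions to `L²`. -/
def deriv2Test : 𝓓(halfLine, ℂ) →ₗ[ℂ] L2Half where
  toFun φ := (memLp_deriv2 φ).toLp _
  map_add' φ ψ := by
    rw [← MemLp.toLp_add]
    refine MemLp.toLp_congr _ _ (Eventually.of_forall fun x => ?_)
    rw [deriv_add_test]
    exact deriv_add (differentiable_deriv φ x) (differentiable_deriv ψ x)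
  map_smul' c φ := by
    rw [RingHom.id_apply, ← MemLp.toLp_const_smul]
    refine MemLp.toLp_congr _ _ (Eventually.of_forall fun x => ?_)
    rw [deriv_smul_test]
    exact deriv_const_smul c (differentiable_deriv φ x)

/-- The differential expression `φ ↦ -φ'' + q φ` on test functions, with values in `L²`. -/
def schrodingerTest (C β : ℝ) : 𝓓(halfLine, ℂ) →ₗ[ℂ] L2Half :=
  -deriv2Test + mulTest (fun x => (potential C β x : ℂ))
    (Complex.continuous_ofReal.comp_continuousOn (continuousOn_potential C β))

/-- The map `φ ↦ (φ, φ', √q φ)` from test functions to `L² × L² × L²`: the sum of the squared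
norms of the components is `‖φ‖² + ∫ (|φ'|² + q |φ|²)`, the squared form norm of `φ`. -/
def formMap (C β : ℝ) : 𝓓(halfLine, ℂ) →ₗ[ℂ] L2Half × L2Half × L2Half :=
  inclTest.prod (derivTest.prod (mulTest (fun x => (√(potential C β x) : ℂ))
    (Complex.continuous_ofReal.comp_continuousOn
      (Real.continuous_sqrt.comp_continuousOn (continuousOn_potential C β)))))

/-- The domain of the closure of the quadratic form `φ ↦ ∫ (|φ'|² + q |φ|²)` on test functions:
the `u ∈ L²` that are `L²`-limits of test functions which form a Cauchy sequence for the form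
norm. -/
def formDomain (C β : ℝ) : Submodule ℂ L2Half :=
  (LinearMap.range (formMap C β)).topologicalClosure.map (LinearMap.fst ℂ L2Half (L2Half × L2Half))

/-- The graph of the Friedrichs extension of `-d²/dx² + q` on `C_c^∞((0, +∞))`: the adjoint of
this operator, restricted to the form domain. -/
def friedrichsGraph (C β : ℝ) : Submodule ℂ (L2Half × L2Half) where
  carrier := {p | p.1 ∈ formDomain C β ∧
    ∀ ψ : 𝓓(halfLine, ℂ), ⟪schrodingerTest C β ψ, p.1⟫_ℂ = ⟪inclTest ψ, p.2⟫_ℂ}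
  add_mem' := by
    rintro p p' ⟨h1, h2⟩ ⟨h1', h2'⟩
    refine ⟨add_mem h1 h1', fun ψ => ?_⟩
    simp only [Prod.fst_add, Prod.snd_add, inner_add_right, h2 ψ, h2' ψ]
  zero_mem' := ⟨zero_mem _, fun ψ => by simp⟩
  smul_mem' := by
    rintro c p ⟨h1, h2⟩
    refine ⟨Submodule.smul_mem _ c h1, fun ψ => ?_⟩
    simp only [Prod.smul_fst, Prod.smul_snd, inner_smul_right, h2 ψ]

/-- The Schrödinger operator `P₁ = -d²/dx² + C x⁻² + x ^ β` in `L²((0, +∞), dx)`: the Friedrichs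
extension from `C_c^∞((0, +∞))`. -/
def schrodinger (C β : ℝ) : L2Half →ₗ.[ℂ] L2Half := (friedrichsGraph C β).toLinearPMap

/-- Test functions are dense in `L²`, in the form that an element orthogonal to all of them
vanishes. -/
theorem eq_zero_of_inner_test {f : L2Half}
    (h : ∀ ψ : 𝓓(halfLine, ℂ), ⟪inclTest ψ, f⟫_ℂ = 0) : f = 0 := by
  have hloc : LocallyIntegrable (f : ℝ → ℂ) halfMeasure :=
    (Lp.memLp f).locallyIntegrable (by norm_num)
  have key := isOpen_Ioi.ae_eq_zero_of_integral_contDiff_smul_eq_zero (U := Ioi (0 : ℝ))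
    (hloc.locallyIntegrableOn _) (fun g hg hgc hgs => by
      have hsup : Function.support (fun x => (g x : ℂ)) = Function.support g := by
        ext x; simp
      let ψ : 𝓓(halfLine, ℂ) :=
        { toFun := fun x => (g x : ℂ)
          contDiff' := Complex.ofRealCLM.contDiff.comp hg
          hasCompactSupport' := by
            unfold HasCompactSupport tsupport; rw [hsup]; exact hgc
          tsupport_subset' := by unfold tsupport; rw [hsup]; exact hgs }
      have h1 := h ψ
      rw [L2.inner_def] at h1
      rw [← h1]
      refine integral_congr_ae ?_
      have h2 : (inclTest ψ : ℝ → ℂ) =ᵐ[halfMeasure] fun x => (1 : ℂ) * ψ x :=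
        MemLp.coeFn_toLp (memLp_test continuousOn_const ψ)
      filter_upwards [h2] with x hx
      rw [hx]
      have : ψ x = (g x : ℂ) := rfl
      simp [this, mul_comm])
  refine Lp.ext ?_
  have h3 : ∀ᵐ x ∂halfMeasure, x ∈ Ioi (0 : ℝ) := ae_restrict_mem measurableSet_Ioi
  filter_upwards [key, h3, Lp.coeFn_zero ℂ 2 halfMeasure] with x hx hx' h0
  rw [hx hx', h0]; rfl

/-- The graph of `schrodinger C β` is `friedrichsGraph C β`. -/
theorem schrodinger_graph (C β : ℝ) : (schrodinger C β).graph = friedrichsGraph C β := by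
  refine Submodule.toLinearPMap_graph_eq _ fun p hp hp0 => ?_
  refine eq_zero_of_inner_test fun ψ => ?_
  rw [← hp.2 ψ, hp0, inner_zero_right]

/-! ### Cut-off functions and the truncated heat operator -/

/-- A smooth nonincreasing function `χ : [0, +∞) → [0, 1]` that is identically `1` on an interval
`[0, a]`, `a > 0` (only the values on `[0, +∞)` matter). -/
structure Cutoff where
  /-- the underlying function -/
  toFun : ℝ → ℝ
  smooth : ContDiffOn ℝ ∞ toFun (Ici 0)
  antitone : AntitoneOn toFun (Ici 0)
  mem_Icc : ∀ x ∈ Ici (0 : ℝ), toFun x ∈ Icc (0 : ℝ) 1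
  eq_one : ∃ a > 0, ∀ x ∈ Icc (0 : ℝ) a, toFun x = 1

theorem Cutoff.memLp_top (χ : Cutoff) : MemLp (fun x => (χ.toFun x : ℂ)) ⊤ halfMeasure := by
  refine memLp_top_of_bound ?_ 1 ?_
  · refine ContinuousOn.aestronglyMeasurable ?_ measurableSet_Ioi
    exact Complex.continuous_ofReal.comp_continuousOn
      (χ.smooth.continuousOn.mono Ioi_subset_Ici_self)
  · filter_upwards [ae_restrict_mem measurableSet_Ioi] with x hx
    have h := χ.mem_Icc x (Ioi_subset_Ici_self hx)
    rw [Complex.norm_real, Real.norm_eq_abs, abs_of_nonneg h.1]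
    exact h.2

/-- Multiplication by `χ` as a bounded operator on `L²((0, +∞), dx)`. -/
def Cutoff.mulOperator (χ : Cutoff) : L2Half →L[ℂ] L2Half :=
  (ContinuousLinearMap.mul ℂ ℂ).holderL halfMeasure ⊤ 2 2 (χ.memLp_top.toLp _)

/-- The operator `exp (-τ P₁) χ`. -/
def truncatedHeat (C β : ℝ) (χ : Cutoff) (τ : ℝ) : L2Half →L[ℂ] L2Half :=
  heatOperator (schrodinger C β) τ ∘L χ.mulOperator

/-- The counting function `#{j | μ j ≤ x}` of a sequence of reals. -/
def countingFunction (μ : ℕ → ℝ) (x : ℝ) : ℕ := {j : ℕ | μ j ≤ x}.ncard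

end HalfLine

end

/-!
Let `P` be the Friedrichs extension, and let `ι` be the inclusion of the form domain, with its form
norm, in `L²`. Then `(1 + P)⁻¹ = ι ι†`, and `ι` is compact: on a bounded set of the form domain the
derivative controls the error made by averaging over short cells, and the growth of `x ^ β` controls
the tails. The spectral theorem for compact operators gives an orthonormal basis of eigenvectors
(`exists_isEigenbasis`).

Everything else rests on coherent states, that is, on wave packets `e^{2πixξ} g(x - q)` with a
smooth window `g` supported in `(0, 1)`. They resolve the identity, and the mean of `(2πξ)²` over
them is the kinetic energy up to the constant `windowEnergy = ∫ g'²`, while the mean of `q ^ β` is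
at most the potential energy. For a nonincreasing convex function `F`, Jensen's inequality, applied
on one side to the distribution of an eigenvector over phase space and on the other side to the
spectral measure of a wave packet, bounds the traces of `F (P)` above and below by integrals over
classical phase space (`IsEigenbasis.tsum_profile_le`, `IsEigenbasis.le_tsum_profile`). The wave
packets for the lower bound are taken in `(1, +∞)`, where `C x⁻² ≤ C`. The upper bound persists
after localization by a function `η` with `|η'| ≤ a η`: the energy of `η e j` is at most `μ j + a²`
times its squared norm, so the localization costs only a bounded shift of the energy.

For `F (x) = e^{-τx}` this compares the measure with density the diagonal of the heat kernel with
the classical measure of density `(4πτ)^{-1/2} e^{-τ x ^ β}`. With a fixed profile for `η`,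
translated and reflected, the heat measure of every initial and every final interval of the
half-line exceeds the classical one by at most `O (τ^{-γ})`, where `γ = max(1/β, 1/2)`, with a
constant that does not depend on the interval. Together with the lower bound for the total mass this
controls the difference of the two measures on all intervals of both kinds, and the layer-cake
formula passes to an arbitrary monotone `χ` with values in `[0, 1]`
(`lintegral_antitone_comparison`, `IsEigenbasis.abs_truncatedTrace_sub_le`). Only the monotonicity
of `χ` enters, which is why the constant is uniform.

For `F (x) = (Λ - x)₊` the same bounds give the asymptotics of the Riesz means `∑ⱼ (Λ - μⱼ)₊`. Their
difference quotients enclose the counting function, so the Weyl law follows by an elementary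
Tauberian argument (`tendsto_div_rpow_of_difference_quotients`), and the substitution `y = x ^ β`
identifies the constant as a Beta integral.
-/

noncomputable section

namespace HalfLine

/-! ### Compact operators, functional calculus and traces on a Hilbert space -/

/-- A real function on an infinite type with finite sublevel sets can be enumerated in increasing
order. -/
theorem exists_equiv_nat_monotone {ι : Type*} [Infinite ι] (m : ι → ℝ)
    (hfin : ∀ x, {i | m i ≤ x}.Finite) : ∃ e : ℕ ≃ ι, Monotone (m ∘ e) := by
  have hc : Countable ι := by
    rw [← Set.countable_univ_iff]
    have : (univ : Set ι) = ⋃ n : ℕ, {i | m i ≤ n} := by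
      ext i
      simpa using exists_nat_ge (m i)
    rw [this]
    exact countable_iUnion fun n => (hfin n).countable
  obtain ⟨f, hf⟩ := exists_injective_nat ι
  -- ties between equal values of `m` are broken by an injection into `ℕ`
  let k : ι → ℝ ×ₗ ℕ := fun i => toLex (m i, f i)
  have hk : Function.Injective k := fun i j h => hf (congrArg Prod.snd (toLex.injective h))
  have hkm : ∀ i j, k i ≤ k j → m i ≤ m j := fun i j h => by
    rcases Prod.Lex.le_iff.1 h with h | h
    · exact h.le
    · exact h.1.le
  have hlow : ∀ i, {j | k j < k i}.Finite := fun i =>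
    (hfin (m i)).subset fun j hj => hkm j i (le_of_lt hj)
  let r : ι → ℕ := fun i => {j | k j < k i}.ncard
  have hr : ∀ i j, k i < k j → r i < r j := fun i j h =>
    ncard_lt_ncard ⟨fun l hl => lt_trans hl h, fun hsub => lt_irrefl (k i) (hsub h)⟩ (hlow j)
  have hri : Function.Injective r := fun i j h => by
    rcases lt_trichotomy (k i) (k j) with h' | h' | h'
    · exact absurd h (hr i j h').ne
    · exact hk h'
    · exact absurd h (hr j i h').ne'
  have : Infinite (range r) := infinite_range_iff hri |>.2 ‹_› |>.to_subtype
  classical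
  refine ⟨(Nat.Subtype.orderIsoOfNat (range r)).toEquiv.trans (Equiv.ofInjective r hri).symm,
    fun a b hab => ?_⟩
  simp only [Function.comp_apply, Equiv.trans_apply]
  refine hkm _ _ (not_lt.1 fun hlt => ?_)
  have h1 := hr _ _ hlt
  have h2 : ∀ x : range r, r ((Equiv.ofInjective r hri).symm x) = x := fun x =>
    Equiv.apply_ofInjective_symm hri x
  rw [h2, h2] at h1
  exact absurd ((Nat.Subtype.orderIsoOfNat (range r)).monotone hab) (not_le.2 h1)

section Abstract

variable {H : Type*} [NormedAddCommGroup H] [InnerProductSpace ℂ H]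

/-- Eigenvectors for eigenvalues at least `ε` are mapped by `R` to points at mutual distance at
least `ε`, so compactness leaves room for finitely many of them. -/
theorem finite_eigenvalue_ge {R : H →L[ℂ] H} (hR : IsCompactOperator R) {ι : Type*} {v : ι → H}
    (hv : Orthonormal ℂ v) {r : ι → ℝ} (hr : ∀ i, R (v i) = (r i : ℂ) • v i) {ε : ℝ} (hε : 0 < ε) :
    {i | ε ≤ r i}.Finite := by
  by_contra hinf
  have hinf : {i | ε ≤ r i}.Infinite := hinf
  let s := hinf.natEmbedding
  have hcpt := hR.isCompact_closure_image_closedBall (1 : ℝ)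
  have hmem : ∀ n, R (v (s n)) ∈ closure (R '' Metric.closedBall 0 1) := fun n =>
    subset_closure ⟨_, by simp [hv.1], rfl⟩
  obtain ⟨a, -, φ, hφ, hlim⟩ := hcpt.tendsto_subseq hmem
  have hcau := hlim.cauchySeq
  rw [Metric.cauchySeq_iff'] at hcau
  obtain ⟨N, hN⟩ := hcau ε hε
  have h1 := hN (N + 1) (Nat.le_succ N)
  have hne : (s (φ (N + 1)) : ι) ≠ s (φ N) := fun h =>
    absurd (s.injective (Subtype.ext h)) (hφ (Nat.lt_succ_self N)).ne'
  set i : ι := (s (φ (N + 1)) : ι)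
  set j : ι := (s (φ N) : ι)
  have hj : ε ≤ r j := (s (φ N)).2
  have h3 : ⟪v j, R (v i) - R (v j)⟫_ℂ = -(r j : ℂ) := by
    rw [hr, hr, inner_sub_right, inner_smul_right, inner_smul_right, hv.2 hne.symm,
      inner_self_eq_norm_sq_to_K, hv.1]
    simp
  have h4 := norm_inner_le_norm (𝕜 := ℂ) (v j) (R (v i) - R (v j))
  rw [h3, hv.1, one_mul, norm_neg, Complex.norm_real, Real.norm_eq_abs] at h4
  simp only [Function.comp_apply, dist_eq_norm] at h1
  exact absurd (h1.trans_le (hj.trans ((le_abs_self _).trans h4))) (lt_irrefl _)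

/-- An injective compact self-adjoint operator with spectrum in `(0, 1)` on an infinite-dimensional
space has a Hilbert basis of eigenvectors, for the eigenvalues `(1 + μ j)⁻¹` with `μ` monotone,
positive and tending to infinity. -/
theorem exists_hilbertBasis_eigenvectors [CompleteSpace H] (hdim : ¬ FiniteDimensional ℂ H)
    {R : H →L[ℂ] H} (hR : IsCompactOperator R) (hsym : R.IsSymmetric)
    (hev : ∀ (r : ℝ) (v : H), v ≠ 0 → R v = (r : ℂ) • v → 0 < r ∧ r < 1) :
    ∃ (μ : ℕ → ℝ) (e : HilbertBasis ℕ ℂ H), Monotone μ ∧ Tendsto μ atTop atTop ∧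
      (∀ j, 0 < μ j) ∧ ∀ j, R (e j) = ((1 + μ j)⁻¹ : ℂ) • e j := by
  have hfd : ∀ c : ℂ, FiniteDimensional ℂ (Module.End.eigenspace (R : Module.End ℂ H) c) := by
    intro c
    by_cases hc : c = 0
    · have : Module.End.eigenspace (R : Module.End ℂ H) c = ⊥ := by
        rw [eq_bot_iff]
        intro v hv
        rw [Module.End.mem_eigenspace_iff, hc] at hv
        by_contra hne
        exact lt_irrefl _ (hev 0 v hne (by simpa using hv)).1
      rw [this]
      infer_instance
    · exact ContinuousLinearMap.finite_dimensional_eigenspace hR c hc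
  let b := fun c : ℂ => stdOrthonormalBasis ℂ (Module.End.eigenspace (R : Module.End ℂ H) c)
  let ι := Σ c : ℂ, Fin (Module.finrank ℂ (Module.End.eigenspace (R : Module.End ℂ H) c))
  let v : ι → H := fun a => (b a.1 a.2 : H)
  have hv : Orthonormal ℂ v :=
    hsym.orthogonalFamily_eigenspaces.orthonormal_sigma_orthonormal fun c => (b c).orthonormal
  have hspan : (Submodule.span ℂ (range v))ᗮ = ⊥ := by
    rw [← ContinuousLinearMap.orthogonalComplement_iSup_eigenspaces_eq_bot hR hsym]
    refine le_antisymm (Submodule.orthogonal_le (iSup_le fun c => ?_))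
      (Submodule.orthogonal_le ?_)
    · intro x hx
      have h1 := (b c).sum_repr ⟨x, hx⟩
      have h2 : x = ∑ i, (b c).repr ⟨x, hx⟩ i • (b c i : H) := by
        have := congrArg Subtype.val h1
        simpa using this.symm
      rw [h2]
      exact Submodule.sum_mem _ fun i _ => Submodule.smul_mem _ _
        (Submodule.subset_span ⟨⟨c, i⟩, rfl⟩)
    · rw [Submodule.span_le]
      rintro _ ⟨a, rfl⟩
      exact Submodule.mem_iSup_of_mem a.1 (b a.1 a.2).2
  let B := HilbertBasis.mkOfOrthogonalEqBot hv hspan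
  have hB : ∀ a, B a = v a := fun a => by simp [B]
  have hRv : ∀ a : ι, R (v a) = a.1 • v a := fun a =>
    Module.End.mem_eigenspace_iff.1 (b a.1 a.2).2
  have hreal : ∀ a : ι, ((a.1.re : ℝ) : ℂ) = a.1 := fun a => by
    have h : Module.End.HasEigenvalue (R : Module.End ℂ H) a.1 :=
      Module.End.hasEigenvalue_of_hasEigenvector
        ⟨(b a.1 a.2).2, fun h => by simpa [v, h] using hv.1 a⟩
    exact Complex.conj_eq_iff_re.1 (hsym.conj_eigenvalue_eq_self h)
  have hRv' : ∀ a : ι, R (v a) = ((a.1.re : ℝ) : ℂ) • v a := fun a => by rw [hreal, hRv]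
  have hr : ∀ a : ι, 0 < a.1.re ∧ a.1.re < 1 := fun a =>
    hev _ (v a) (fun h => by simpa [h] using hv.1 a) (hRv' a)
  have hinf : Infinite ι := by
    by_contra h
    rw [not_infinite_iff_finite] at h
    have := Fintype.ofFinite ι
    exact hdim (B.toOrthonormalBasis.toBasis.finiteDimensional_of_finite)
  let m : ι → ℝ := fun a => (a.1.re)⁻¹ - 1
  have hm : ∀ x, {i | m i ≤ x}.Finite := fun x => by
    refine (finite_eigenvalue_ge hR hv hRv' (ε := (1 + max x 0)⁻¹) (by positivity)).subset ?_
    intro a ha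
    have ha' : (a.1.re)⁻¹ - 1 ≤ x := ha
    have h1 : (a.1.re)⁻¹ ≤ 1 + max x 0 := by linarith [le_max_left x 0]
    exact inv_le_of_inv_le₀ (hr a).1 h1
  obtain ⟨s, hs⟩ := exists_equiv_nat_monotone m hm
  have horth : Orthonormal ℂ (v ∘ s) := hv.comp s s.injective
  have hspan' : (Submodule.span ℂ (range (v ∘ s)))ᗮ = ⊥ := by
    rw [s.surjective.range_comp, hspan]
  refine ⟨m ∘ s, HilbertBasis.mkOfOrthogonalEqBot horth hspan', hs, ?_, fun j => ?_, fun j => ?_⟩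
  · refine tendsto_atTop_atTop.2 fun x => ?_
    by_contra! h
    -- otherwise the whole sequence stays in a finite sublevel set
    refine (Set.infinite_univ (α := ℕ)) (((hm x).preimage s.injective.injOn).subset fun n _ => ?_)
    obtain ⟨a, ha, hlt⟩ := h n
    exact (hs ha).trans hlt.le
  · have := hr (s j)
    simp only [m, Function.comp_apply, sub_pos]
    exact (one_lt_inv₀ this.1).2 this.2
  · rw [HilbertBasis.coe_mkOfOrthogonalEqBot]
    simp only [Function.comp_apply, hRv', m]
    congr 1
    push_cast
    simp

theorem IsInvOneAdd.unique {A : H →ₗ.[ℂ] H} {R R' : H →L[ℂ] H} (h : IsInvOneAdd A R)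
    (h' : IsInvOneAdd A R') : R = R' := by
  ext f
  obtain ⟨u, hu, huf⟩ := h.1 f
  rw [← hu, ← h'.2 u, huf]

theorem IsInvOneAdd.invOneAdd_eq {A : H →ₗ.[ℂ] H} {R : H →L[ℂ] H} (h : IsInvOneAdd A R) :
    invOneAdd A = R := by
  have hex : ∃ R : H →L[ℂ] H, IsInvOneAdd A R := ⟨R, h⟩
  rw [invOneAdd, dif_pos hex]
  exact hex.choose_spec.unique h

/-- The continuous functional calculus of a self-adjoint operator acts on an eigenvector by the
value of the function at the eigenvalue. -/
theorem cfc_apply_eigenvector [CompleteSpace H] {R : H →L[ℂ] H} (hR : IsSelfAdjoint R) {r : ℝ}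
    {v : H} (hv : R v = (r : ℂ) • v) {f : ℝ → ℝ} (hf : Continuous f) :
    cfc f R v = (f r : ℂ) • v := by
  by_cases hv0 : v = 0
  · simp [hv0]
  have hspec : r ∈ spectrum ℝ R := by
    rw [spectrum.mem_iff]
    intro hu
    obtain ⟨U, hU⟩ := hu
    have h1 : (U : H →L[ℂ] H) v = 0 := by
      rw [hU]
      simp [Algebra.algebraMap_eq_smul_one, hv]
    have h2 : ((U⁻¹ : (H →L[ℂ] H)ˣ) : H →L[ℂ] H) ((U : H →L[ℂ] H) v) = v := by
      rw [← mul_apply_eq_comp, Units.inv_mul, one_apply_eq_self]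
    rw [h1, map_zero] at h2
    exact hv0 h2.symm
  have key : ∀ F : C(spectrum ℝ R, ℝ), cfcHom hR F v = ((F ⟨r, hspec⟩ : ℝ) : ℂ) • v := by
    have : CompactSpace (spectrum ℝ R) := inferInstance
    intro F
    refine ContinuousMap.induction_on_of_compact (𝕜 := ℝ)
      (p := fun F : C(spectrum ℝ R, ℝ) => cfcHom hR F v = ((F ⟨r, hspec⟩ : ℝ) : ℂ) • v)
      ?_ ?_ ?_ ?_ ?_ ?_ F
    · intro c
      have : (ContinuousMap.const (spectrum ℝ R) c) = algebraMap ℝ C(spectrum ℝ R, ℝ) c := rfl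
      rw [this, AlgHomClass.commutes, Algebra.algebraMap_eq_smul_one]
      simp
    · rw [cfcHom_id]
      simpa using hv
    · rw [star_trivial, cfcHom_id]
      simpa using hv
    · intro f g hf hg
      rw [map_add, add_apply, hf, hg, ContinuousMap.add_apply]
      push_cast
      rw [add_smul]
    · intro f g hf hg
      rw [map_mul, mul_apply_eq_comp, hg, map_smul, hf, ContinuousMap.mul_apply]
      push_cast
      rw [smul_smul, mul_comm]
    · intro f hf
      have hcl : IsClosed {F : C(spectrum ℝ R, ℝ) |
          cfcHom hR F v = ((F ⟨r, hspec⟩ : ℝ) : ℂ) • v} := by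
        refine isClosed_eq ?_ ?_
        · exact (ContinuousLinearMap.apply ℂ H v).continuous.comp (cfcHom_continuous hR)
        · exact (Complex.continuous_ofReal.comp (continuous_eval_const _)).smul
            continuous_const
      exact hcl.mem_of_frequently_of_tendsto hf tendsto_id
  rw [cfc_apply f R hR hf.continuousOn, key]
  rfl

theorem continuous_heatSymbol {τ : ℝ} (hτ : 0 < τ) : Continuous (heatSymbol τ) := by
  rw [continuous_iff_continuousAt]
  intro r
  rcases lt_trichotomy r 0 with h | h | h
  · refine (continuousAt_const (y := (0 : ℝ))).congr ?_
    filter_upwards [eventually_lt_nhds h] with x hx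
    simp [heatSymbol, hx.le]
  · subst h
    rw [continuousAt_iff_continuous_left'_right']
    have h0 : heatSymbol τ 0 = 0 := by simp [heatSymbol]
    constructor
    · rw [ContinuousWithinAt, h0]
      refine tendsto_const_nhds.congr' ?_
      filter_upwards [self_mem_nhdsWithin] with x hx
      simp [heatSymbol, (mem_Iio.1 hx).le]
    · rw [ContinuousWithinAt, h0]
      have h1 : Tendsto (fun r : ℝ => Real.exp (-τ * (1 / r - 1))) (𝓝[>] 0) (𝓝 0) := by
        refine Real.tendsto_exp_atBot.comp ?_
        refine Tendsto.const_mul_atTop_of_neg (neg_lt_zero.2 hτ) ?_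
        simp only [one_div]
        exact tendsto_atTop_add_const_right _ _ tendsto_inv_nhdsGT_zero
      refine h1.congr' ?_
      filter_upwards [self_mem_nhdsWithin] with x hx
      simp [heatSymbol, not_le.2 (mem_Ioi.1 hx)]
  · have : ContinuousAt (fun r : ℝ => Real.exp (-τ * (1 / r - 1))) r := by
      have := h.ne'
      fun_prop (disch := assumption)
    refine this.congr ?_
    filter_upwards [eventually_gt_nhds h] with x hx
    simp [heatSymbol, hx]

/-- The operator `exp (-τ A)`, defined through `(1 + A)⁻¹`, acts by `exp (-τ m)` on an eigenvector
of `A` with eigenvalue `m`. -/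
theorem heatOperator_apply_eigenvector [CompleteSpace H] {A : H →ₗ.[ℂ] H} {R : H →L[ℂ] H}
    (hR : IsInvOneAdd A R) (hsa : IsSelfAdjoint R) {m : ℝ} (hm : 0 < m) {v : H}
    (hv : R v = ((1 + m)⁻¹ : ℂ) • v) {τ : ℝ} (hτ : 0 < τ) :
    heatOperator A τ v = (Real.exp (-τ * m) : ℂ) • v := by
  have hv' : R v = (((1 + m)⁻¹ : ℝ) : ℂ) • v := by rw [hv]; push_cast; rfl
  rw [heatOperator, hR.invOneAdd_eq, cfc_apply_eigenvector hsa hv' (continuous_heatSymbol hτ)]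
  have h : ¬ (1 + m)⁻¹ ≤ 0 := not_le.2 (by positivity)
  simp [heatSymbol, h]

/-- Parseval's identity. -/
theorem hasSum_norm_inner_sq {ι : Type*} (e : HilbertBasis ι ℂ H) (u : H) :
    HasSum (fun i => ‖⟪e i, u⟫_ℂ‖ ^ 2) (‖u‖ ^ 2) := by
  have h := e.hasSum_inner_mul_inner u u
  rw [inner_self_eq_norm_sq_to_K] at h
  refine Complex.hasSum_ofReal.1 ?_
  push_cast
  refine h.congr_fun fun i => ?_
  rw [← inner_conj_symm u (e i), mul_comm, Complex.mul_conj, Complex.normSq_eq_norm_sq]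
  push_cast
  rfl

/-- The operator `∑ₙ ⟪xₙ, ·⟫ yₙ` is trace class with trace `∑ₙ ⟪xₙ, yₙ⟫`. -/
theorem hasTrace_of_hasSum {T : H →L[ℂ] H} {x y : ℕ → H}
    (hs : Summable fun n => ‖x n‖ * ‖y n‖) (hT : ∀ u, HasSum (fun n => ⟪x n, u⟫_ℂ • y n) (T u))
    {z : ℂ} (hz : HasSum (fun n => ⟪x n, y n⟫_ℂ) z) : HasTrace T z := by
  refine ⟨⟨x, y, hs, hT⟩, fun ι e => ?_⟩
  let G : ℕ × ι → ℂ := fun p => ⟪x p.1, e p.2⟫_ℂ * ⟪e p.2, y p.1⟫_ℂ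
  have hcs : ∀ n, Summable (fun i => ‖G (n, i)‖) ∧ ∑' i, ‖G (n, i)‖ ≤ ‖x n‖ * ‖y n‖ := by
    intro n
    have hx : ∀ i, ‖⟪x n, e i⟫_ℂ‖ = ‖⟪e i, x n⟫_ℂ‖ := fun i => norm_inner_symm _ _
    have h := Real.summable_and_inner_le_Lp_mul_Lq_tsum_of_nonneg (f := fun i => ‖⟪e i, x n⟫_ℂ‖)
      (g := fun i => ‖⟪e i, y n⟫_ℂ‖) Real.HolderConjugate.two_two (fun i => norm_nonneg _)
      (fun i => norm_nonneg _) (by simpa using (hasSum_norm_inner_sq e (x n)).summable)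
      (by simpa using (hasSum_norm_inner_sq e (y n)).summable)
    simp only [Real.rpow_two, (hasSum_norm_inner_sq e _).tsum_eq, ← Real.sqrt_eq_rpow,
      Real.sqrt_sq (norm_nonneg _)] at h
    simpa [G, hx] using h
  have hG : Summable G := by
    refine Summable.of_norm ?_
    rw [summable_prod_of_nonneg fun p => norm_nonneg _]
    exact ⟨fun n => (hcs n).1,
      Summable.of_nonneg_of_le (fun n => tsum_nonneg fun i => norm_nonneg _)
        (fun n => (hcs n).2) hs⟩
  have h1 : ∀ n, HasSum (fun i => G (n, i)) ⟪x n, y n⟫_ℂ := fun n =>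
    e.hasSum_inner_mul_inner (x n) (y n)
  have h2 : HasSum G z := by
    have := hG.hasSum.prod_fiberwise h1
    rw [hz.unique this]
    exact hG.hasSum
  have h3 : HasSum (G ∘ Prod.swap) z := (Equiv.prodComm ι ℕ).hasSum_iff.2 h2
  refine h3.prod_fiberwise fun i => ?_
  have h4 := (innerSL ℂ (e i)).hasSum (hT (e i))
  simpa [G, inner_smul_right] using h4

end Abstract

/-! ### Inner products of test functions and the potential -/

theorem inner_self_complex {H : Type*} [NormedAddCommGroup H] [InnerProductSpace ℂ H] (x : H) :
    ⟪x, x⟫_ℂ = ((‖x‖ ^ 2 : ℝ) : ℂ) := by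
  rw [inner_self_eq_norm_sq_to_K, Complex.ofReal_pow]
  rfl

theorem inner_toLp {f g : ℝ → ℂ} (hf : MemLp f 2 halfMeasure) (hg : MemLp g 2 halfMeasure) :
    ⟪hf.toLp f, hg.toLp g⟫_ℂ = ∫ x in Ioi (0 : ℝ), ⟪f x, g x⟫_ℂ := by
  rw [L2.inner_def]
  refine integral_congr_ae ?_
  filter_upwards [hf.coeFn_toLp, hg.coeFn_toLp] with x hx hx'
  rw [hx, hx']

theorem norm_sq_eq_integral (u : L2Half) : ‖u‖ ^ 2 = ∫ x in Ioi (0 : ℝ), ‖u x‖ ^ 2 := by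
  refine Complex.ofReal_injective ?_
  rw [← inner_self_complex, L2.inner_def, ← integral_complex_ofReal]
  simp only [inner_self_complex]

theorem norm_sq_toLp {f : ℝ → ℂ} (hf : MemLp f 2 halfMeasure) :
    ‖hf.toLp f‖ ^ 2 = ∫ x in Ioi (0 : ℝ), ‖f x‖ ^ 2 := by
  rw [norm_sq_eq_integral]
  refine integral_congr_ae ?_
  filter_upwards [hf.coeFn_toLp] with x hx
  rw [hx]

theorem integrable_norm_sq (u : L2Half) : Integrable (fun x => ‖u x‖ ^ 2) halfMeasure :=
  (memLp_two_iff_integrable_sq_norm (Lp.aestronglyMeasurable u)).1 (Lp.memLp u)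

theorem test_eq_zero (φ : 𝓓(halfLine, ℂ)) {x : ℝ} (hx : x ≤ 0) : φ x = 0 := by
  refine image_eq_zero_of_notMem_tsupport fun h => ?_
  exact absurd (φ.tsupport_subset h) (not_lt.2 hx)

theorem deriv_test_eq_zero (φ : 𝓓(halfLine, ℂ)) {x : ℝ} (hx : x ≤ 0) : deriv φ x = 0 := by
  have h : x ∉ tsupport φ := fun h => absurd (φ.tsupport_subset h) (not_lt.2 hx)
  exact image_eq_zero_of_notMem_tsupport fun h' => h (tsupport_deriv_subset h')

theorem setIntegral_Ioi_eq {E : Type*} [NormedAddCommGroup E] [NormedSpace ℝ E] {f : ℝ → E}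
    (hf : ∀ x ≤ 0, f x = 0) : ∫ x in Ioi (0 : ℝ), f x = ∫ x, f x :=
  setIntegral_eq_integral_of_forall_compl_eq_zero fun x hx => hf x (not_lt.1 hx)

theorem inner_mulTest {g g' : ℝ → ℂ} (hg : ContinuousOn g (Ioi 0)) (hg' : ContinuousOn g' (Ioi 0))
    (ψ φ : 𝓓(halfLine, ℂ)) :
    ⟪mulTest g hg ψ, mulTest g' hg' φ⟫_ℂ = ∫ x in Ioi (0 : ℝ), ⟪g x * ψ x, g' x * φ x⟫_ℂ :=
  inner_toLp (memLp_test hg ψ) (memLp_test hg' φ)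

theorem norm_sq_mulTest {g : ℝ → ℂ} (hg : ContinuousOn g (Ioi 0)) (φ : 𝓓(halfLine, ℂ)) :
    ‖mulTest g hg φ‖ ^ 2 = ∫ x in Ioi (0 : ℝ), ‖g x * φ x‖ ^ 2 :=
  norm_sq_toLp (memLp_test hg φ)

theorem coeFn_inclTest (φ : 𝓓(halfLine, ℂ)) : (inclTest φ : ℝ → ℂ) =ᵐ[halfMeasure] φ := by
  refine (MemLp.coeFn_toLp (memLp_test continuousOn_const φ)).trans ?_
  exact Eventually.of_forall fun x => by simp

theorem norm_sq_inclTest (φ : 𝓓(halfLine, ℂ)) : ‖inclTest φ‖ ^ 2 = ∫ x, ‖φ x‖ ^ 2 := by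
  rw [← setIntegral_Ioi_eq fun x hx => by simp [test_eq_zero φ hx]]
  refine (norm_sq_mulTest _ _).trans ?_
  simp

/-- Integration by parts. -/
theorem inner_derivTest (ψ φ : 𝓓(halfLine, ℂ)) :
    ⟪derivTest ψ, derivTest φ⟫_ℂ = -⟪deriv2Test ψ, inclTest φ⟫_ℂ := by
  have h1 : ⟪derivTest ψ, derivTest φ⟫_ℂ = ∫ x, star (deriv ψ x) * deriv φ x := by
    rw [← setIntegral_Ioi_eq fun x hx => by simp [deriv_test_eq_zero φ hx]]
    refine (inner_toLp (memLp_deriv ψ) (memLp_deriv φ)).trans ?_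
    simp [mul_comm]
  have h2 : ⟪deriv2Test ψ, inclTest φ⟫_ℂ = ∫ x, star (deriv (deriv ψ) x) * φ x := by
    rw [← setIntegral_Ioi_eq fun x hx => by simp [test_eq_zero φ hx]]
    refine (inner_toLp (memLp_deriv2 ψ) (memLp_test continuousOn_const φ)).trans ?_
    simp [mul_comm]
  rw [h1, h2]
  have hc := φ.hasCompactSupport
  refine integral_mul_deriv_eq_deriv_mul_of_integrable (u := fun x => star (deriv ψ x))
    (v := φ) (u' := fun x => star (deriv (deriv ψ) x)) (v' := deriv φ) ?_ ?_ ?_ ?_ ?_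
  · exact fun x _ => ((differentiable_deriv ψ x).hasDerivAt).star
  · exact fun x _ => (differentiable_test φ x).hasDerivAt
  · exact Continuous.integrable_of_hasCompactSupport
      ((continuous_star.comp (continuous_deriv ψ)).mul (continuous_deriv φ)) hc.deriv.mul_left
  · exact Continuous.integrable_of_hasCompactSupport
      ((continuous_star.comp (continuous_deriv2 ψ)).mul φ.continuous) hc.mul_left
  · exact Continuous.integrable_of_hasCompactSupport
      ((continuous_star.comp (continuous_deriv ψ)).mul φ.continuous) hc.mul_left

theorem potential_ge {C β x : ℝ} (hC : 0 < C) (hβ : 0 < β) (hx : 0 < x) :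
    min C 1 ≤ potential C β x := by
  unfold potential
  have h1 : 0 ≤ C / x ^ 2 := by positivity
  have h2 : 0 ≤ x ^ β := by positivity
  rcases le_total x 1 with h | h
  · have : C ≤ C / x ^ 2 := by
      rw [le_div_iff₀ (by positivity)]
      exact mul_le_of_le_one_right hC.le (pow_le_one₀ hx.le h)
    linarith [min_le_left C 1]
  · have : 1 ≤ x ^ β := Real.one_le_rpow h hβ.le
    linarith [min_le_right C 1]

theorem potential_pos {C β x : ℝ} (hC : 0 < C) (hβ : 0 < β) (hx : 0 < x) : 0 < potential C β x :=
  (lt_min hC one_pos).trans_le (potential_ge hC hβ hx)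

/-- Multiplication of test functions by `q`, with values in `L²`. -/
abbrev potTest (C β : ℝ) : 𝓓(halfLine, ℂ) →ₗ[ℂ] L2Half :=
  mulTest (fun x => (potential C β x : ℂ))
    (Complex.continuous_ofReal.comp_continuousOn (continuousOn_potential C β))

/-- Multiplication of test functions by `√q`, with values in `L²`. -/
abbrev sqrtPotTest (C β : ℝ) : 𝓓(halfLine, ℂ) →ₗ[ℂ] L2Half :=
  mulTest (fun x => (√(potential C β x) : ℂ))
    (Complex.continuous_ofReal.comp_continuousOn
      (Real.continuous_sqrt.comp_continuousOn (continuousOn_potential C β)))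

theorem inner_sqrtPotTest {C β : ℝ} (hC : 0 < C) (hβ : 0 < β) (ψ φ : 𝓓(halfLine, ℂ)) :
    ⟪sqrtPotTest C β ψ, sqrtPotTest C β φ⟫_ℂ = ⟪potTest C β ψ, inclTest φ⟫_ℂ := by
  refine (inner_mulTest _ _ _ _).trans (Eq.trans ?_ (inner_mulTest _ _ _ _).symm)
  refine setIntegral_congr_fun measurableSet_Ioi fun x hx => ?_
  have h : ((√(potential C β x) : ℝ) : ℂ) * ((√(potential C β x) : ℝ) : ℂ) = potential C β x := by
    rw [← Complex.ofReal_mul, Real.mul_self_sqrt (potential_pos hC hβ hx).le]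
  simp only [RCLike.inner_apply, map_mul, Complex.conj_ofReal, one_mul]
  rw [← h]
  ring

theorem norm_sq_sqrtPotTest {C β : ℝ} (hC : 0 < C) (hβ : 0 < β) (φ : 𝓓(halfLine, ℂ)) :
    ‖sqrtPotTest C β φ‖ ^ 2 = ∫ x in Ioi (0 : ℝ), potential C β x * ‖φ x‖ ^ 2 := by
  refine (norm_sq_mulTest _ _).trans ?_
  refine setIntegral_congr_fun measurableSet_Ioi fun x hx => ?_
  simp only [norm_mul, mul_pow, Complex.norm_real, Real.norm_eq_abs, sq_abs]
  rw [Real.sq_sqrt (potential_pos hC hβ hx).le]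

theorem norm_sq_derivTest (φ : 𝓓(halfLine, ℂ)) : ‖derivTest φ‖ ^ 2 = ∫ x, ‖deriv φ x‖ ^ 2 := by
  rw [← setIntegral_Ioi_eq fun x hx => by simp [deriv_test_eq_zero φ hx]]
  exact norm_sq_toLp (memLp_deriv φ)

/-! ### The form domain as a Hilbert space -/

/-- The `ℓ²` direct sum of three copies of `L²`. -/
abbrev FormSpace : Type := WithLp 2 (L2Half × WithLp 2 (L2Half × L2Half))

/-- The identification of `L² × L² × L²` with the Hilbert space `FormSpace`. -/
def formEquiv : (L2Half × L2Half × L2Half) ≃L[ℂ] FormSpace :=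
  ((ContinuousLinearEquiv.refl ℂ L2Half).prodCongr
    (WithLp.prodContinuousLinearEquiv 2 ℂ L2Half L2Half).symm).trans
      (WithLp.prodContinuousLinearEquiv 2 ℂ L2Half (WithLp 2 (L2Half × L2Half))).symm

/-- The map `φ ↦ (φ, φ', √q φ)` with values in the Hilbert space `FormSpace`. -/
def formVec (C β : ℝ) : 𝓓(halfLine, ℂ) →ₗ[ℂ] FormSpace :=
  formEquiv.toLinearMap ∘ₗ formMap C β

theorem formVec_fst (C β : ℝ) (φ : 𝓓(halfLine, ℂ)) : (formVec C β φ).fst = inclTest φ := rfl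

theorem formVec_snd_snd (C β : ℝ) (φ : 𝓓(halfLine, ℂ)) :
    (formVec C β φ).snd.snd = sqrtPotTest C β φ := rfl

theorem norm_sq_formVec (C β : ℝ) (φ : 𝓓(halfLine, ℂ)) :
    ‖formVec C β φ‖ ^ 2 = ‖inclTest φ‖ ^ 2 + (‖derivTest φ‖ ^ 2 + ‖sqrtPotTest C β φ‖ ^ 2) := by
  rw [WithLp.prod_norm_sq_eq_of_L2, WithLp.prod_norm_sq_eq_of_L2]
  rfl

/-- On test functions the form norm belongs to the operator `1 + P`. -/
theorem inner_formVec {C β : ℝ} (hC : 0 < C) (hβ : 0 < β) (ψ φ : 𝓓(halfLine, ℂ)) :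
    ⟪formVec C β ψ, formVec C β φ⟫_ℂ = ⟪inclTest ψ + schrodingerTest C β ψ, inclTest φ⟫_ℂ := by
  rw [WithLp.prod_inner_apply, WithLp.prod_inner_apply]
  change ⟪inclTest ψ, inclTest φ⟫_ℂ + (⟪derivTest ψ, derivTest φ⟫_ℂ +
    ⟪sqrtPotTest C β ψ, sqrtPotTest C β φ⟫_ℂ) = _
  rw [inner_derivTest, inner_sqrtPotTest hC hβ, schrodingerTest, inner_add_left,
    LinearMap.add_apply, inner_add_left, LinearMap.neg_apply, inner_neg_left]

/-- The closure of the graph-like set `{(φ, φ', √q φ)}`: the form domain with its form norm. -/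
def formClosure (C β : ℝ) : Submodule ℂ FormSpace :=
  (LinearMap.range (formVec C β)).topologicalClosure

instance (C β : ℝ) : CompleteSpace (formClosure C β) :=
  (Submodule.isClosed_topologicalClosure _).completeSpace_coe

theorem formVec_mem (C β : ℝ) (φ : 𝓓(halfLine, ℂ)) : formVec C β φ ∈ formClosure C β :=
  Submodule.le_topologicalClosure _ ⟨φ, rfl⟩

theorem exists_seq_formVec {C β : ℝ} {h : FormSpace} (hh : h ∈ formClosure C β) :
    ∃ φ : ℕ → 𝓓(halfLine, ℂ), Tendsto (fun n => formVec C β (φ n)) atTop (𝓝 h) := by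
  obtain ⟨s, hs, hlim⟩ := mem_closure_iff_seq_limit.1 hh
  choose φ hφ using hs
  exact ⟨φ, by simpa only [hφ] using hlim⟩

theorem mem_formDomain_iff {C β : ℝ} {u : L2Half} :
    u ∈ formDomain C β ↔ ∃ h ∈ formClosure C β, h.fst = u := by
  constructor
  · rintro ⟨p, hp, rfl⟩
    refine ⟨formEquiv p, ?_, rfl⟩
    refine map_mem_closure formEquiv.continuous hp ?_
    rintro _ ⟨φ, rfl⟩
    exact ⟨φ, rfl⟩
  · rintro ⟨h, hh, rfl⟩
    refine ⟨formEquiv.symm h, ?_, ?_⟩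
    · refine map_mem_closure formEquiv.symm.continuous hh ?_
      rintro _ ⟨φ, rfl⟩
      exact ⟨φ, (formEquiv.symm_apply_apply _).symm⟩
    · change (formEquiv (formEquiv.symm h)).fst = h.fst
      rw [formEquiv.apply_symm_apply]

/-- The inclusion of the form domain in `L²`. -/
def formIncl (C β : ℝ) : formClosure C β →L[ℂ] L2Half :=
  WithLp.fstL 2 ℂ L2Half (WithLp 2 (L2Half × L2Half)) ∘L (formClosure C β).subtypeL

theorem inner_formVec_of_mem {C β : ℝ} (hC : 0 < C) (hβ : 0 < β) (ψ : 𝓓(halfLine, ℂ))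
    {h : FormSpace} (hh : h ∈ formClosure C β) :
    ⟪formVec C β ψ, h⟫_ℂ = ⟪inclTest ψ + schrodingerTest C β ψ, h.fst⟫_ℂ := by
  obtain ⟨φ, hφ⟩ := exists_seq_formVec hh
  have h1 := (tendsto_const_nhds (x := formVec C β ψ)).inner (𝕜 := ℂ) hφ
  have h2 := (tendsto_const_nhds (x := inclTest ψ + schrodingerTest C β ψ)).inner (𝕜 := ℂ)
    (((WithLp.fstL 2 ℂ L2Half (WithLp 2 (L2Half × L2Half))).continuous.tendsto h).comp hφ)
  refine tendsto_nhds_unique h1 (h2.congr fun n => ?_)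
  exact (inner_formVec hC hβ ψ (φ n)).symm

/-- The adjoint of the inclusion of the form domain in `L²`. -/
def formAdj (C β : ℝ) : L2Half →L[ℂ] formClosure C β :=
  ContinuousLinearMap.adjoint (𝕜 := ℂ) (E := formClosure C β) (F := L2Half) (formIncl C β)

theorem inner_formAdj {C β : ℝ} {h : FormSpace} (hh : h ∈ formClosure C β) (f : L2Half) :
    ⟪h, (formAdj C β f : FormSpace)⟫_ℂ = ⟪h.fst, f⟫_ℂ := by
  have := ContinuousLinearMap.adjoint_inner_right (𝕜 := ℂ) (E := formClosure C β) (F := L2Half)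
    (formIncl C β) ⟨h, hh⟩ f
  rw [Submodule.coe_inner] at this
  exact this

/-- The operator `(1 + P)⁻¹`: if `ι` is the inclusion of the form domain in `L²`, it is `ι ι†`. -/
def resolvent (C β : ℝ) : L2Half →L[ℂ] L2Half := formIncl C β ∘L formAdj C β

theorem resolvent_mem_graph {C β : ℝ} (hC : 0 < C) (hβ : 0 < β) (f : L2Half) :
    (resolvent C β f, f - resolvent C β f) ∈ (schrodinger C β).graph := by
  rw [schrodinger_graph]
  set h := formAdj C β f with hdef
  have hR : resolvent C β f = (h : FormSpace).fst := rfl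
  refine ⟨mem_formDomain_iff.2 ⟨h, h.2, rfl⟩, fun ψ => ?_⟩
  have h1 := inner_formVec_of_mem hC hβ ψ h.2
  have h2 : ⟪formVec C β ψ, (h : FormSpace)⟫_ℂ = ⟪inclTest ψ, f⟫_ℂ :=
    inner_formAdj (formVec_mem C β ψ) f
  rw [h2, inner_add_left] at h1
  change ⟪schrodingerTest C β ψ, resolvent C β f⟫_ℂ = ⟪inclTest ψ, f - resolvent C β f⟫_ℂ
  rw [inner_sub_right, h1, hR]
  ring

/-- If `(u, v)` lies in the graph of `P`, then the element `h` of the form domain with first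
component `u` solves the variational problem that defines `ι†`, for the right-hand side `u + v`. -/
theorem formAdj_eq {C β : ℝ} (hC : 0 < C) (hβ : 0 < β) {u v : L2Half}
    (huv : (u, v) ∈ (schrodinger C β).graph) (h : formClosure C β) (hu : (h : FormSpace).fst = u) :
    formAdj C β (u + v) = h := by
  rw [schrodinger_graph] at huv
  rw [← sub_eq_zero]
  set k := formAdj C β (u + v) - h
  -- `k` is orthogonal to the vectors `(ψ, ψ', √q ψ)`, which are dense in the form domain
  have hk : ∀ ψ, ⟪formVec C β ψ, (k : FormSpace)⟫_ℂ = 0 := fun ψ => by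
    have h1 : ⟪formVec C β ψ,
        (formAdj C β (u + v) : FormSpace)⟫_ℂ
          = ⟪inclTest ψ, u + v⟫_ℂ :=
      inner_formAdj (formVec_mem C β ψ) _
    have h2 := inner_formVec_of_mem hC hβ ψ h.2
    have h3 := huv.2 ψ
    simp only [k, Submodule.coe_sub, inner_sub_right, h1, h2, hu, inner_add_left, inner_add_right]
    rw [h3]
    ring
  obtain ⟨φ, hφ⟩ := exists_seq_formVec k.2
  have h1 := hφ.inner (𝕜 := ℂ) (tendsto_const_nhds (x := (k : FormSpace)))
  simp only [hk] at h1
  have h2 : ⟪(k : FormSpace), (k : FormSpace)⟫_ℂ = 0 := tendsto_nhds_unique h1 tendsto_const_nhds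
  exact Subtype.ext (inner_self_eq_zero.1 h2)

/-- The operator `ι ι†` inverts `1 + P`, where `P` is the Friedrichs extension. -/
theorem isInvOneAdd_resolvent {C β : ℝ} (hC : 0 < C) (hβ : 0 < β) :
    IsInvOneAdd (schrodinger C β) (resolvent C β) := by
  constructor
  · intro f
    obtain ⟨u, hu, hAu⟩ := (LinearPMap.mem_graph_iff _).1 (resolvent_mem_graph hC hβ f)
    refine ⟨u, hu, ?_⟩
    have h2 : schrodinger C β u = f - resolvent C β f := hAu
    have h1 : (u : L2Half) = resolvent C β f := hu
    rw [h2, h1]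
    abel
  · intro u
    have hg := LinearPMap.mem_graph _ u
    have hg' := hg
    rw [schrodinger_graph] at hg'
    obtain ⟨h, hh, hu⟩ := mem_formDomain_iff.1 hg'.1
    have := formAdj_eq hC hβ hg ⟨h, hh⟩ hu
    rw [resolvent, ContinuousLinearMap.comp_apply, this]
    exact hu

theorem resolvent_isSymmetric (C β : ℝ) :
    (resolvent C β : L2Half →ₗ[ℂ] L2Half).IsSymmetric := by
  intro u v
  have h1 := inner_formAdj (formAdj C β u).2 v
  have h2 := inner_formAdj (formAdj C β v).2 u
  rw [← inner_conj_symm, h2, inner_conj_symm] at h1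
  exact h1.symm

theorem isSelfAdjoint_resolvent (C β : ℝ) : IsSelfAdjoint (resolvent C β) :=
  ContinuousLinearMap.isSelfAdjoint_iff_isSymmetric.2 (resolvent_isSymmetric C β)

/-- The form is bounded below by `min C 1`, since the potential is. -/
theorem norm_sq_fst_le {C β : ℝ} (hC : 0 < C) (hβ : 0 < β) {h : FormSpace}
    (hh : h ∈ formClosure C β) : min C 1 * ‖h.fst‖ ^ 2 ≤ ‖h.snd.snd‖ ^ 2 := by
  obtain ⟨φ, hφ⟩ := exists_seq_formVec hh
  have c1 : Continuous fun h : FormSpace => min C 1 * ‖h.fst‖ ^ 2 :=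
    (((WithLp.fstL 2 ℂ L2Half (WithLp 2 (L2Half × L2Half))).continuous.norm).pow 2).const_mul _
  have c2 : Continuous fun h : FormSpace => ‖h.snd.snd‖ ^ 2 :=
    (((WithLp.sndL 2 ℂ L2Half L2Half).continuous.comp
      (WithLp.sndL 2 ℂ L2Half (WithLp 2 (L2Half × L2Half))).continuous).norm).pow 2
  refine le_of_tendsto_of_tendsto' ((c1.tendsto h).comp hφ) ((c2.tendsto h).comp hφ) fun n => ?_
  simp only [Function.comp_apply, formVec_fst, formVec_snd_snd]
  rw [norm_sq_sqrtPotTest hC hβ, norm_sq_inclTest,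
    ← setIntegral_Ioi_eq fun x hx => by simp [test_eq_zero (φ n) hx], ← integral_const_mul]
  refine setIntegral_mono_on ?_ ?_ measurableSet_Ioi fun x hx =>
    mul_le_mul_of_nonneg_right (potential_ge hC hβ hx) (by positivity)
  · have := (Continuous.integrable_of_hasCompactSupport (μ := volume)
      (f := fun x => min C 1 * ‖φ n x‖ ^ 2) (by have := (φ n).continuous; fun_prop) ?_)
    · exact this.integrableOn
    · exact ((φ n).hasCompactSupport.norm.comp_left (g := fun t => t ^ 2) (by simp)).mul_left
  · have h1 := integrable_norm_sq (sqrtPotTest C β (φ n))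
    refine h1.congr ?_
    filter_upwards [MemLp.coeFn_toLp (memLp_test (Complex.continuous_ofReal.comp_continuousOn
      (Real.continuous_sqrt.comp_continuousOn (continuousOn_potential C β))) (φ n)),
      ae_restrict_mem measurableSet_Ioi] with x hx hx0
    erw [hx]
    simp only [Function.comp_apply, norm_mul, mul_pow, Complex.norm_real, Real.norm_eq_abs, sq_abs]
    rw [Real.sq_sqrt (potential_pos hC hβ hx0).le]

/-- The eigenvalues of `(1 + P)⁻¹` lie in `(0, 1)`. -/
theorem resolvent_eigenvalue {C β : ℝ} (hC : 0 < C) (hβ : 0 < β) {r : ℝ} {v : L2Half}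
    (hv : v ≠ 0) (hr : resolvent C β v = (r : ℂ) • v) : 0 < r ∧ r < 1 := by
  set h := formAdj C β v with hdef
  have hRv : (h : FormSpace).fst = (r : ℂ) • v := hr
  have hvpos : 0 < ‖v‖ ^ 2 := by positivity
  have h1 : ‖(h : FormSpace)‖ ^ 2 = r * ‖v‖ ^ 2 := by
    have h2 : ⟪(h : FormSpace), (h : FormSpace)⟫_ℂ = ⟪(r : ℂ) • v, v⟫_ℂ := by
      rw [← hRv]
      exact inner_formAdj h.2 v
    rw [inner_self_complex, inner_smul_left, inner_self_complex, Complex.conj_ofReal] at h2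
    exact_mod_cast h2
  have hne : h ≠ 0 := fun h0 => by
    refine hv (eq_zero_of_inner_test fun ψ => ?_)
    have h2 : ⟪formVec C β ψ, (h : FormSpace)⟫_ℂ = ⟪inclTest ψ, v⟫_ℂ :=
      inner_formAdj (formVec_mem C β ψ) v
    rw [← h2, h0]
    simp
  have hpos : 0 < ‖(h : FormSpace)‖ ^ 2 := by
    have : 0 < ‖(h : FormSpace)‖ := norm_pos_iff.2 fun h' => hne (Subtype.ext h')
    positivity
  have hr0 : 0 < r := by
    rw [h1] at hpos
    exact pos_of_mul_pos_left hpos hvpos.le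
  refine ⟨hr0, ?_⟩
  have h3 := norm_sq_fst_le hC hβ h.2
  have h4 : ‖(h : FormSpace)‖ ^ 2 = ‖(h : FormSpace).fst‖ ^ 2 +
      (‖(h : FormSpace).snd.fst‖ ^ 2 + ‖(h : FormSpace).snd.snd‖ ^ 2) := by
    rw [WithLp.prod_norm_sq_eq_of_L2, WithLp.prod_norm_sq_eq_of_L2]
  have h5 : ‖(h : FormSpace).fst‖ ^ 2 = r ^ 2 * ‖v‖ ^ 2 := by
    rw [hRv, norm_smul, mul_pow, Complex.norm_real, Real.norm_eq_abs, sq_abs]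
  have h6 : r ^ 2 * ‖v‖ ^ 2 + min C 1 * (r ^ 2 * ‖v‖ ^ 2) ≤ r * ‖v‖ ^ 2 := by
    rw [h5] at h3 h4
    rw [← h1, h4]
    nlinarith [sq_nonneg ‖(h : FormSpace).snd.fst‖]
  have h7 : 0 < min C 1 := lt_min hC one_pos
  by_contra hr1
  have h8 : r * ‖v‖ ^ 2 ≤ r ^ 2 * ‖v‖ ^ 2 := by
    refine mul_le_mul_of_nonneg_right ?_ hvpos.le
    nlinarith
  have h9 : 0 < min C 1 * (r ^ 2 * ‖v‖ ^ 2) := by positivity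
  linarith

theorem not_finiteDimensional_L2Half : ¬ FiniteDimensional ℂ L2Half := by
  intro hfd
  let I : ℕ → Set ℝ := fun n => Ioc (n : ℝ) (n + 1)
  have hI : ∀ n, MeasurableSet (I n) := fun n => measurableSet_Ioc
  have hIsub : ∀ n, I n ⊆ Ioi 0 := fun n x hx => lt_of_le_of_lt (Nat.cast_nonneg n) hx.1
  have hIm : ∀ n, halfMeasure (I n) = 1 := fun n => by
    rw [Measure.restrict_apply (hI n), inter_eq_left.2 (hIsub n), Real.volume_Ioc]
    simp
  let v : ℕ → L2Half := fun n => indicatorConstLp 2 (hI n) (by rw [hIm]; simp) (1 : ℂ)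
  have hv : Orthonormal ℂ v := by
    rw [orthonormal_iff_ite]
    intro i j
    rw [L2.inner_indicatorConstLp_one_indicatorConstLp_one (hI i) (hI j) (by simp [hIm])
      (by simp [hIm])]
    split_ifs with hij
    · subst hij
      rw [inter_self, Measure.real, hIm]
      simp
    · have : I i ∩ I j = ∅ := by
        rw [← disjoint_iff_inter_eq_empty]
        have := pairwise_disjoint_Ioc_add_intCast (0 : ℝ)
          (show (i : ℤ) ≠ (j : ℤ) by exact_mod_cast hij)
        simpa [I, Function.onFun] using this
      rw [this]
      simp
  exact (Set.infinite_univ (α := ℕ)) (by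
    have := hv.linearIndependent.finite
    exact Set.finite_univ)

/-! ### Compactness of the resolvent -/

theorem coeFn_sum_L2Half {ι : Type*} (s : Finset ι) (f : ι → L2Half) :
    (∑ i ∈ s, f i : L2Half) =ᵐ[halfMeasure] fun x => ∑ i ∈ s, f i x := by
  classical
  induction s using Finset.induction_on with
  | empty => simpa using! Lp.coeFn_zero ℂ 2 halfMeasure
  | insert a s ha ih =>
    rw [Finset.sum_insert ha]
    filter_upwards [Lp.coeFn_add (f a) (∑ i ∈ s, f i), ih] with x h1 h2
    rw [h1, Pi.add_apply, h2, Finset.sum_insert ha]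

/-- The Cauchy–Schwarz inequality against the constant function `1`. -/
theorem sq_integral_Ioc_le {f : ℝ → ℝ} (hf : Continuous f) (a : ℝ) {δ : ℝ} (hδ : 0 < δ) :
    (∫ y in Ioc a (a + δ), f y) ^ 2 ≤ δ * ∫ y in Ioc a (a + δ), f y ^ 2 := by
  set M := ∫ y in Ioc a (a + δ), f y
  have hvol : volume.real (Ioc a (a + δ)) = δ := by simp [hδ.le]
  have h0 : 0 ≤ ∫ y in Ioc a (a + δ), (f y - M / δ) ^ 2 := integral_nonneg fun y => sq_nonneg _
  have h1 : ∫ y in Ioc a (a + δ), (f y - M / δ) ^ 2 =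
      (∫ y in Ioc a (a + δ), f y ^ 2) - M ^ 2 / δ := by
    have e : ∀ y, (f y - M / δ) ^ 2 = f y ^ 2 - (2 * (M / δ) * f y - (M / δ) ^ 2) := fun y => by
      ring
    simp only [e]
    have i1 : IntegrableOn (fun y => f y ^ 2) (Ioc a (a + δ)) :=
      (hf.pow 2).integrableOn_Ioc
    have i2 : IntegrableOn (fun y => 2 * (M / δ) * f y) (Ioc a (a + δ)) :=
      (continuous_const.mul hf).integrableOn_Ioc
    have i3 : IntegrableOn (fun _ : ℝ => (M / δ) ^ 2) (Ioc a (a + δ)) :=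
      continuous_const.integrableOn_Ioc
    rw [integral_sub i1 (by exact i2.sub i3), integral_sub i2 i3, integral_const_mul,
      setIntegral_const, hvol, smul_eq_mul]
    change _ - (2 * (M / δ) * M - _) = _
    field_simp
    ring
  rw [h1, sub_nonneg, div_le_iff₀ hδ] at h0
  linarith

/-- Poincaré's inequality on an interval, in pointwise form. -/
theorem norm_sub_average_sq_le {f : ℝ → ℂ} (hf : Differentiable ℝ f) (hf' : Continuous (deriv f))
    {a δ x : ℝ} (hδ : 0 < δ) (hx : x ∈ Ioc a (a + δ)) :
    ‖f x - (δ⁻¹ : ℂ) * ∫ y in Ioc a (a + δ), f y‖ ^ 2 ≤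
      δ * ∫ y in Ioc a (a + δ), ‖deriv f y‖ ^ 2 := by
  set M := ∫ y in Ioc a (a + δ), ‖deriv f y‖
  have hvol : volume.real (Ioc a (a + δ)) = δ := by simp [hδ.le]
  have hM : ∀ y ∈ Ioc a (a + δ), ‖f x - f y‖ ≤ M := by
    intro y hy
    rw [← intervalIntegral.integral_eq_sub_of_hasDerivAt (f := f) (f' := deriv f)
      (fun z _ => (hf z).hasDerivAt) (hf'.intervalIntegrable _ _)]
    refine (intervalIntegral.norm_integral_le_integral_norm_uIoc).trans ?_
    refine setIntegral_mono_set hf'.norm.integrableOn_Ioc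
      (Eventually.of_forall fun _ => norm_nonneg _) (LE.le.eventuallyLE ?_)
    rw [uIoc]
    exact Ioc_subset_Ioc (le_min hy.1.le hx.1.le) (max_le hy.2 hx.2)
  have h1 : f x - (δ⁻¹ : ℂ) * ∫ y in Ioc a (a + δ), f y
      = (δ⁻¹ : ℂ) * ∫ y in Ioc a (a + δ), (f x - f y) := by
    rw [integral_sub continuous_const.integrableOn_Ioc hf.continuous.integrableOn_Ioc,
      setIntegral_const, hvol]
    have : (δ : ℂ) ≠ 0 := by exact_mod_cast hδ.ne'
    simp only [Complex.real_smul]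
    field_simp
  have h2 : ‖f x - (δ⁻¹ : ℂ) * ∫ y in Ioc a (a + δ), f y‖ ≤ M := by
    rw [h1, norm_mul]
    have h3 := norm_setIntegral_le_of_norm_le_const (μ := volume) (s := Ioc a (a + δ))
      (by simp) hM
    rw [hvol] at h3
    have h4 : ‖(δ⁻¹ : ℂ)‖ = δ⁻¹ := by
      rw [norm_inv, Complex.norm_real, Real.norm_eq_abs, abs_of_pos hδ]
    rw [h4]
    calc δ⁻¹ * _ ≤ δ⁻¹ * (M * δ) := by gcongr
      _ = M := by field_simp
  calc _ ≤ M ^ 2 := by gcongr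
    _ ≤ _ := sq_integral_Ioc_le hf'.norm a hδ

/-- The `k`-th cell `(kδ, kδ + δ]`. -/
def cell (δ : ℝ) (k : ℕ) : Set ℝ := Ioc (k * δ) (k * δ + δ)

theorem measurableSet_cell (δ : ℝ) (k : ℕ) : MeasurableSet (cell δ k) := measurableSet_Ioc

theorem halfMeasure_cell_ne_top (δ : ℝ) (k : ℕ) : halfMeasure (cell δ k) ≠ ⊤ :=
  ((Measure.restrict_apply_le _ _).trans_lt (by simp [cell])).ne

/-- The indicator function of a cell. -/
def cellFn (δ : ℝ) (k : ℕ) : L2Half :=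
  indicatorConstLp 2 (measurableSet_cell δ k) (halfMeasure_cell_ne_top δ k) (1 : ℂ)

/-- The operator which replaces a function by its averages over the first `N` cells, and by zero
on the other ones. -/
def cellAverage (δ : ℝ) (N : ℕ) : L2Half →L[ℂ] L2Half :=
  ∑ k ∈ Finset.range N, (δ⁻¹ : ℂ) • (innerSL ℂ (cellFn δ k)).smulRight (cellFn δ k)

theorem isCompactOperator_cellAverage (δ : ℝ) (N : ℕ) : IsCompactOperator (cellAverage δ N) := by
  unfold cellAverage
  induction N with
  | zero => simpa using! isCompactOperator_zero
  | succ N ih =>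
    rw [Finset.sum_range_succ]
    refine ih.add ?_
    have h : IsCompactOperator (innerSL ℂ (cellFn δ N)) :=
      isCompactOperator_of_locallyCompactSpace_dom _
    exact (h.clm_comp (ContinuousLinearMap.toSpanSingleton ℂ (cellFn δ N))).smul (δ⁻¹ : ℂ)

theorem cell_subset {δ : ℝ} (hδ : 0 < δ) (k : ℕ) : cell δ k ⊆ Ioi 0 := fun _ hx =>
  lt_of_le_of_lt (by positivity) hx.1

theorem pairwise_disjoint_cell {δ : ℝ} (hδ : 0 < δ) :
    Pairwise (Function.onFun Disjoint (cell δ)) := by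
  intro i j hij
  have h : ∀ i j : ℕ, i < j → Disjoint (cell δ i) (cell δ j) := fun i j hij => by
    refine Set.disjoint_left.2 fun x hi hj => ?_
    have h1 : ((i : ℝ) + 1) * δ ≤ j * δ := by
      gcongr
      exact_mod_cast hij
    have := hi.2
    have := hj.1
    linarith
  rcases lt_or_gt_of_ne hij with h' | h'
  · exact h i j h'
  · exact (h j i h').symm

theorem integrable_potential_mul {C β : ℝ} (hC : 0 < C) (hβ : 0 < β) (φ : 𝓓(halfLine, ℂ)) :
    Integrable (fun x => potential C β x * ‖φ x‖ ^ 2) halfMeasure := by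
  refine (integrable_norm_sq (sqrtPotTest C β φ)).congr ?_
  filter_upwards [MemLp.coeFn_toLp (memLp_test (Complex.continuous_ofReal.comp_continuousOn
    (Real.continuous_sqrt.comp_continuousOn (continuousOn_potential C β))) φ),
    ae_restrict_mem measurableSet_Ioi] with x hx hx0
  erw [hx]
  simp only [Function.comp_apply, norm_mul, mul_pow, Complex.norm_real, Real.norm_eq_abs, sq_abs]
  rw [Real.sq_sqrt (potential_pos hC hβ hx0).le]

/-- Averaging over `N` cells of length `δ` is uniformly close to the identity on the unit ball of
the form norm: the derivative controls the error on the cells, and the growth of the potential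
controls the tail beyond `N δ`. -/
theorem norm_sub_cellAverage_sq_le {C β : ℝ} (hC : 0 < C) (hβ : 0 < β) {δ : ℝ} (hδ : 0 < δ) {N : ℕ}
    (hN : 0 < N) (φ : 𝓓(halfLine, ℂ)) :
    ‖inclTest φ - cellAverage δ N (inclTest φ)‖ ^ 2 ≤
      (δ ^ 2 + (N * δ) ^ (-β)) * ‖formVec C β φ‖ ^ 2 := by
  set L : ℝ := N * δ
  have hL : 0 < L := by positivity
  have hφd := differentiable_test φ
  have hφ' := continuous_deriv φ
  let D : ℕ → ℝ := fun k => ∫ y in cell δ k, ‖deriv φ y‖ ^ 2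
  let c : ℕ → ℂ := fun k => (δ⁻¹ : ℂ) * ∫ y in cell δ k, φ y
  have hDi : Integrable (fun x => ‖deriv φ x‖ ^ 2) :=
    Continuous.integrable_of_hasCompactSupport (by fun_prop)
      (φ.hasCompactSupport.deriv.norm.comp_left (g := fun t => t ^ 2) (by simp))
  have hφi : Integrable (fun x => ‖φ x‖ ^ 2) :=
    Continuous.integrable_of_hasCompactSupport (by have := φ.continuous; fun_prop)
      (φ.hasCompactSupport.norm.comp_left (g := fun t => t ^ 2) (by simp))
  -- the averaged function, as a function on the half-line
  have hB : cellAverage δ N (inclTest φ) =ᵐ[halfMeasure]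
      fun x => ∑ k ∈ Finset.range N, (cell δ k).indicator (fun _ => c k) x := by
    have e1 : cellAverage δ N (inclTest φ) =
        ∑ k ∈ Finset.range N, c k • cellFn δ k := by
      simp only [cellAverage, sum_apply, smul_apply,
        ContinuousLinearMap.smulRight_apply, innerSL_apply_apply, smul_smul]
      refine Finset.sum_congr rfl fun k _ => ?_
      congr 2
      rw [cellFn, L2.inner_indicatorConstLp_one]
      rw [Measure.restrict_restrict (measurableSet_cell δ k),
        inter_eq_left.2 (cell_subset hδ k)]
      refine setIntegral_congr_ae (measurableSet_cell δ k) ?_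
      have := (ae_restrict_iff' measurableSet_Ioi).1 (coeFn_inclTest φ)
      filter_upwards [this] with x hx hxk
      exact hx (cell_subset hδ k hxk)
    rw [e1]
    refine (coeFn_sum_L2Half _ _).trans ?_
    have h2 : ∀ᵐ x ∂halfMeasure, ∀ k, (c k • cellFn δ k : L2Half) x
        = (cell δ k).indicator (fun _ => c k) x := by
      rw [ae_all_iff]
      intro k
      filter_upwards [Lp.coeFn_smul (c k) (cellFn δ k),
        indicatorConstLp_coeFn (p := 2) (hs := measurableSet_cell δ k)
          (hμs := halfMeasure_cell_ne_top δ k) (c := (1 : ℂ))] with x h1 h2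
      rw [h1, Pi.smul_apply, cellFn, h2]
      by_cases hx : x ∈ cell δ k <;> simp [hx]
    filter_upwards [h2] with x hx
    exact Finset.sum_congr rfl fun k _ => hx k
  -- pointwise bound: Poincaré on the cells, the potential outside
  have hpt : ∀ᵐ x ∂halfMeasure, ‖(inclTest φ - cellAverage δ N (inclTest φ) : L2Half) x‖ ^ 2 ≤
      (∑ k ∈ Finset.range N, (cell δ k).indicator (fun _ => δ * D k) x) +
        L ^ (-β) * (potential C β x * ‖φ x‖ ^ 2) := by
    filter_upwards [Lp.coeFn_sub (inclTest φ) (cellAverage δ N (inclTest φ)), hB,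
      coeFn_inclTest φ, ae_restrict_mem measurableSet_Ioi] with x h1 h2 h3 hx
    have hx0 : (0 : ℝ) < x := hx
    have hDk : ∀ k, 0 ≤ δ * D k := fun k =>
      mul_nonneg hδ.le (integral_nonneg fun y => by positivity)
    have hq := potential_pos hC hβ hx0
    rw [h1, Pi.sub_apply, h2, h3]
    by_cases hk : ∃ k ∈ Finset.range N, x ∈ cell δ k
    · obtain ⟨k, hkN, hxk⟩ := hk
      have hother : ∀ j, j ≠ k → x ∉ cell δ j := fun j hj hxj =>
        Set.disjoint_left.1 (pairwise_disjoint_cell hδ hj) hxj hxk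
      rw [Finset.sum_eq_single_of_mem k hkN fun j _ hj => indicator_of_notMem (hother j hj) _,
        Finset.sum_eq_single_of_mem k hkN fun j _ hj => indicator_of_notMem (hother j hj) _,
        indicator_of_mem hxk, indicator_of_mem hxk]
      have := norm_sub_average_sq_le hφd hφ' hδ hxk
      have h5 : 0 ≤ L ^ (-β) * (potential C β x * ‖φ x‖ ^ 2) := by positivity
      exact this.trans (le_add_of_nonneg_right h5)
    · push Not at hk
      rw [Finset.sum_eq_zero fun k hkN => indicator_of_notMem (hk k hkN) _, sub_zero]
      have hxL : L ≤ x := by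
        by_contra! hlt
        -- a point of `(0, L)` lies in the cell number `⌈x / δ⌉ - 1`
        obtain ⟨k, hk1⟩ : ∃ k : ℕ, ⌈x / δ⌉₊ = k + 1 :=
          Nat.exists_eq_succ_of_ne_zero (Nat.ceil_pos.2 (by positivity)).ne'
        have h6 : x / δ ≤ k + 1 := by
          have := Nat.le_ceil (x / δ); rw [hk1] at this; exact_mod_cast this
        have h7 : (k : ℝ) < x / δ := Nat.lt_ceil.1 (by omega)
        have h8 : k + 1 ≤ N := by
          rw [← hk1]
          exact Nat.ceil_le.2 ((div_le_iff₀ hδ).2 hlt.le)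
        refine hk k (Finset.mem_range.2 (by omega)) ⟨(lt_div_iff₀ hδ).1 h7, ?_⟩
        have := (div_le_iff₀ hδ).1 h6
        linarith
      have h9 : 1 ≤ L ^ (-β) * potential C β x := by
        have h10 : L ^ β ≤ potential C β x := by
          unfold potential
          have : L ^ β ≤ x ^ β := Real.rpow_le_rpow hL.le hxL hβ.le
          have : 0 ≤ C / x ^ 2 := by positivity
          linarith
        rw [Real.rpow_neg hL.le]
        rw [inv_mul_eq_div, one_le_div (by positivity)]
        exact h10
      calc ‖φ x‖ ^ 2 = 1 * ‖φ x‖ ^ 2 := by ring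
        _ ≤ L ^ (-β) * potential C β x * ‖φ x‖ ^ 2 := by gcongr
        _ ≤ _ := by
          rw [mul_assoc]
          exact le_add_of_nonneg_left (Finset.sum_nonneg fun k _ =>
            indicator_nonneg (fun _ _ => hDk k) _)
  have hqi := integrable_potential_mul hC hβ φ
  have hci : ∀ k, Integrable ((cell δ k).indicator (fun _ => δ * D k)) halfMeasure := fun k =>
    (integrable_indicator_iff (measurableSet_cell δ k)).2
      (integrableOn_const (halfMeasure_cell_ne_top δ k))
  have hvol : ∀ k, halfMeasure.real (cell δ k) = δ := fun k => by
    rw [Measure.real, Measure.restrict_apply (measurableSet_cell δ k),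
      inter_eq_left.2 (cell_subset hδ k), cell, Real.volume_Ioc]
    simp [hδ.le]
  have hDsum : ∑ k ∈ Finset.range N, D k ≤ ‖derivTest φ‖ ^ 2 := by
    rw [norm_sq_derivTest]
    rw [← integral_biUnion_finset (Finset.range N) (fun k _ => measurableSet_cell δ k)
      (fun i _ j _ hij => pairwise_disjoint_cell hδ hij) (fun k _ => hDi.integrableOn)]
    exact setIntegral_le_integral hDi (Eventually.of_forall fun x => by positivity)
  calc ‖inclTest φ - cellAverage δ N (inclTest φ)‖ ^ 2
      ≤ ∫ x in Ioi (0 : ℝ), ((∑ k ∈ Finset.range N, (cell δ k).indicator (fun _ => δ * D k) x) +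
        L ^ (-β) * (potential C β x * ‖φ x‖ ^ 2)) := by
        rw [norm_sq_eq_integral]
        exact integral_mono_ae (integrable_norm_sq _)
          ((integrable_finsetSum _ fun k _ => hci k).add (hqi.const_mul _)) hpt
    _ = δ ^ 2 * (∑ k ∈ Finset.range N, D k) + L ^ (-β) * ‖sqrtPotTest C β φ‖ ^ 2 := by
        rw [integral_add (integrable_finsetSum _ fun k _ => hci k) (hqi.const_mul _),
          integral_finsetSum _ fun k _ => hci k, integral_const_mul, norm_sq_sqrtPotTest hC hβ,
          Finset.mul_sum]
        congr 1
        refine Finset.sum_congr rfl fun k _ => ?_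
        rw [integral_indicator (measurableSet_cell δ k), setIntegral_const, hvol, smul_eq_mul]
        ring
    _ ≤ δ ^ 2 * ‖derivTest φ‖ ^ 2 + L ^ (-β) * ‖sqrtPotTest C β φ‖ ^ 2 := by gcongr
    _ ≤ _ := by
        rw [norm_sq_formVec]
        have h1 : 0 ≤ L ^ (-β) := by positivity
        nlinarith [mul_nonneg (sq_nonneg δ) (sq_nonneg ‖inclTest φ‖),
          mul_nonneg (sq_nonneg δ) (sq_nonneg ‖sqrtPotTest C β φ‖),
          mul_nonneg h1 (sq_nonneg ‖inclTest φ‖), mul_nonneg h1 (sq_nonneg ‖derivTest φ‖)]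

theorem isCompactOperator_of_forall_exists {X Y : Type*} [NormedAddCommGroup X] [NormedSpace ℂ X]
    [NormedAddCommGroup Y] [NormedSpace ℂ Y] [CompleteSpace Y] {T : X →L[ℂ] Y}
    (h : ∀ ε > 0, ∃ S : X →L[ℂ] Y, IsCompactOperator S ∧ ∀ x, ‖T x - S x‖ ≤ ε * ‖x‖) :
    IsCompactOperator T := by
  have hcl : IsClosed {f : X →L[ℂ] Y | IsCompactOperator f} :=
    isClosed_setOfPred_isCompactOperator
  refine hcl.closure_subset (Metric.mem_closure_iff.2 fun ε hε => ?_)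
  obtain ⟨S, hS, hTS⟩ := h (ε / 2) (half_pos hε)
  refine ⟨S, hS, ?_⟩
  rw [dist_eq_norm]
  exact lt_of_le_of_lt (ContinuousLinearMap.opNorm_le_bound _ (half_pos hε).le hTS)
    (half_lt_self hε)

/-- The inclusion of the form domain in `L²` is the norm limit of operators of finite rank. -/
theorem isCompactOperator_formIncl {C β : ℝ} (hC : 0 < C) (hβ : 0 < β) :
    IsCompactOperator (formIncl C β) := by
  refine isCompactOperator_of_forall_exists fun ε hε => ?_
  obtain ⟨δ, hδ, hδε⟩ : ∃ δ : ℝ, 0 < δ ∧ δ ^ 2 < ε ^ 2 / 2 := by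
    refine ⟨ε / 2, by positivity, ?_⟩
    nlinarith [sq_nonneg ε, mul_pos hε hε]
  obtain ⟨N, hN, hNε⟩ : ∃ N : ℕ, 0 < N ∧ ((N : ℝ) * δ) ^ (-β) < ε ^ 2 / 2 := by
    have h1 : Tendsto (fun N : ℕ => ((N : ℝ) * δ) ^ (-β)) atTop (𝓝 0) :=
      (tendsto_rpow_neg_atTop hβ).comp (tendsto_natCast_atTop_atTop.atTop_mul_const hδ)
    have h2 := (h1.eventually (gt_mem_nhds (show (0 : ℝ) < ε ^ 2 / 2 by positivity))).and
      (eventually_gt_atTop 0)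
    obtain ⟨N, h3, h4⟩ := h2.exists
    exact ⟨N, h4, h3⟩
  refine ⟨cellAverage δ N ∘L formIncl C β,
    (isCompactOperator_cellAverage δ N).comp_clm (formIncl C β), fun h => ?_⟩
  obtain ⟨φ, hφ⟩ := exists_seq_formVec h.2
  have hfst : Continuous fun h : FormSpace => h.fst :=
    (WithLp.fstL 2 ℂ L2Half (WithLp 2 (L2Half × L2Half))).continuous
  have c1 : Continuous fun h : FormSpace => ‖h.fst - cellAverage δ N h.fst‖ :=
    (hfst.sub ((cellAverage δ N).continuous.comp hfst)).norm
  refine le_of_tendsto_of_tendsto' ((c1.tendsto _).comp hφ)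
    ((hφ.norm).const_mul ε) fun n => ?_
  simp only [Function.comp_apply, formVec_fst]
  refine le_of_sq_le_sq ?_ (by positivity)
  refine (norm_sub_cellAverage_sq_le hC hβ hδ hN (φ n)).trans ?_
  rw [mul_pow]
  gcongr
  linarith

theorem isCompactOperator_resolvent {C β : ℝ} (hC : 0 < C) (hβ : 0 < β) :
    IsCompactOperator (resolvent C β) :=
  (isCompactOperator_formIncl hC hβ).comp_clm (formAdj C β)

/-! ### The eigenbasis -/

/-- `(e j)` is a Hilbert basis of eigenvectors of `P`, with positive eigenvalues `μ j`; the
eigenvalue equation is stated for the operator `(1 + P)⁻¹`. -/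
structure IsEigenbasis (C β : ℝ) (μ : ℕ → ℝ) (e : HilbertBasis ℕ ℂ L2Half) : Prop where
  pos : ∀ j, 0 < μ j
  resolvent_apply : ∀ j, resolvent C β (e j) = ((1 + μ j)⁻¹ : ℂ) • e j

/-- The spectral theorem for the compact operator `(1 + P)⁻¹`. -/
theorem exists_isEigenbasis {C β : ℝ} (hC : 0 < C) (hβ : 0 < β) :
    ∃ (μ : ℕ → ℝ) (e : HilbertBasis ℕ ℂ L2Half),
      Monotone μ ∧ Tendsto μ atTop atTop ∧ IsEigenbasis C β μ e := by
  obtain ⟨μ, e, h1, h2, h3, h4⟩ := exists_hilbertBasis_eigenvectors not_finiteDimensional_L2Half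
    (isCompactOperator_resolvent hC hβ) (resolvent_isSymmetric C β)
    fun r v hv hr => resolvent_eigenvalue hC hβ hv hr
  exact ⟨μ, e, h1, h2, h3, h4⟩

section Eigenbasis

variable {C β : ℝ} {μ : ℕ → ℝ} {e : HilbertBasis ℕ ℂ L2Half}

theorem IsEigenbasis.one_add_ne_zero (he : IsEigenbasis C β μ e) (j : ℕ) : (1 + μ j : ℂ) ≠ 0 := by
  have := he.pos j
  exact_mod_cast (by linarith : (1 + μ j : ℝ) ≠ 0)

theorem IsEigenbasis.mem_graph (he : IsEigenbasis C β μ e) (hC : 0 < C) (hβ : 0 < β) (j : ℕ) :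
    (e j, (μ j : ℂ) • e j) ∈ (schrodinger C β).graph := by
  have h := resolvent_mem_graph hC hβ (e j)
  have h' := Submodule.smul_mem _ (1 + μ j : ℂ) h
  rw [he.resolvent_apply, Prod.smul_mk, smul_sub, smul_smul,
    mul_inv_cancel₀ (he.one_add_ne_zero j), one_smul, add_smul, one_smul, add_sub_cancel_left] at h'
  exact h'

theorem IsEigenbasis.isEigenvalueSequence (he : IsEigenbasis C β μ e) (hC : 0 < C) (hβ : 0 < β)
    (hmono : Monotone μ) (hlim : Tendsto μ atTop atTop) :
    IsEigenvalueSequence (schrodinger C β) μ := by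
  refine ⟨hmono, hlim, e, fun j => ?_⟩
  obtain ⟨u, hu, hAu⟩ := (LinearPMap.mem_graph_iff _).1 (he.mem_graph hC hβ j)
  exact ⟨u, hu, hAu⟩

/-- The weak form of the eigenvalue equation. -/
theorem IsEigenbasis.inner_schrodingerTest (he : IsEigenbasis C β μ e) (hC : 0 < C) (hβ : 0 < β)
    (ψ : 𝓓(halfLine, ℂ)) (j : ℕ) :
    ⟪schrodingerTest C β ψ, e j⟫_ℂ = μ j * ⟪inclTest ψ, e j⟫_ℂ := by
  have h := he.mem_graph hC hβ j
  rw [schrodinger_graph] at h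
  rw [h.2 ψ, inner_smul_right]

/-- An eigenvector is the `L²`-limit of test functions which converge for the form norm. -/
theorem IsEigenbasis.exists_seq (he : IsEigenbasis C β μ e) (hC : 0 < C) (hβ : 0 < β) (j : ℕ) :
    ∃ (φ : ℕ → 𝓓(halfLine, ℂ)) (h : FormSpace), Tendsto (fun n => formVec C β (φ n)) atTop (𝓝 h) ∧
      h.fst = e j ∧ ∀ ψ, ⟪formVec C β ψ, h⟫_ℂ = (1 + μ j) * ⟪inclTest ψ, e j⟫_ℂ := by
  have hmem := Submodule.smul_mem (formClosure C β) (1 + μ j : ℂ) (formAdj C β (e j)).2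
  obtain ⟨φ, hφ⟩ := exists_seq_formVec hmem
  have hfst : ((1 + μ j : ℂ) • (formAdj C β (e j) : FormSpace)).fst = e j := by
    have : (formAdj C β (e j) : FormSpace).fst = resolvent C β (e j) := rfl
    rw [WithLp.smul_fst, this, he.resolvent_apply, smul_smul,
      mul_inv_cancel₀ (he.one_add_ne_zero j), one_smul]
  refine ⟨φ, _, hφ, hfst, fun ψ => ?_⟩
  rw [inner_formVec_of_mem hC hβ ψ hmem, hfst, inner_add_left, he.inner_schrodingerTest hC hβ]
  ring

end Eigenbasis

/-! ### Multiplication operators -/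

/-- Multiplication by a bounded real function as an operator on `L²`. -/
def mulBdd {w : ℝ → ℝ} (hw : MemLp (fun x => (w x : ℂ)) ⊤ halfMeasure) : L2Half →L[ℂ] L2Half :=
  (ContinuousLinearMap.mul ℂ ℂ).holderL halfMeasure ⊤ 2 2 (hw.toLp _)

theorem coeFn_mulBdd {w : ℝ → ℝ} (hw : MemLp (fun x => (w x : ℂ)) ⊤ halfMeasure) (u : L2Half) :
    mulBdd hw u =ᵐ[halfMeasure] fun x => w x * u x := by
  filter_upwards [(ContinuousLinearMap.mul ℂ ℂ).coeFn_holder (r := 2) (hw.toLp _) u,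
    hw.coeFn_toLp] with x h1 h2
  refine h1.trans ?_
  simp [h2]

theorem inner_mulBdd {w : ℝ → ℝ} (hw : MemLp (fun x => (w x : ℂ)) ⊤ halfMeasure) (u v : L2Half) :
    ⟪u, mulBdd hw v⟫_ℂ = ⟪mulBdd hw u, v⟫_ℂ := by
  rw [L2.inner_def, L2.inner_def]
  refine integral_congr_ae ?_
  filter_upwards [coeFn_mulBdd hw u, coeFn_mulBdd hw v] with x h1 h2
  rw [h1, h2]
  simp only [RCLike.inner_apply, map_mul, Complex.conj_ofReal]
  ring

theorem norm_sq_mulBdd {w : ℝ → ℝ} (hw : MemLp (fun x => (w x : ℂ)) ⊤ halfMeasure) (u : L2Half) :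
    ‖mulBdd hw u‖ ^ 2 = ∫ x in Ioi (0 : ℝ), w x ^ 2 * ‖u x‖ ^ 2 := by
  rw [norm_sq_eq_integral]
  refine integral_congr_ae ?_
  filter_upwards [coeFn_mulBdd hw u] with x h1
  rw [h1, norm_mul, mul_pow, Complex.norm_real, Real.norm_eq_abs, sq_abs]

/-- The product of a smooth function and a test function. -/
def smulTest {η : ℝ → ℝ} (hη : ContDiff ℝ ∞ η) (φ : 𝓓(halfLine, ℂ)) : 𝓓(halfLine, ℂ) where
  toFun x := η x * φ x
  contDiff' := (Complex.ofRealCLM.contDiff.comp hη).mul φ.contDiff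
  hasCompactSupport' := φ.hasCompactSupport.mul_left
  tsupport_subset' := (tsupport_mul_subset_right (f := fun x => (η x : ℂ))).trans φ.tsupport_subset

theorem smulTest_apply {η : ℝ → ℝ} (hη : ContDiff ℝ ∞ η) (φ : 𝓓(halfLine, ℂ)) (x : ℝ) :
    smulTest hη φ x = η x * φ x := rfl

theorem deriv_smulTest {η : ℝ → ℝ} (hη : ContDiff ℝ ∞ η) (φ : 𝓓(halfLine, ℂ)) (x : ℝ) :
    deriv (smulTest hη φ) x = ((deriv η x : ℝ) : ℂ) * φ x + η x * deriv φ x := by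
  have h1 : HasDerivAt (fun x => (η x : ℂ)) ((deriv η x : ℝ) : ℂ) x :=
    ((hη.differentiable (by simp)) x).hasDerivAt.ofReal_comp
  exact (h1.mul (differentiable_test φ x).hasDerivAt).deriv

theorem inclTest_smulTest {η : ℝ → ℝ} (hη : ContDiff ℝ ∞ η)
    (hw : MemLp (fun x => (η x : ℂ)) ⊤ halfMeasure) (φ : 𝓓(halfLine, ℂ)) :
    inclTest (smulTest hη φ) = mulBdd hw (inclTest φ) := by
  refine Lp.ext ?_
  filter_upwards [coeFn_mulBdd hw (inclTest φ), coeFn_inclTest φ, coeFn_inclTest (smulTest hη φ)]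
    with x h1 h2 h3
  rw [h1, h2, h3, smulTest_apply]

theorem memLp_top_of_bounded {η : ℝ → ℝ} (hη : Continuous η) {M : ℝ} (hM : ∀ x, |η x| ≤ M) :
    MemLp (fun x => (η x : ℂ)) ⊤ halfMeasure :=
  memLp_top_of_bound (Complex.continuous_ofReal.comp hη).aestronglyMeasurable M
    (Eventually.of_forall fun x => by simpa using hM x)

/-! ### Energy of localized eigenvectors -/

section Localization

variable {C β : ℝ} {η : ℝ → ℝ} {a M : ℝ}

theorem re_inner_sqrtPotTest_smulTest (hη : ContDiff ℝ ∞ η)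
    (φ : 𝓓(halfLine, ℂ)) :
    (⟪sqrtPotTest C β (smulTest hη (smulTest hη φ)), sqrtPotTest C β φ⟫_ℂ).re =
      ‖sqrtPotTest C β (smulTest hη φ)‖ ^ 2 := by
  have h : ⟪sqrtPotTest C β (smulTest hη (smulTest hη φ)), sqrtPotTest C β φ⟫_ℂ =
      ⟪sqrtPotTest C β (smulTest hη φ), sqrtPotTest C β (smulTest hη φ)⟫_ℂ := by
    refine (inner_mulTest _ _ _ _).trans (Eq.trans ?_ (inner_mulTest _ _ _ _).symm)
    congr 1
    ext x
    simp only [smulTest_apply, RCLike.inner_apply, map_mul, Complex.conj_ofReal]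
    ring
  rw [h, inner_self_complex, Complex.ofReal_re]

theorem re_inner_inclTest_smulTest (hη : ContDiff ℝ ∞ η) (φ : 𝓓(halfLine, ℂ)) :
    (⟪inclTest (smulTest hη (smulTest hη φ)), inclTest φ⟫_ℂ).re =
      ‖inclTest (smulTest hη φ)‖ ^ 2 := by
  have h : ⟪inclTest (smulTest hη (smulTest hη φ)), inclTest φ⟫_ℂ =
      ⟪inclTest (smulTest hη φ), inclTest (smulTest hη φ)⟫_ℂ := by
    refine (inner_mulTest _ _ _ _).trans (Eq.trans ?_ (inner_mulTest _ _ _ _).symm)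
    congr 1
    ext x
    simp only [smulTest_apply, RCLike.inner_apply, map_mul, Complex.conj_ofReal]
    ring
  rw [h, inner_self_complex, Complex.ofReal_re]

/-- Localization formula: `Re ⟨(η² φ)', φ'⟩ = ‖(η φ)'‖² - ‖η' φ‖²`, with the last term estimated
through `|η'| ≤ a η`. -/
theorem norm_sq_derivTest_smulTest_le (hη : ContDiff ℝ ∞ η) (hηa : ∀ x, |deriv η x| ≤ a * η x)
    (φ : 𝓓(halfLine, ℂ)) :
    ‖derivTest (smulTest hη φ)‖ ^ 2 ≤
      (⟪derivTest (smulTest hη (smulTest hη φ)), derivTest φ⟫_ℂ).re +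
        a ^ 2 * ‖inclTest (smulTest hη φ)‖ ^ 2 := by
  have hr : (⟪derivTest (smulTest hη (smulTest hη φ)), derivTest φ⟫_ℂ).re =
      ∫ x, (⟪deriv (smulTest hη (smulTest hη φ)) x, deriv φ x⟫_ℂ).re := by
    have h1 : ⟪derivTest (smulTest hη (smulTest hη φ)), derivTest φ⟫_ℂ =
        ∫ x, ⟪deriv (smulTest hη (smulTest hη φ)) x, deriv φ x⟫_ℂ := by
      rw [← setIntegral_Ioi_eq fun x hx => by simp [deriv_test_eq_zero φ hx]]
      exact inner_toLp (memLp_deriv (smulTest hη (smulTest hη φ))) (memLp_deriv φ)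
    have hint : Integrable fun x => ⟪deriv (smulTest hη (smulTest hη φ)) x, deriv φ x⟫_ℂ := by
      refine Continuous.integrable_of_hasCompactSupport
        ((continuous_deriv _).inner (continuous_deriv φ)) ?_
      refine φ.hasCompactSupport.deriv.mono fun x hx => ?_
      rw [Function.mem_support] at hx ⊢
      exact fun h0 => hx (by rw [h0, inner_zero_right])
    rw [h1]
    exact (integral_re hint).symm
  rw [hr, norm_sq_derivTest, norm_sq_inclTest, ← integral_const_mul, ← integral_add]
  · refine integral_mono ?_ ?_ fun x => ?_
    · exact Continuous.integrable_of_hasCompactSupport ((continuous_deriv _).norm.pow 2)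
        ((smulTest hη φ).hasCompactSupport.deriv.norm.comp_left (g := fun t => t ^ 2) (by simp))
    · refine Continuous.integrable_of_hasCompactSupport (Continuous.add
        (Complex.continuous_re.comp ((continuous_deriv _).inner (continuous_deriv φ)))
        (((smulTest hη φ).continuous.norm.pow 2).const_mul _)) (HasCompactSupport.add ?_ ?_)
      · refine φ.hasCompactSupport.deriv.mono fun x hx => ?_
        rw [Function.mem_support] at hx ⊢
        exact fun h0 => hx (by simp [h0])
      · exact ((smulTest hη φ).hasCompactSupport.norm.comp_left
          (g := fun t => t ^ 2) (by simp)).mul_left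
    · have hsq : deriv η x ^ 2 ≤ a ^ 2 * η x ^ 2 := by
        rw [← mul_pow, ← sq_abs (deriv η x)]
        exact pow_le_pow_left₀ (abs_nonneg _) (hηa x) 2
      have h2 : 0 ≤ (φ x).re ^ 2 + (φ x).im ^ 2 := by positivity
      have h3 := mul_le_mul_of_nonneg_right hsq h2
      simp only [deriv_smulTest, smulTest_apply, ← Complex.normSq_eq_norm_sq, Complex.normSq_apply,
        RCLike.inner_apply, map_mul, map_add, Complex.conj_ofReal, Complex.add_re, Complex.mul_re,
        Complex.add_im, Complex.mul_im, Complex.ofReal_re, Complex.ofReal_im, Complex.conj_re,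
        Complex.conj_im]
      nlinarith [h3]
  · refine Continuous.integrable_of_hasCompactSupport
        (Complex.continuous_re.comp ((continuous_deriv _).inner (continuous_deriv φ))) ?_
    refine φ.hasCompactSupport.deriv.mono fun x hx => ?_
    rw [Function.mem_support] at hx ⊢
    exact fun h0 => hx (by simp [h0])
  · exact Continuous.integrable_of_hasCompactSupport
      (((smulTest hη φ).continuous.norm.pow 2).const_mul _)
      ((smulTest hη φ).hasCompactSupport.norm.comp_left (g := fun t => t ^ 2) (by simp)).mul_left

/-- The quadratic form `∫ (|φ'|² + q |φ|²)` of `P` on test functions. -/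
def energy (C β : ℝ) (φ : 𝓓(halfLine, ℂ)) : ℝ := ‖derivTest φ‖ ^ 2 + ‖sqrtPotTest C β φ‖ ^ 2

/-- The energy of `η φ`, estimated through the form norm product of `η² φ` and `φ`. In the limit of
an eigenvector `φ` that product becomes `(1 + μ) ‖η φ‖²`. -/
theorem energy_smulTest_le (hη : ContDiff ℝ ∞ η)
    (hηa : ∀ x, |deriv η x| ≤ a * η x) (φ : 𝓓(halfLine, ℂ)) :
    energy C β (smulTest hη φ) ≤
      (⟪formVec C β (smulTest hη (smulTest hη φ)), formVec C β φ⟫_ℂ).re +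
        (a ^ 2 - 1) * ‖inclTest (smulTest hη φ)‖ ^ 2 := by
  have h1 : ⟪formVec C β (smulTest hη (smulTest hη φ)), formVec C β φ⟫_ℂ =
      ⟪inclTest (smulTest hη (smulTest hη φ)), inclTest φ⟫_ℂ +
      (⟪derivTest (smulTest hη (smulTest hη φ)), derivTest φ⟫_ℂ +
      ⟪sqrtPotTest C β (smulTest hη (smulTest hη φ)), sqrtPotTest C β φ⟫_ℂ) := by
    rw [WithLp.prod_inner_apply, WithLp.prod_inner_apply]
    rfl
  rw [h1, Complex.add_re, Complex.add_re, re_inner_sqrtPotTest_smulTest,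
    re_inner_inclTest_smulTest, energy]
  linarith [norm_sq_derivTest_smulTest_le hη hηa φ]

/-- Multiplication by `η` is bounded for the form norm. -/
theorem norm_formVec_smulTest_le (hη : ContDiff ℝ ∞ η)
    (hηa : ∀ x, |deriv η x| ≤ a * η x) (hM : ∀ x, |η x| ≤ M) (φ : 𝓓(halfLine, ℂ)) :
    ‖formVec C β (smulTest hη φ)‖ ^ 2 ≤ (2 * a ^ 2 + 2) * M ^ 2 * ‖formVec C β φ‖ ^ 2 := by
  have hM2 : ∀ x, η x ^ 2 ≤ M ^ 2 := fun x => by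
    rw [← sq_abs (η x)]
    exact pow_le_pow_left₀ (abs_nonneg _) (hM x) 2
  have h1 : ‖inclTest (smulTest hη φ)‖ ^ 2 ≤ M ^ 2 * ‖inclTest φ‖ ^ 2 := by
    rw [norm_sq_inclTest, norm_sq_inclTest, ← integral_const_mul]
    refine integral_mono ?_ ?_ fun x => ?_
    · exact Continuous.integrable_of_hasCompactSupport ((smulTest hη φ).continuous.norm.pow 2)
        ((smulTest hη φ).hasCompactSupport.norm.comp_left (g := fun t => t ^ 2) (by simp))
    · exact Continuous.integrable_of_hasCompactSupport ((φ.continuous.norm.pow 2).const_mul _)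
        (φ.hasCompactSupport.norm.comp_left (g := fun t => t ^ 2) (by simp)).mul_left
    · simp only [smulTest_apply, norm_mul, mul_pow, Complex.norm_real, Real.norm_eq_abs, sq_abs]
      exact mul_le_mul_of_nonneg_right (hM2 x) (by positivity)
  have h2 : ‖sqrtPotTest C β (smulTest hη φ)‖ ^ 2 ≤ M ^ 2 * ‖sqrtPotTest C β φ‖ ^ 2 := by
    have hw : MemLp (fun x => (η x : ℂ)) ⊤ halfMeasure := memLp_top_of_bounded hη.continuous hM
    have hint := fun φ => integrable_norm_sq (sqrtPotTest C β φ)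
    have hae : ∀ φ : 𝓓(halfLine, ℂ), (fun x => ‖sqrtPotTest C β φ x‖ ^ 2) =ᵐ[halfMeasure]
        fun x => ‖(√(potential C β x) : ℂ) * φ x‖ ^ 2 := fun φ => by
      filter_upwards [MemLp.coeFn_toLp (memLp_test (Complex.continuous_ofReal.comp_continuousOn
        (Real.continuous_sqrt.comp_continuousOn (continuousOn_potential C β))) φ)] with x hx
      erw [hx]
      rfl
    rw [norm_sq_eq_integral, norm_sq_eq_integral, ← integral_const_mul]
    refine integral_mono_ae (hint _) ((hint _).const_mul _) ?_
    filter_upwards [hae φ, hae (smulTest hη φ)] with x e1 e2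
    rw [e1, e2]
    simp only [smulTest_apply, norm_mul, mul_pow, Complex.norm_real, Real.norm_eq_abs, sq_abs]
    have h3 := hM2 x
    have h4 : 0 ≤ √(potential C β x) ^ 2 * ‖φ x‖ ^ 2 := by positivity
    nlinarith
  have h3 : ‖derivTest (smulTest hη φ)‖ ^ 2 ≤
      2 * a ^ 2 * M ^ 2 * ‖inclTest φ‖ ^ 2 + 2 * M ^ 2 * ‖derivTest φ‖ ^ 2 := by
    have i1 : Integrable fun x => ‖φ x‖ ^ 2 :=
      Continuous.integrable_of_hasCompactSupport (φ.continuous.norm.pow 2)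
        (φ.hasCompactSupport.norm.comp_left (g := fun t => t ^ 2) (by simp))
    have i2 : Integrable fun x => ‖deriv φ x‖ ^ 2 :=
      Continuous.integrable_of_hasCompactSupport ((continuous_deriv φ).norm.pow 2)
        (φ.hasCompactSupport.deriv.norm.comp_left (g := fun t => t ^ 2) (by simp))
    rw [norm_sq_derivTest, norm_sq_derivTest, norm_sq_inclTest, ← integral_const_mul,
      ← integral_const_mul, ← integral_add (i1.const_mul _) (i2.const_mul _)]
    refine integral_mono ?_ ((i1.const_mul _).add (i2.const_mul _)) fun x => ?_
    · exact Continuous.integrable_of_hasCompactSupport ((continuous_deriv _).norm.pow 2)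
        ((smulTest hη φ).hasCompactSupport.deriv.norm.comp_left (g := fun t => t ^ 2) (by simp))
    · have hsq : deriv η x ^ 2 ≤ a ^ 2 * M ^ 2 := by
        have : deriv η x ^ 2 ≤ a ^ 2 * η x ^ 2 := by
          rw [← mul_pow, ← sq_abs (deriv η x)]
          exact pow_le_pow_left₀ (abs_nonneg _) (hηa x) 2
        exact this.trans (mul_le_mul_of_nonneg_left (hM2 x) (sq_nonneg a))
      have e1 : ‖((deriv η x : ℝ) : ℂ) * φ x‖ ^ 2 ≤ a ^ 2 * M ^ 2 * ‖φ x‖ ^ 2 := by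
        simp only [norm_mul, mul_pow, Complex.norm_real, Real.norm_eq_abs, sq_abs]
        exact mul_le_mul_of_nonneg_right hsq (by positivity)
      have e2 : ‖(η x : ℂ) * deriv φ x‖ ^ 2 ≤ M ^ 2 * ‖deriv φ x‖ ^ 2 := by
        simp only [norm_mul, mul_pow, Complex.norm_real, Real.norm_eq_abs, sq_abs]
        exact mul_le_mul_of_nonneg_right (hM2 x) (by positivity)
      have e3 := norm_add_le (((deriv η x : ℝ) : ℂ) * φ x) ((η x : ℂ) * deriv φ x)
      have e4 := pow_le_pow_left₀ (norm_nonneg _) e3 2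
      simp only [deriv_smulTest]
      nlinarith [sq_nonneg (‖((deriv η x : ℝ) : ℂ) * φ x‖ - ‖(η x : ℂ) * deriv φ x‖)]
  rw [norm_sq_formVec, norm_sq_formVec]
  have p1 := mul_nonneg (sq_nonneg M) (sq_nonneg ‖inclTest φ‖)
  have p2 := mul_nonneg (sq_nonneg M) (sq_nonneg ‖derivTest φ‖)
  have p3 := mul_nonneg (sq_nonneg M) (sq_nonneg ‖sqrtPotTest C β φ‖)
  have p4 := mul_nonneg (sq_nonneg a) p2
  have p5 := mul_nonneg (sq_nonneg a) p3
  nlinarith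

/-- For an eigenvector `e j` and a function `η` with `|η'| ≤ a η`, the product `η e j` is an
`L²`-limit of test functions `f n` whose energies are asymptotically at most
`(μ j + a²) ‖η e j‖²`. -/
theorem IsEigenbasis.exists_seq_energy_le {μ : ℕ → ℝ} {e : HilbertBasis ℕ ℂ L2Half}
    (he : IsEigenbasis C β μ e) (hC : 0 < C) (hβ : 0 < β) (hη : ContDiff ℝ ∞ η)
    (hηa : ∀ x, |deriv η x| ≤ a * η x) (hM : ∀ x, |η x| ≤ M)
    (hw : MemLp (fun x => (η x : ℂ)) ⊤ halfMeasure) (j : ℕ) :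
    ∃ (f : ℕ → 𝓓(halfLine, ℂ)) (b : ℕ → ℝ),
      Tendsto (fun n => inclTest (f n)) atTop (𝓝 (mulBdd hw (e j))) ∧
      (∀ n, energy C β (f n) ≤ b n) ∧
      Tendsto b atTop (𝓝 ((μ j + a ^ 2) * ‖mulBdd hw (e j)‖ ^ 2)) := by
  obtain ⟨φ, h, hφ, hfst, hinner⟩ := he.exists_seq hC hβ j
  have hincl : Tendsto (fun n => inclTest (φ n)) atTop (𝓝 (e j)) := by
    have := ((WithLp.fstL 2 ℂ L2Half (WithLp 2 (L2Half × L2Half))).continuous.tendsto h).comp hφ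
    rw [← hfst]
    exact this
  have hlim : Tendsto (fun n => inclTest (smulTest hη (φ n))) atTop (𝓝 (mulBdd hw (e j))) := by
    simp only [inclTest_smulTest hη hw]
    exact ((mulBdd hw).continuous.tendsto _).comp hincl
  refine ⟨fun n => smulTest hη (φ n), fun n =>
    (⟪formVec C β (smulTest hη (smulTest hη (φ n))), formVec C β (φ n)⟫_ℂ).re +
        (a ^ 2 - 1) * ‖inclTest (smulTest hη (φ n))‖ ^ 2, hlim,
    fun n => energy_smulTest_le hη hηa (φ n), ?_⟩
  have hnorm := (hlim.norm.pow 2).const_mul (a ^ 2 - 1)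
  -- the form is tested against `η² φ n`; the error term is a bounded sequence times a null one
  have hmain : Tendsto (fun n => ⟪formVec C β (smulTest hη (smulTest hη (φ n))),
      formVec C β (φ n)⟫_ℂ) atTop (𝓝 ((1 + μ j) * ⟪mulBdd hw (e j), mulBdd hw (e j)⟫_ℂ)) := by
    have h1 : ∀ n, ⟪formVec C β (smulTest hη (smulTest hη (φ n))), formVec C β (φ n)⟫_ℂ =
        (1 + μ j) * ⟪inclTest (smulTest hη (φ n)), mulBdd hw (e j)⟫_ℂ +
          ⟪formVec C β (smulTest hη (smulTest hη (φ n))), formVec C β (φ n) - h⟫_ℂ := fun n => by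
      rw [inner_sub_right, hinner, inclTest_smulTest hη hw (smulTest hη (φ n)), inner_mulBdd]
      ring
    simp only [h1]
    rw [← add_zero ((1 + μ j) * ⟪mulBdd hw (e j), mulBdd hw (e j)⟫_ℂ)]
    refine ((hlim.inner tendsto_const_nhds).const_mul _).add ?_
    set K := (2 * a ^ 2 + 2) * M ^ 2
    have hK : 0 ≤ K := by positivity
    have hb : ∀ n, ‖formVec C β (smulTest hη (smulTest hη (φ n)))‖ ≤ K * ‖formVec C β (φ n)‖ := by
      intro n
      refine le_of_sq_le_sq ?_ (by positivity)
      have e1 := norm_formVec_smulTest_le (C := C) (β := β) hη hηa hM (smulTest hη (φ n))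
      have e2 := mul_le_mul_of_nonneg_left
        (norm_formVec_smulTest_le (C := C) (β := β) hη hηa hM (φ n)) hK
      calc _ ≤ _ := e1
        _ ≤ _ := e2
        _ = _ := by ring
    have hz : Tendsto (fun n => K * ‖formVec C β (φ n)‖ * ‖formVec C β (φ n) - h‖) atTop
        (𝓝 (K * ‖h‖ * ‖h - h‖)) :=
      ((hφ.norm).const_mul K).mul (hφ.sub_const h).norm
    rw [sub_self, norm_zero, mul_zero] at hz
    refine squeeze_zero_norm (fun n => ?_) hz
    exact (norm_inner_le_norm _ _).trans (mul_le_mul_of_nonneg_right (hb n) (norm_nonneg _))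
  have hre := (Complex.continuous_re.tendsto _).comp hmain
  rw [inner_self_complex] at hre
  have hval : ((1 + μ j : ℂ) * ((‖mulBdd hw (e j)‖ ^ 2 : ℝ) : ℂ)).re =
      (1 + μ j) * ‖mulBdd hw (e j)‖ ^ 2 := by
    rw [← Complex.ofReal_one, ← Complex.ofReal_add, ← Complex.ofReal_mul, Complex.ofReal_re]
  rw [hval] at hre
  have := hre.add hnorm
  have hlim' : (μ j + a ^ 2) * ‖mulBdd hw (e j)‖ ^ 2 =
      (1 + μ j) * ‖mulBdd hw (e j)‖ ^ 2 + (a ^ 2 - 1) * ‖mulBdd hw (e j)‖ ^ 2 := by ring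
  rw [hlim']
  exact this

end Localization

/-! ### The window and the coherent states -/

theorem hasCompactSupport_sq {f : ℝ → ℝ} (hf : HasCompactSupport f) :
    HasCompactSupport fun x => f x ^ 2 :=
  hf.comp_left (g := fun t : ℝ => t ^ 2) (by simp)

theorem hasCompactSupport_comp_sub {f : ℝ → ℝ} (hf : HasCompactSupport f) (q : ℝ) :
    HasCompactSupport fun x => f (x - q) := by
  simpa [sub_eq_add_neg] using! hf.comp_homeomorph (Homeomorph.addRight (-q))

theorem exists_window : ∃ g : ℝ → ℝ, ContDiff ℝ ∞ g ∧ HasCompactSupport g ∧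
    tsupport g ⊆ Ioo 0 1 ∧ ∫ x, g x ^ 2 = 1 := by
  let b : ContDiffBump (1 / 2 : ℝ) := ⟨1 / 8, 1 / 4, by norm_num, by norm_num⟩
  have hb : ContDiff ℝ ∞ (b : ℝ → ℝ) := b.contDiff
  have hpos : 0 < ∫ x, b x ^ 2 := by
    refine (hb.continuous.pow 2).integral_pos_of_hasCompactSupport_nonneg_nonzero
      (hasCompactSupport_sq b.hasCompactSupport)
      (fun x => sq_nonneg _) (x := 1 / 2) ?_
    have h1 : b (1 / 2) = 1 := b.one_of_mem_closedBall (by simp [b])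
    rw [h1]
    simp
  refine ⟨fun x => (√(∫ x, b x ^ 2))⁻¹ * b x, contDiff_const.mul hb,
    b.hasCompactSupport.mul_left, ?_, ?_⟩
  · refine (tsupport_mul_subset_right (f := fun _ => (√(∫ x, b x ^ 2))⁻¹)).trans ?_
    rw [b.tsupport_eq, Real.closedBall_eq_Icc]
    intro x hx
    simp only [b, mem_Icc] at hx
    constructor <;> linarith [hx.1, hx.2]
  · simp only [mul_pow, inv_pow, Real.sq_sqrt hpos.le]
    rw [integral_const_mul, inv_mul_cancel₀ hpos.ne']

/-- A fixed smooth window, supported in `(0, 1)` and normalized in `L²`. -/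
def window : ℝ → ℝ := exists_window.choose

theorem window_contDiff : ContDiff ℝ ∞ window := exists_window.choose_spec.1

theorem window_hasCompactSupport : HasCompactSupport window := exists_window.choose_spec.2.1

theorem window_tsupport : tsupport window ⊆ Ioo 0 1 := exists_window.choose_spec.2.2.1

theorem integral_window_sq : ∫ x, window x ^ 2 = 1 := exists_window.choose_spec.2.2.2

theorem window_continuous : Continuous window := window_contDiff.continuous

theorem window_differentiable : Differentiable ℝ window := window_contDiff.differentiable (by simp)

theorem deriv_window_continuous : Continuous (deriv window) :=
  window_contDiff.continuous_deriv (by simp)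

theorem mem_Ioo_of_window_ne_zero {x : ℝ} (hx : window x ≠ 0) : x ∈ Ioo 0 1 :=
  window_tsupport (subset_tsupport _ hx)

attribute [irreducible] window

/-- The kinetic energy of the window. -/
def windowEnergy : ℝ := ∫ x, deriv window x ^ 2

theorem windowEnergy_nonneg : 0 ≤ windowEnergy := integral_nonneg fun _ => sq_nonneg _

theorem integrable_window_sq : Integrable fun x => window x ^ 2 :=
  (window_continuous.pow 2).integrable_of_hasCompactSupport
    (hasCompactSupport_sq window_hasCompactSupport)

theorem integrable_deriv_window_sq : Integrable fun x => deriv window x ^ 2 :=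
  (deriv_window_continuous.pow 2).integrable_of_hasCompactSupport
    (hasCompactSupport_sq window_hasCompactSupport.deriv)

theorem integrable_window_mul_deriv : Integrable fun x => window x * deriv window x :=
  (window_continuous.mul deriv_window_continuous).integrable_of_hasCompactSupport
    window_hasCompactSupport.mul_right

theorem integral_window_mul_deriv : ∫ x, window x * deriv window x = 0 := by
  have h := integral_mul_deriv_eq_deriv_mul_of_integrable (u := window) (v := window)
    (u' := deriv window) (v' := deriv window)
    (fun x _ => (window_differentiable x).hasDerivAt)
    (fun x _ => (window_differentiable x).hasDerivAt)
    integrable_window_mul_deriv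
    (integrable_window_mul_deriv.congr (Eventually.of_forall fun x => mul_comm _ _))
    (integrable_window_sq.congr (Eventually.of_forall fun x => sq _))
  have h2 : ∫ x, deriv window x * window x = ∫ x, window x * deriv window x := by
    simp only [mul_comm]
  linarith

/-- The function `x ↦ e^{2πixξ} g(x - q)`, a wave packet of momentum `2πξ` located in
`(q, q + 1)`; here `p = (q, ξ)`. -/
def packet (p : ℝ × ℝ) (x : ℝ) : ℂ :=
  Complex.exp (2 * Real.pi * x * p.2 * Complex.I) * window (x - p.1)

theorem continuous_packet : Continuous fun z : (ℝ × ℝ) × ℝ => packet z.1 z.2 := by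
  unfold packet
  have := window_continuous
  fun_prop

theorem norm_packet (p : ℝ × ℝ) (x : ℝ) : ‖packet p x‖ = |window (x - p.1)| := by
  have : (2 * Real.pi * x * p.2 * Complex.I : ℂ) =
      ((2 * Real.pi * x * p.2 : ℝ) : ℂ) * Complex.I := by
    push_cast; ring
  rw [packet, norm_mul, this, Complex.norm_exp_ofReal_mul_I, one_mul, Complex.norm_real,
    Real.norm_eq_abs]

theorem hasCompactSupport_window_sub (q : ℝ) : HasCompactSupport fun x => window (x - q) :=
  hasCompactSupport_comp_sub window_hasCompactSupport q

theorem memLp_packet (p : ℝ × ℝ) : MemLp (packet p) 2 halfMeasure := by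
  have h1 : Continuous (packet p) := by
    unfold packet
    have := window_continuous
    fun_prop
  have h2 : HasCompactSupport (packet p) := by
    refine (hasCompactSupport_window_sub p.1).mono fun x hx => ?_
    rw [Function.mem_support] at hx ⊢
    exact fun h => hx (by simp [packet, h])
  exact (h1.memLp_of_hasCompactSupport h2).restrict _

/-- The wave packet as an element of `L²((0, +∞))`. -/
def atom (p : ℝ × ℝ) : L2Half := (memLp_packet p).toLp _

theorem inner_atom (p : ℝ × ℝ) (u : L2Half) :
    ⟪atom p, u⟫_ℂ = ∫ x in Ioi (0 : ℝ), ⟪packet p x, u x⟫_ℂ := by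
  rw [L2.inner_def]
  refine integral_congr_ae ?_
  filter_upwards [(memLp_packet p).coeFn_toLp] with x hx
  rw [atom, hx]

theorem measurable_inner_atom (u : L2Half) : Measurable fun p => ⟪atom p, u⟫_ℂ := by
  simp only [inner_atom]
  refine StronglyMeasurable.measurable ?_
  refine StronglyMeasurable.integral_prod_right (f := fun p x => ⟪packet p x, u x⟫_ℂ) ?_
  exact (continuous_packet.stronglyMeasurable).inner
    ((Lp.stronglyMeasurable u).comp_measurable measurable_snd)

theorem norm_sq_atom (p : ℝ × ℝ) : ‖atom p‖ ^ 2 = ∫ x in Ioi (0 : ℝ), window (x - p.1) ^ 2 := by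
  rw [atom, norm_sq_toLp]
  simp only [norm_packet, sq_abs]

theorem integral_window_sub_sq (q : ℝ) : ∫ x, window (x - q) ^ 2 = 1 := by
  rw [integral_sub_right_eq_self (fun x => window x ^ 2) q, integral_window_sq]

theorem integrable_window_sub_sq (q : ℝ) : Integrable fun x => window (x - q) ^ 2 :=
  integrable_window_sq.comp_sub_right q

theorem norm_atom_le (p : ℝ × ℝ) : ‖atom p‖ ≤ 1 := by
  have h : ‖atom p‖ ^ 2 ≤ 1 := by
    rw [norm_sq_atom, ← integral_window_sub_sq p.1]
    exact setIntegral_le_integral (integrable_window_sub_sq p.1)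
      (Eventually.of_forall fun x => sq_nonneg _)
  exact (sq_le_one_iff₀ (norm_nonneg _)).1 h

theorem atom_eq_zero {p : ℝ × ℝ} (hp : p.1 ≤ -1) : atom p = 0 := by
  have h : ‖atom p‖ ^ 2 = 0 := by
    rw [norm_sq_atom]
    refine setIntegral_eq_zero_of_forall_eq_zero fun x hx => ?_
    by_contra hne
    have := (mem_Ioo_of_window_ne_zero (x := x - p.1) (fun h0 => hne (by simp [h0]))).2
    have hx0 : (0 : ℝ) < x := hx
    linarith
  exact norm_eq_zero.1 (pow_eq_zero_iff (two_ne_zero) |>.1 h)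

/-! ### Resolution of the identity and the kinetic energy -/

section Plancherel

open scoped FourierTransform SchwartzMap

/-- Plancherel's theorem for Schwartz functions, for the Lebesgue integral in `[0, ∞]`. -/
theorem lintegral_norm_sq_schwartz (F : 𝓢(ℝ, ℂ)) :
    ∫⁻ ξ, ENNReal.ofReal (‖𝓕 F ξ‖ ^ 2) = ENNReal.ofReal (∫ x, ‖F x‖ ^ 2) := by
  rw [← SchwartzMap.integral_norm_sq_fourier, ← ofReal_integral_eq_lintegral_ofReal]
  · exact (memLp_two_iff_integrable_sq_norm (𝓕 F).continuous.aestronglyMeasurable).1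
      ((𝓕 F).memLp 2)
  · exact Eventually.of_forall fun x => sq_nonneg _

theorem fourier_deriv_schwartz (F : 𝓢(ℝ, ℂ)) (ξ : ℝ) :
    𝓕 (SchwartzMap.derivCLM ℂ ℂ F) ξ = (2 * Real.pi * Complex.I * ξ) * 𝓕 F ξ := by
  have h := congrFun (Real.fourier_deriv F.integrable F.differentiable
    (by exact (SchwartzMap.derivCLM ℂ ℂ F).integrable)) ξ
  rw [SchwartzMap.fourier_coe, SchwartzMap.fourier_coe]
  exact h

theorem lintegral_sq_mul_norm_sq_schwartz (F : 𝓢(ℝ, ℂ)) :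
    ∫⁻ ξ, ENNReal.ofReal ((2 * Real.pi * ξ) ^ 2 * ‖𝓕 F ξ‖ ^ 2) =
      ENNReal.ofReal (∫ x, ‖deriv F x‖ ^ 2) := by
  rw [← show ∫ x, ‖SchwartzMap.derivCLM ℂ ℂ F x‖ ^ 2 = ∫ x, ‖deriv F x‖ ^ 2 from rfl,
    ← lintegral_norm_sq_schwartz]
  refine lintegral_congr fun ξ => ?_
  have : (2 * Real.pi * Complex.I * ξ : ℂ) = ((2 * Real.pi * ξ : ℝ) : ℂ) * Complex.I := by
    push_cast; ring
  rw [fourier_deriv_schwartz, this, norm_mul, norm_mul, Complex.norm_I, mul_one,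
    Complex.norm_real, Real.norm_eq_abs, mul_pow _ ‖𝓕 F ξ‖, sq_abs]

/-- Tonelli's theorem for a nonnegative kernel `k` whose marginal in `q` is `K`. -/
theorem lintegral_ofReal_integral_eq {ν : Measure ℝ} [SFinite ν] {k : ℝ → ℝ → ℝ} {K : ℝ → ℝ}
    (hk : Measurable (Function.uncurry k)) (h0 : ∀ᵐ x ∂ν, ∀ q, 0 ≤ k x q)
    (hx : ∀ q, Integrable (fun x => k x q) ν)
    (hq : ∀ᵐ x ∂ν, Integrable (k x) ∧ ∫ q, k x q = K x) (hK : Integrable K ν) :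
    ∫⁻ q, ENNReal.ofReal (∫ x, k x q ∂ν) = ENNReal.ofReal (∫ x, K x ∂ν) := by
  have hK0 : 0 ≤ᵐ[ν] K := by
    filter_upwards [h0, hq] with x h1 h2
    rw [← h2.2]
    exact integral_nonneg h1
  rw [ofReal_integral_eq_lintegral_ofReal hK hK0]
  have h1 : ∀ q, ENNReal.ofReal (∫ x, k x q ∂ν) = ∫⁻ x, ENNReal.ofReal (k x q) ∂ν := fun q =>
    ofReal_integral_eq_lintegral_ofReal (hx q) (h0.mono fun x h => h q)
  simp only [h1]
  rw [lintegral_lintegral_swap]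
  · refine lintegral_congr_ae ?_
    filter_upwards [h0, hq] with x h2 h3
    rw [← h3.2, ofReal_integral_eq_lintegral_ofReal h3.1 (Eventually.of_forall h2)]
  · exact (hk.comp measurable_swap).ennreal_ofReal.aemeasurable

/-- The product of a test function with the translated window. -/
def windowed (f : 𝓓(halfLine, ℂ)) (q : ℝ) : 𝓢(ℝ, ℂ) :=
  HasCompactSupport.toSchwartzMap (f := fun x => (window (x - q) : ℂ) * f x)
    f.hasCompactSupport.mul_left
    ((Complex.ofRealCLM.contDiff.comp (window_contDiff.comp (contDiff_id.sub contDiff_const))).mul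
      f.contDiff)

theorem windowed_apply (f : 𝓓(halfLine, ℂ)) (q x : ℝ) :
    windowed f q x = window (x - q) * f x := rfl

theorem deriv_windowed (f : 𝓓(halfLine, ℂ)) (q x : ℝ) : deriv (windowed f q) x =
    ((deriv window (x - q) : ℝ) : ℂ) * f x + window (x - q) * deriv f x := by
  have h0 : HasDerivAt (fun x => window (x - q)) (deriv window (x - q)) x := by
    exact (window_differentiable (x - q)).hasDerivAt.comp_sub_const x q
  exact HasDerivAt.deriv (h0.ofReal_comp.mul (differentiable_test f x).hasDerivAt)

/-- Testing against wave packets is a short-time Fourier transform. -/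
theorem inner_atom_inclTest (f : 𝓓(halfLine, ℂ)) (p : ℝ × ℝ) :
    ⟪atom p, inclTest f⟫_ℂ = 𝓕 (windowed f p.1) p.2 := by
  rw [inner_atom, SchwartzMap.fourier_coe, Real.fourier_real_eq_integral_exp_smul,
    ← setIntegral_Ioi_eq fun x hx => by simp [windowed_apply, test_eq_zero f hx]]
  refine integral_congr_ae ?_
  filter_upwards [coeFn_inclTest f] with x hx
  rw [hx, windowed_apply, packet]
  simp only [RCLike.inner_apply, map_mul, Complex.conj_ofReal, smul_eq_mul, ← Complex.exp_conj,
    Complex.conj_I, map_ofNat]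
  push_cast
  rw [mul_comm (f x), mul_assoc]
  congr 2
  ring

theorem integrable_test_sq (f : 𝓓(halfLine, ℂ)) : Integrable fun x => ‖f x‖ ^ 2 :=
  Continuous.integrable_of_hasCompactSupport (f.continuous.norm.pow 2)
    (f.hasCompactSupport.norm.comp_left (g := fun t => t ^ 2) (by simp))

theorem integrable_deriv_test_sq (f : 𝓓(halfLine, ℂ)) : Integrable fun x => ‖deriv f x‖ ^ 2 :=
  Continuous.integrable_of_hasCompactSupport ((continuous_deriv f).norm.pow 2)
    (f.hasCompactSupport.deriv.norm.comp_left (g := fun t => t ^ 2) (by simp))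

theorem integral_window_sub_left (c x : ℝ) : Integrable (fun q => window (x - q) ^ 2 * c) ∧
    ∫ q, window (x - q) ^ 2 * c = c := by
  refine ⟨(integrable_window_sq.comp_sub_left x).mul_const c, ?_⟩
  rw [integral_mul_const, integral_sub_left_eq_self (fun x => window x ^ 2) volume x,
    integral_window_sq, one_mul]

/-- The wave packets form a resolution of the identity. -/
theorem lintegral_norm_sq_inner_atom (f : 𝓓(halfLine, ℂ)) :
    ∫⁻ p, ENNReal.ofReal (‖⟪atom p, inclTest f⟫_ℂ‖ ^ 2) = ENNReal.ofReal (‖inclTest f‖ ^ 2) := by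
  have hm : Measurable fun p => ENNReal.ofReal (‖⟪atom p, inclTest f⟫_ℂ‖ ^ 2) :=
    ((measurable_inner_atom _).norm.pow_const 2).ennreal_ofReal
  rw [Measure.volume_eq_prod, lintegral_prod _ hm.aemeasurable]
  simp only [inner_atom_inclTest]
  simp only [lintegral_norm_sq_schwartz]
  rw [norm_sq_inclTest]
  have hc := f.continuous
  have hw := window_continuous
  refine lintegral_ofReal_integral_eq (k := fun x q => ‖windowed f q x‖ ^ 2) ?_ ?_ ?_ ?_
    (integrable_test_sq f)
  · simp only [windowed_apply, Function.uncurry_def]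
    exact Continuous.measurable (by fun_prop)
  · exact Eventually.of_forall fun x q => sq_nonneg _
  · intro q
    exact (memLp_two_iff_integrable_sq_norm (windowed f q).continuous.aestronglyMeasurable).1
      ((windowed f q).memLp 2)
  · refine Eventually.of_forall fun x => ?_
    simp only [windowed_apply, norm_mul, mul_pow, Complex.norm_real, Real.norm_eq_abs, sq_abs]
    exact integral_window_sub_left _ _

/-- The momentum weight `(2πξ)²` recovers the kinetic energy, up to the kinetic energy of the
window. -/
theorem lintegral_kinetic (f : 𝓓(halfLine, ℂ)) :
    ∫⁻ p : ℝ × ℝ, ENNReal.ofReal ((2 * Real.pi * p.2) ^ 2 * ‖⟪atom p, inclTest f⟫_ℂ‖ ^ 2) =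
      ENNReal.ofReal (‖derivTest f‖ ^ 2 + windowEnergy * ‖inclTest f‖ ^ 2) := by
  have hm : Measurable fun p : ℝ × ℝ =>
      ENNReal.ofReal ((2 * Real.pi * p.2) ^ 2 * ‖⟪atom p, inclTest f⟫_ℂ‖ ^ 2) :=
    (((measurable_snd.const_mul _).pow_const 2).mul
      ((measurable_inner_atom _).norm.pow_const 2)).ennreal_ofReal
  rw [Measure.volume_eq_prod, lintegral_prod _ hm.aemeasurable]
  simp only [inner_atom_inclTest]
  simp only [lintegral_sq_mul_norm_sq_schwartz]
  rw [norm_sq_inclTest, norm_sq_derivTest, ← integral_const_mul,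
    ← integral_add (integrable_deriv_test_sq f) ((integrable_test_sq f).const_mul _)]
  have hc := f.continuous
  have hc' := continuous_deriv f
  have hw := window_continuous
  have hw' := deriv_window_continuous
  refine lintegral_ofReal_integral_eq (k := fun x q => ‖deriv (windowed f q) x‖ ^ 2) ?_ ?_ ?_ ?_
    ((integrable_deriv_test_sq f).add ((integrable_test_sq f).const_mul _))
  · simp only [deriv_windowed, Function.uncurry_def]
    exact Continuous.measurable (by fun_prop)
  · exact Eventually.of_forall fun x q => sq_nonneg _
  · intro q
    exact (memLp_two_iff_integrable_sq_norm
      (SchwartzMap.derivCLM ℂ ℂ (windowed f q)).continuous.aestronglyMeasurable).1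
      ((SchwartzMap.derivCLM ℂ ℂ (windowed f q)).memLp 2)
  · refine Eventually.of_forall fun x => ?_
    -- the mixed term vanishes after integration over `q`, since `∫ g g' = 0`
    set b : ℝ := 2 * ((f x).re * (deriv f x).re + (f x).im * (deriv f x).im)
    have e : ∀ q, ‖deriv (windowed f q) x‖ ^ 2 = window (x - q) ^ 2 * ‖deriv f x‖ ^ 2 +
        (deriv window (x - q) ^ 2 * ‖f x‖ ^ 2 +
          window (x - q) * deriv window (x - q) * b) := fun q => by
      simp only [deriv_windowed, ← Complex.normSq_eq_norm_sq, Complex.normSq_apply, Complex.add_re,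
        Complex.mul_re, Complex.add_im, Complex.mul_im, Complex.ofReal_re, Complex.ofReal_im, b]
      ring
    have i1 := integral_window_sub_left (‖deriv f x‖ ^ 2) x
    have i2 : Integrable fun q => deriv window (x - q) ^ 2 * ‖f x‖ ^ 2 :=
      (integrable_deriv_window_sq.comp_sub_left x).mul_const _
    have i3 : Integrable fun q => window (x - q) * deriv window (x - q) * b :=
      (integrable_window_mul_deriv.comp_sub_left x).mul_const _
    simp only [e]
    refine ⟨i1.1.add (i2.add i3), ?_⟩
    rw [integral_add i1.1 (by exact i2.add i3), integral_add i2 i3, i1.2, integral_mul_const,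
      integral_mul_const, integral_sub_left_eq_self (fun x => deriv window x ^ 2) volume x,
      integral_sub_left_eq_self (fun x => window x * deriv window x) volume x,
      integral_window_mul_deriv, zero_mul, add_zero]
    rfl

/-- Since the packet at `q` lives in `(q, q + 1)`, the weight `max(q, 0) ^ β` is a lower bound for
the potential energy; the term `C x⁻²` is dropped. -/
theorem lintegral_potential_le {C β : ℝ} (hC : 0 < C) (hβ : 0 < β) (f : 𝓓(halfLine, ℂ)) :
    ∫⁻ p : ℝ × ℝ, ENNReal.ofReal (max p.1 0 ^ β * ‖⟪atom p, inclTest f⟫_ℂ‖ ^ 2) ≤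
      ENNReal.ofReal (‖sqrtPotTest C β f‖ ^ 2) := by
  have hm : Measurable fun p : ℝ × ℝ =>
      ENNReal.ofReal (max p.1 0 ^ β * ‖⟪atom p, inclTest f⟫_ℂ‖ ^ 2) :=
    (((measurable_fst.max measurable_const).pow_const β).mul
      ((measurable_inner_atom _).norm.pow_const 2)).ennreal_ofReal
  rw [Measure.volume_eq_prod, lintegral_prod _ hm.aemeasurable]
  have hq0 : ∀ q : ℝ, 0 ≤ max q 0 ^ β := fun q => by positivity
  simp only [inner_atom_inclTest, ENNReal.ofReal_mul (hq0 _)]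
  have hm2 : ∀ q : ℝ, Measurable fun ξ => ENNReal.ofReal (‖𝓕 (windowed f q) ξ‖ ^ 2) := fun q =>
    ((𝓕 (windowed f q)).continuous.norm.pow 2).measurable.ennreal_ofReal
  simp only [lintegral_const_mul _ (hm2 _)]
  simp only [lintegral_norm_sq_schwartz, ← ENNReal.ofReal_mul (hq0 _)]
  have hmpot : Measurable (potential C β) := by
    unfold potential
    fun_prop
  have hc := f.continuous
  have hw := window_continuous
  have hint : ∀ q, Integrable (fun x => window (x - q) ^ 2 * (potential C β x * ‖f x‖ ^ 2))
      halfMeasure := fun q => by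
    obtain ⟨B, hB⟩ := window_hasCompactSupport.exists_bound_of_continuous window_continuous
    refine (integrable_potential_mul hC hβ f).bdd_mul (c := B ^ 2) ?_ ?_
    · exact Continuous.aestronglyMeasurable (by fun_prop)
    · refine Eventually.of_forall fun x => ?_
      rw [norm_pow]
      exact pow_le_pow_left₀ (norm_nonneg _) (hB _) 2
  rw [norm_sq_sqrtPotTest hC hβ, ← lintegral_ofReal_integral_eq (ν := halfMeasure)
    (k := fun x q => window (x - q) ^ 2 * (potential C β x * ‖f x‖ ^ 2)) ?_ ?_ hint ?_
    (integrable_potential_mul hC hβ f)]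
  · refine lintegral_mono fun q => ENNReal.ofReal_le_ofReal ?_
    rw [← setIntegral_Ioi_eq fun x hx => by simp [windowed_apply, test_eq_zero f hx],
      ← integral_const_mul]
    refine integral_mono_ae ?_ (hint q) ?_
    · exact ((memLp_two_iff_integrable_sq_norm
        (windowed f q).continuous.aestronglyMeasurable).1
        ((windowed f q).memLp 2)).integrableOn.const_mul _
    · filter_upwards [ae_restrict_mem measurableSet_Ioi] with x hx
      have hx0 : (0 : ℝ) < x := hx
      simp only [windowed_apply, norm_mul, mul_pow, Complex.norm_real, Real.norm_eq_abs, sq_abs]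
      by_cases hne : window (x - q) = 0
      · simp [hne]
      · have h1 := (mem_Ioo_of_window_ne_zero hne).1
        have h2 : max q 0 ^ β ≤ potential C β x := by
          unfold potential
          have h3 : max q 0 ^ β ≤ x ^ β :=
            Real.rpow_le_rpow (le_max_right _ _) (max_le (by linarith) hx0.le) hβ.le
          have h4 : 0 ≤ C / x ^ 2 := by positivity
          linarith
        have h5 : 0 ≤ window (x - q) ^ 2 * ‖f x‖ ^ 2 := by positivity
        nlinarith
  · simp only [Function.uncurry_def]
    have := hw.measurable
    have := hc.measurable
    fun_prop
  · filter_upwards [ae_restrict_mem measurableSet_Ioi] with x hx q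
    have := potential_pos hC hβ hx
    positivity
  · exact Eventually.of_forall fun x => integral_window_sub_left _ _

end Plancherel

/-! ### Localized upper bound for convex functions of the operator -/

section

/-- `F` is a nonnegative, nonincreasing convex function, and `-s m` is a subgradient of `F` at
`m`. -/
structure ConvexProfile (F s : ℝ → ℝ) : Prop where
  measurable : Measurable F
  nonneg : ∀ x, 0 ≤ F x
  slope_nonneg : ∀ m, 0 ≤ s m
  tangent : ∀ m x, F m + s m * m ≤ F x + s m * x

/-- The classical symbol `(2πξ)² + max(q, 0) ^ β` at `p = (q, ξ)`, a lower bound for the energy of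
wave packets. -/
def phaseSymbol (β : ℝ) (p : ℝ × ℝ) : ℝ := (2 * Real.pi * p.2) ^ 2 + max p.1 0 ^ β

theorem measurable_phaseSymbol (β : ℝ) : Measurable (phaseSymbol β) := by
  unfold phaseSymbol
  fun_prop

theorem phaseSymbol_nonneg (β : ℝ) (p : ℝ × ℝ) : 0 ≤ phaseSymbol β p := by
  unfold phaseSymbol
  positivity

variable {C β : ℝ} {F s : ℝ → ℝ}

theorem lintegral_phaseSymbol_le (hC : 0 < C) (hβ : 0 < β) (f : 𝓓(halfLine, ℂ)) :
    ∫⁻ p, ENNReal.ofReal (phaseSymbol β p * ‖⟪atom p, inclTest f⟫_ℂ‖ ^ 2) ≤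
      ENNReal.ofReal (energy C β f + windowEnergy * ‖inclTest f‖ ^ 2) := by
  have hκ := windowEnergy_nonneg
  have hm : Measurable fun p : ℝ × ℝ =>
      ENNReal.ofReal ((2 * Real.pi * p.2) ^ 2 * ‖⟪atom p, inclTest f⟫_ℂ‖ ^ 2) :=
    (((measurable_snd.const_mul _).pow_const 2).mul
      ((measurable_inner_atom _).norm.pow_const 2)).ennreal_ofReal
  have h1 : ∀ p, ENNReal.ofReal (phaseSymbol β p * ‖⟪atom p, inclTest f⟫_ℂ‖ ^ 2) =
      ENNReal.ofReal ((2 * Real.pi * p.2) ^ 2 * ‖⟪atom p, inclTest f⟫_ℂ‖ ^ 2) +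
        ENNReal.ofReal (max p.1 0 ^ β * ‖⟪atom p, inclTest f⟫_ℂ‖ ^ 2) := fun p => by
    rw [← ENNReal.ofReal_add (by positivity) (by positivity), phaseSymbol, add_mul]
  simp only [h1]
  rw [lintegral_add_left hm, lintegral_kinetic]
  refine (add_le_add_right (lintegral_potential_le hC hβ f) _).trans_eq ?_
  rw [← ENNReal.ofReal_add (by positivity) (by positivity), energy]
  congr 1
  ring

/-- Jensen's inequality for the resolution of the identity, in the form of a tangent line
estimate. -/
theorem ConvexProfile.tangent_le_lintegral (hF : ConvexProfile F s) (hC : 0 < C) (hβ : 0 < β)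
    (m : ℝ) (f : 𝓓(halfLine, ℂ)) :
    ENNReal.ofReal ((F m + s m * m) * ‖inclTest f‖ ^ 2 -
        s m * (energy C β f + windowEnergy * ‖inclTest f‖ ^ 2)) ≤
      ∫⁻ p, ENNReal.ofReal (F (phaseSymbol β p) * ‖⟪atom p, inclTest f⟫_ℂ‖ ^ 2) := by
  have hs := hF.slope_nonneg m
  have hκ := windowEnergy_nonneg
  have hE : 0 ≤ energy C β f + windowEnergy * ‖inclTest f‖ ^ 2 := by
    unfold energy
    positivity
  have hm1 : Measurable fun p => ENNReal.ofReal (‖⟪atom p, inclTest f⟫_ℂ‖ ^ 2) :=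
    ((measurable_inner_atom _).norm.pow_const 2).ennreal_ofReal
  have hm2 : Measurable fun p =>
      ENNReal.ofReal (F (phaseSymbol β p) * ‖⟪atom p, inclTest f⟫_ℂ‖ ^ 2) :=
    ((hF.measurable.comp (measurable_phaseSymbol β)).mul
      ((measurable_inner_atom _).norm.pow_const 2)).ennreal_ofReal
  rw [ENNReal.ofReal_sub _ (by positivity)]
  refine tsub_le_iff_right.2 ?_
  calc ENNReal.ofReal ((F m + s m * m) * ‖inclTest f‖ ^ 2)
      = ∫⁻ p, ENNReal.ofReal ((F m + s m * m) * ‖⟪atom p, inclTest f⟫_ℂ‖ ^ 2) := by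
        rw [ENNReal.ofReal_mul' (by positivity), ← lintegral_norm_sq_inner_atom,
          ← lintegral_const_mul _ hm1]
        refine lintegral_congr fun p => ?_
        rw [ENNReal.ofReal_mul' (by positivity)]
    _ ≤ ∫⁻ p, (ENNReal.ofReal (F (phaseSymbol β p) * ‖⟪atom p, inclTest f⟫_ℂ‖ ^ 2) +
          ENNReal.ofReal (s m) *
            ENNReal.ofReal (phaseSymbol β p * ‖⟪atom p, inclTest f⟫_ℂ‖ ^ 2)) := by
        refine lintegral_mono fun p => ?_
        have h1 := hF.nonneg (phaseSymbol β p)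
        have h2 := phaseSymbol_nonneg β p
        rw [← ENNReal.ofReal_mul hs, ← ENNReal.ofReal_add (by positivity) (by positivity)]
        refine ENNReal.ofReal_le_ofReal ?_
        have h3 := mul_le_mul_of_nonneg_right (hF.tangent m (phaseSymbol β p))
          (sq_nonneg ‖⟪atom p, inclTest f⟫_ℂ‖)
        linarith
    _ ≤ _ := by
        rw [lintegral_add_left hm2, ENNReal.ofReal_mul hs]
        gcongr
        rw [lintegral_const_mul']
        · gcongr
          exact lintegral_phaseSymbol_le hC hβ f
        · exact ENNReal.ofReal_ne_top

theorem norm_inner_atom_sq_le (p : ℝ × ℝ) (u : L2Half) : ‖⟪atom p, u⟫_ℂ‖ ^ 2 ≤ ‖u‖ ^ 2 := by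
  refine pow_le_pow_left₀ (norm_nonneg _) ((norm_inner_le_norm _ _).trans ?_) 2
  exact mul_le_of_le_one_left (norm_nonneg _) (norm_atom_le p)

/-- Dominated convergence for phase space integrals. The packets with `q ≤ -1` vanish on the
half-line, so an integrable bound is needed only for `q > -1`. -/
theorem tendsto_lintegral_atom (hF : Measurable F) (hF0 : ∀ x, 0 ≤ F x)
    (hfin : ∫⁻ p in {p : ℝ × ℝ | -1 < p.1}, ENNReal.ofReal (F (phaseSymbol β p)) ≠ ⊤)
    {u : ℕ → L2Half} {v : L2Half} (hu : Tendsto u atTop (𝓝 v)) :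
    Tendsto (fun n => ∫⁻ p, ENNReal.ofReal (F (phaseSymbol β p) * ‖⟪atom p, u n⟫_ℂ‖ ^ 2)) atTop
      (𝓝 (∫⁻ p, ENNReal.ofReal (F (phaseSymbol β p) * ‖⟪atom p, v⟫_ℂ‖ ^ 2))) := by
  obtain ⟨B, hB⟩ := hu.norm.bddAbove_range
  have hB' : ∀ n, ‖u n‖ ≤ B := fun n => hB ⟨n, rfl⟩
  have hS : MeasurableSet {p : ℝ × ℝ | -1 < p.1} := measurableSet_lt measurable_const measurable_fst
  have hmeas : Measurable fun p => F (phaseSymbol β p) := hF.comp (measurable_phaseSymbol β)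
  refine tendsto_lintegral_of_dominated_convergence
    (fun p => ENNReal.ofReal (B ^ 2) *
      {p : ℝ × ℝ | -1 < p.1}.indicator (fun p => ENNReal.ofReal (F (phaseSymbol β p))) p)
    (fun n => (hmeas.mul ((measurable_inner_atom _).norm.pow_const 2)).ennreal_ofReal)
    (fun n => Eventually.of_forall fun p => ?_) ?_ (Eventually.of_forall fun p => ?_)
  · beta_reduce
    by_cases hp : -1 < p.1
    · rw [indicator_of_mem (by exact hp), mul_comm (ENNReal.ofReal (B ^ 2)),
        ← ENNReal.ofReal_mul (hF0 _)]
      refine ENNReal.ofReal_le_ofReal (mul_le_mul_of_nonneg_left ?_ (hF0 _))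
      exact (norm_inner_atom_sq_le p _).trans (pow_le_pow_left₀ (norm_nonneg _) (hB' n) 2)
    · simp [atom_eq_zero (not_lt.1 hp)]
  · rw [lintegral_const_mul' _ _ ENNReal.ofReal_ne_top, lintegral_indicator hS]
    exact ENNReal.mul_ne_top ENNReal.ofReal_ne_top hfin
  · refine ENNReal.tendsto_ofReal (Tendsto.const_mul _ (Tendsto.pow (Tendsto.norm ?_) 2))
    exact tendsto_const_nhds.inner hu

variable {μ : ℕ → ℝ} {e : HilbertBasis ℕ ℂ L2Half} {η : ℝ → ℝ} {a M : ℝ}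

/-- Upper bound for the contribution of one eigenvector. -/
theorem IsEigenbasis.profile_le (he : IsEigenbasis C β μ e) (hC : 0 < C) (hβ : 0 < β)
    (hF : ConvexProfile F s) (hη : ContDiff ℝ ∞ η)
    (hηa : ∀ x, |deriv η x| ≤ a * η x) (hM : ∀ x, |η x| ≤ M)
    (hw : MemLp (fun x => (η x : ℂ)) ⊤ halfMeasure)
    (hfin : ∫⁻ p in {p : ℝ × ℝ | -1 < p.1}, ENNReal.ofReal (F (phaseSymbol β p)) ≠ ⊤) (j : ℕ) :
    ENNReal.ofReal (F (μ j + a ^ 2 + windowEnergy) * ‖mulBdd hw (e j)‖ ^ 2) ≤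
      ∫⁻ p, ENNReal.ofReal (F (phaseSymbol β p) * ‖⟪atom p, mulBdd hw (e j)⟫_ℂ‖ ^ 2) := by
  obtain ⟨f, b, hf, hfb, hb⟩ := he.exists_seq_energy_le hC hβ hη hηa hM hw j
  set m := μ j + a ^ 2 + windowEnergy
  set N := ‖mulBdd hw (e j)‖ ^ 2
  have hN : Tendsto (fun n => ‖inclTest (f n)‖ ^ 2) atTop (𝓝 N) := hf.norm.pow 2
  have hlhs : Tendsto (fun n => (F m + s m * m) * ‖inclTest (f n)‖ ^ 2 -
      s m * (b n + windowEnergy * ‖inclTest (f n)‖ ^ 2)) atTop (𝓝 ((F m + s m * m) * N -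
        s m * ((μ j + a ^ 2) * N + windowEnergy * N))) :=
    (hN.const_mul _).sub ((hb.add (hN.const_mul _)).const_mul _)
  have hval : (F m + s m * m) * N - s m * ((μ j + a ^ 2) * N + windowEnergy * N) = F m * N := by
    simp only [m]
    ring
  rw [hval] at hlhs
  refine le_of_tendsto_of_tendsto' (ENNReal.tendsto_ofReal hlhs)
    (tendsto_lintegral_atom hF.measurable hF.nonneg hfin hf) fun n => ?_
  refine le_trans (ENNReal.ofReal_le_ofReal ?_) (hF.tangent_le_lintegral hC hβ m (f n))
  have := mul_le_mul_of_nonneg_left (hfb n) (hF.slope_nonneg m)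
  linarith

/-- Localized upper bound of Berezin–Lieb type: the sum over the eigenvectors, weighted by `η²`, is
at most the corresponding phase space integral. -/
theorem IsEigenbasis.tsum_profile_le (he : IsEigenbasis C β μ e) (hC : 0 < C) (hβ : 0 < β)
    (hF : ConvexProfile F s) (hη : ContDiff ℝ ∞ η)
    (hηa : ∀ x, |deriv η x| ≤ a * η x) (hM : ∀ x, |η x| ≤ M)
    (hw : MemLp (fun x => (η x : ℂ)) ⊤ halfMeasure)
    (hfin : ∫⁻ p in {p : ℝ × ℝ | -1 < p.1}, ENNReal.ofReal (F (phaseSymbol β p)) ≠ ⊤) :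
    ∑' j, ENNReal.ofReal (F (μ j + a ^ 2 + windowEnergy) * ‖mulBdd hw (e j)‖ ^ 2) ≤
      ∫⁻ p, ENNReal.ofReal (F (phaseSymbol β p) * ‖mulBdd hw (atom p)‖ ^ 2) := by
  refine (ENNReal.tsum_le_tsum fun j => he.profile_le hC hβ hF hη hηa hM hw hfin j).trans ?_
  have hmeas : Measurable fun p => F (phaseSymbol β p) :=
    hF.measurable.comp (measurable_phaseSymbol β)
  have hm : ∀ j, Measurable fun p =>
      ENNReal.ofReal (F (phaseSymbol β p) * ‖⟪atom p, mulBdd hw (e j)⟫_ℂ‖ ^ 2) := fun j =>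
    (hmeas.mul ((measurable_inner_atom _).norm.pow_const 2)).ennreal_ofReal
  rw [← lintegral_tsum fun j => (hm j).aemeasurable]
  refine le_of_eq (lintegral_congr fun p => ?_)
  have h := (hasSum_norm_inner_sq e (mulBdd hw (atom p))).mul_left (F (phaseSymbol β p))
  rw [← h.tsum_eq, ENNReal.ofReal_tsum_of_nonneg
    (fun j => mul_nonneg (hF.nonneg _) (sq_nonneg _)) h.summable]
  congr 1
  ext j
  rw [inner_mulBdd, norm_inner_symm]

/-! ### The lower bound from wave packets as trial functions -/

/-- One half of the resolution of the identity, extended from test functions to their limits by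
Fatou's lemma. -/
theorem lintegral_norm_sq_inner_atom_le {u : L2Half} {f : ℕ → 𝓓(halfLine, ℂ)}
    (hf : Tendsto (fun n => inclTest (f n)) atTop (𝓝 u)) :
    ∫⁻ p, ENNReal.ofReal (‖⟪atom p, u⟫_ℂ‖ ^ 2) ≤ ENNReal.ofReal (‖u‖ ^ 2) := by
  have h1 : ∀ p, ENNReal.ofReal (‖⟪atom p, u⟫_ℂ‖ ^ 2) =
      liminf (fun n => ENNReal.ofReal (‖⟪atom p, inclTest (f n)⟫_ℂ‖ ^ 2)) atTop := fun p =>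
    (ENNReal.tendsto_ofReal ((tendsto_const_nhds.inner hf).norm.pow 2)).liminf_eq.symm
  simp only [h1]
  refine (lintegral_liminf_le fun n =>
    ((measurable_inner_atom _).norm.pow_const 2).ennreal_ofReal).trans ?_
  simp only [lintegral_norm_sq_inner_atom]
  exact (ENNReal.tendsto_ofReal (hf.norm.pow 2)).liminf_eq.le

theorem contDiff_packet (p : ℝ × ℝ) : ContDiff ℝ ∞ (packet p) := by
  unfold packet
  refine ContDiff.mul ?_ (Complex.ofRealCLM.contDiff.comp
    (window_contDiff.comp (contDiff_id.sub contDiff_const)))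
  refine ContDiff.cexp ?_
  exact (((contDiff_const.mul Complex.ofRealCLM.contDiff).mul contDiff_const).mul contDiff_const)

/-- A wave packet located in `(0, +∞)`, as a test function. -/
def packetTest (p : ℝ × ℝ) (hp : 0 ≤ p.1) : 𝓓(halfLine, ℂ) where
  toFun := packet p
  contDiff' := contDiff_packet p
  hasCompactSupport' := (hasCompactSupport_window_sub p.1).mono fun x hx => by
    rw [Function.mem_support] at hx ⊢
    exact fun h => hx (by simp [packet, h])
  tsupport_subset' := by
    intro x hx
    have hcl : IsClosed {x : ℝ | x - p.1 ∈ tsupport window} :=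
      (isClosed_tsupport window).preimage (continuous_sub_right p.1)
    have hsub : Function.support (packet p) ⊆ {x : ℝ | x - p.1 ∈ tsupport window} := fun y hy =>
      subset_tsupport _ fun h => hy (by simp [packet, h])
    have h1 := (window_tsupport (closure_minimal hsub hcl hx)).1
    exact (by linarith : (0 : ℝ) < x)

theorem packetTest_apply (p : ℝ × ℝ) (hp : 0 ≤ p.1) (x : ℝ) : packetTest p hp x = packet p x := rfl

theorem inclTest_packetTest (p : ℝ × ℝ) (hp : 0 ≤ p.1) : inclTest (packetTest p hp) = atom p := by
  refine Lp.ext ?_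
  filter_upwards [coeFn_inclTest (packetTest p hp), (memLp_packet p).coeFn_toLp] with x h1 h2
  rw [h1, atom, h2]
  rfl

theorem norm_sq_atom_eq_one {p : ℝ × ℝ} (hp : 0 ≤ p.1) : ‖atom p‖ ^ 2 = 1 := by
  rw [← inclTest_packetTest p hp, norm_sq_inclTest]
  simp only [packetTest_apply, norm_packet, sq_abs]
  exact integral_window_sub_sq p.1

theorem norm_deriv_packet_sq (p : ℝ × ℝ) (x : ℝ) : ‖deriv (packet p) x‖ ^ 2 =
    (2 * Real.pi * p.2) ^ 2 * window (x - p.1) ^ 2 + deriv window (x - p.1) ^ 2 := by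
  have h0 : HasDerivAt (fun x => window (x - p.1)) (deriv window (x - p.1)) x :=
    (window_differentiable (x - p.1)).hasDerivAt.comp_sub_const x p.1
  have h1 : HasDerivAt (fun x : ℝ => (2 * Real.pi * x * p.2 * Complex.I : ℂ))
      (2 * Real.pi * 1 * p.2 * Complex.I : ℂ) x :=
    (((Complex.ofRealCLM.hasDerivAt.const_mul _).mul_const _).mul_const _)
  have h2 := HasDerivAt.deriv (h1.cexp.mul h0.ofReal_comp)
  have h3 : deriv (packet p) x = Complex.exp (2 * Real.pi * x * p.2 * Complex.I) *
      ((deriv window (x - p.1) : ℝ) + ((2 * Real.pi * p.2 * window (x - p.1) : ℝ) : ℂ) *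
        Complex.I) := by
    refine Eq.trans h2 ?_
    push_cast
    ring
  have h4 : (2 * Real.pi * x * p.2 * Complex.I : ℂ) =
      ((2 * Real.pi * x * p.2 : ℝ) : ℂ) * Complex.I := by
    push_cast; ring
  rw [h3, norm_mul, h4, Complex.norm_exp_ofReal_mul_I, one_mul, ← Complex.normSq_eq_norm_sq,
    Complex.normSq_add_mul_I]
  ring

/-- Upper bound for the energy of a wave packet located in `(1, +∞)`. -/
theorem energy_packetTest_le (hC : 0 < C) (hβ : 0 < β) {p : ℝ × ℝ} (hp : 0 ≤ p.1) (hp1 : 1 ≤ p.1) :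
    energy C β (packetTest p hp) ≤
      (2 * Real.pi * p.2) ^ 2 + windowEnergy + (C + (p.1 + 1) ^ β) := by
  have h1 : ‖derivTest (packetTest p hp)‖ ^ 2 = (2 * Real.pi * p.2) ^ 2 + windowEnergy := by
    rw [norm_sq_derivTest]
    have e : ∀ x, ‖deriv (packetTest p hp) x‖ ^ 2 =
      (2 * Real.pi * p.2) ^ 2 * window (x - p.1) ^ 2 + deriv window (x - p.1) ^ 2 :=
        norm_deriv_packet_sq p
    simp only [e]
    rw [integral_add ((integrable_window_sub_sq p.1).const_mul _)
      (integrable_deriv_window_sq.comp_sub_right p.1), integral_const_mul,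
      integral_window_sub_sq, mul_one,
      integral_sub_right_eq_self (fun x => deriv window x ^ 2) p.1]
    rfl
  have h2 : ‖sqrtPotTest C β (packetTest p hp)‖ ^ 2 ≤ C + (p.1 + 1) ^ β := by
    rw [norm_sq_sqrtPotTest hC hβ]
    have h3 : ∫ x in Ioi (0 : ℝ), (C + (p.1 + 1) ^ β) * ‖packetTest p hp x‖ ^ 2 =
        C + (p.1 + 1) ^ β := by
      rw [integral_const_mul, setIntegral_Ioi_eq fun x hx => by simp [test_eq_zero _ hx]]
      simp only [packetTest_apply, norm_packet, sq_abs]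
      rw [integral_window_sub_sq, mul_one]
    rw [← h3]
    refine setIntegral_mono_on (integrable_potential_mul hC hβ _)
      ((integrable_test_sq _).integrableOn.const_mul _) measurableSet_Ioi fun x hx => ?_
    have hx0 : (0 : ℝ) < x := hx
    simp only [packetTest_apply, norm_packet, sq_abs]
    by_cases hne : window (x - p.1) = 0
    · simp [hne]
    · have h4 := mem_Ioo_of_window_ne_zero hne
      refine mul_le_mul_of_nonneg_right ?_ (sq_nonneg _)
      unfold potential
      have h5 : C / x ^ 2 ≤ C := div_le_self hC.le (one_le_pow₀ (by linarith [h4.1]))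
      have h6 : x ^ β ≤ (p.1 + 1) ^ β := Real.rpow_le_rpow hx0.le (by linarith [h4.2]) hβ.le
      linarith
  rw [energy, h1]
  linarith

/-- The energy of a test function is the first moment of its spectral measure. -/
theorem IsEigenbasis.hasSum_energy (he : IsEigenbasis C β μ e) (hC : 0 < C) (hβ : 0 < β)
    (ψ : 𝓓(halfLine, ℂ)) :
    HasSum (fun j => μ j * ‖⟪e j, inclTest ψ⟫_ℂ‖ ^ 2) (energy C β ψ) := by
  have h1 := e.hasSum_inner_mul_inner (schrodingerTest C β ψ) (inclTest ψ)
  have h2 : ⟪schrodingerTest C β ψ, inclTest ψ⟫_ℂ = (energy C β ψ : ℂ) := by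
    have h3 := inner_formVec hC hβ ψ ψ
    rw [inner_self_complex, inner_add_left, inner_self_complex, norm_sq_formVec] at h3
    rw [energy]
    push_cast at h3 ⊢
    exact (add_left_cancel h3).symm
  rw [h2] at h1
  refine Complex.hasSum_ofReal.1 (h1.congr_fun fun j => ?_)
  rw [he.inner_schrodingerTest hC hβ, mul_assoc, ← inner_conj_symm (inclTest ψ) (e j), mul_comm
    ((starRingEnd ℂ) _), Complex.mul_conj, Complex.normSq_eq_norm_sq]
  push_cast
  rfl

/-- Jensen's inequality for the spectral measure of a wave packet. -/
theorem IsEigenbasis.profile_packet_le (he : IsEigenbasis C β μ e) (hC : 0 < C) (hβ : 0 < β)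
    (hF : ConvexProfile F s) {p : ℝ × ℝ} (hp : 1 ≤ p.1) :
    ENNReal.ofReal (F ((2 * Real.pi * p.2) ^ 2 + windowEnergy + (C + (p.1 + 1) ^ β))) ≤
      ∑' j, ENNReal.ofReal (F (μ j) * ‖⟪atom p, e j⟫_ℂ‖ ^ 2) := by
  have hp0 : 0 ≤ p.1 := zero_le_one.trans hp
  set m := (2 * Real.pi * p.2) ^ 2 + windowEnergy + (C + (p.1 + 1) ^ β)
  have h1 := he.hasSum_energy hC hβ (packetTest p hp0)
  have h2 := hasSum_norm_inner_sq e (inclTest (packetTest p hp0))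
  rw [inclTest_packetTest] at h1 h2
  rw [norm_sq_atom_eq_one hp0] at h2
  have hE := energy_packetTest_le hC hβ hp0 hp
  have hFle : ∀ j, F (μ j) ≤ F 0 := fun j => by
    have := hF.tangent (μ j) 0
    have := mul_nonneg (hF.slope_nonneg (μ j)) (he.pos j).le
    linarith
  have hsum : Summable fun j => F (μ j) * ‖⟪e j, atom p⟫_ℂ‖ ^ 2 :=
    Summable.of_nonneg_of_le (fun j => mul_nonneg (hF.nonneg _) (sq_nonneg _))
      (fun j => mul_le_mul_of_nonneg_right (hFle j) (sq_nonneg _)) (h2.summable.mul_left (F 0))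
  have h3 : ∀ j, ‖⟪atom p, e j⟫_ℂ‖ ^ 2 = ‖⟪e j, atom p⟫_ℂ‖ ^ 2 := fun j => by rw [norm_inner_symm]
  simp only [h3]
  rw [← ENNReal.ofReal_tsum_of_nonneg (fun j => mul_nonneg (hF.nonneg _) (sq_nonneg _)) hsum]
  refine ENNReal.ofReal_le_ofReal ?_
  have h4 := hasSum_le (fun j => ?_) (h2.mul_left (F m + s m * m))
    (hsum.hasSum.add (h1.mul_left (s m)))
  · have h5 := mul_le_mul_of_nonneg_left hE (hF.slope_nonneg m)
    change s m * _ ≤ s m * m at h5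
    linarith
  · have h5 := mul_le_mul_of_nonneg_right (hF.tangent m (μ j)) (sq_nonneg ‖⟪e j, atom p⟫_ℂ‖)
    linarith

/-- Lower bound of Berezin–Lieb type: Jensen's inequality for wave packets in `(1, +∞)`, summed with
the resolution of the identity. -/
theorem IsEigenbasis.le_tsum_profile (he : IsEigenbasis C β μ e) (hC : 0 < C) (hβ : 0 < β)
    (hF : ConvexProfile F s) :
    ∫⁻ p in {p : ℝ × ℝ | 1 ≤ p.1},
        ENNReal.ofReal (F ((2 * Real.pi * p.2) ^ 2 + windowEnergy + (C + (p.1 + 1) ^ β))) ≤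
      ∑' j, ENNReal.ofReal (F (μ j)) := by
  have hS : MeasurableSet {p : ℝ × ℝ | 1 ≤ p.1} := measurableSet_le measurable_const measurable_fst
  have hm : ∀ j, Measurable fun p => ENNReal.ofReal (F (μ j) * ‖⟪atom p, e j⟫_ℂ‖ ^ 2) := fun j =>
    (((measurable_inner_atom _).norm.pow_const 2).const_mul _).ennreal_ofReal
  calc _ ≤ ∫⁻ p in {p : ℝ × ℝ | 1 ≤ p.1},
        ∑' j, ENNReal.ofReal (F (μ j) * ‖⟪atom p, e j⟫_ℂ‖ ^ 2) :=
        setLIntegral_mono' hS fun p hp => he.profile_packet_le hC hβ hF hp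
    _ ≤ ∫⁻ p, ∑' j, ENNReal.ofReal (F (μ j) * ‖⟪atom p, e j⟫_ℂ‖ ^ 2) :=
        setLIntegral_le_lintegral _ _
    _ = ∑' j, ∫⁻ p, ENNReal.ofReal (F (μ j) * ‖⟪atom p, e j⟫_ℂ‖ ^ 2) :=
        lintegral_tsum fun j => (hm j).aemeasurable
    _ ≤ _ := by
        refine ENNReal.tsum_le_tsum fun j => ?_
        simp only [ENNReal.ofReal_mul (hF.nonneg (μ j))]
        rw [lintegral_const_mul' _ _ ENNReal.ofReal_ne_top]
        obtain ⟨φ, h, hφ, hfst, -⟩ := he.exists_seq hC hβ j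
        have hincl : Tendsto (fun n => inclTest (φ n)) atTop (𝓝 (e j)) := by
          have := ((WithLp.fstL 2 ℂ L2Half
            (WithLp 2 (L2Half × L2Half))).continuous.tendsto h).comp hφ
          rw [← hfst]
          exact this
        have h1 := lintegral_norm_sq_inner_atom_le hincl
        rw [e.orthonormal.1 j, one_pow, ENNReal.ofReal_one] at h1
        exact mul_le_of_le_one_right' h1

end

/-! ### Reduction of the phase space integrals to one variable -/

section

/-- The integral of `F ((2πξ)² + E)` over the momentum `ξ`. -/
def momentumIntegral (F : ℝ → ℝ) (E : ℝ) : ENNReal :=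
  ∫⁻ ξ : ℝ, ENNReal.ofReal (F ((2 * Real.pi * ξ) ^ 2 + E))

variable {C β : ℝ} {F s : ℝ → ℝ}

theorem ConvexProfile.antitone (hF : ConvexProfile F s) : Antitone F := fun x m hxm => by
  have h1 := hF.tangent m x
  have h2 := mul_nonneg (hF.slope_nonneg m) (sub_nonneg.2 hxm)
  linarith

theorem ConvexProfile.antitone_momentumIntegral (hF : ConvexProfile F s) :
    Antitone (momentumIntegral F) := fun _ _ h =>
  lintegral_mono fun _ => ENNReal.ofReal_le_ofReal (hF.antitone (by linarith))

theorem setLIntegral_fst {f : ℝ × ℝ → ENNReal} (hf : Measurable f) (S : Set ℝ) :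
    ∫⁻ p in {p : ℝ × ℝ | p.1 ∈ S}, f p = ∫⁻ q in S, ∫⁻ ξ, f (q, ξ) := by
  have h : {p : ℝ × ℝ | p.1 ∈ S} = S ×ˢ univ := by
    ext p
    simp
  rw [h, Measure.volume_eq_prod, setLIntegral_prod _ hf.aemeasurable]
  simp

theorem setLIntegral_phaseSymbol (hF : Measurable F) (β : ℝ) :
    ∫⁻ p in {p : ℝ × ℝ | -1 < p.1}, ENNReal.ofReal (F (phaseSymbol β p)) =
      ∫⁻ q in Ioi (-1 : ℝ), momentumIntegral F (max q 0 ^ β) :=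
  setLIntegral_fst (hF.comp (measurable_phaseSymbol β)).ennreal_ofReal _

theorem ofReal_norm_sq_mulBdd_atom {η : ℝ → ℝ} {M : ℝ} (hη : Continuous η) (hM : ∀ x, |η x| ≤ M)
    (hw : MemLp (fun x => (η x : ℂ)) ⊤ halfMeasure) (p : ℝ × ℝ) :
    ENNReal.ofReal (‖mulBdd hw (atom p)‖ ^ 2) =
      ∫⁻ x in Ioi (0 : ℝ), ENNReal.ofReal (η x ^ 2 * window (x - p.1) ^ 2) := by
  have h1 : ‖mulBdd hw (atom p)‖ ^ 2 = ∫ x in Ioi (0 : ℝ), η x ^ 2 * window (x - p.1) ^ 2 := by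
    rw [norm_sq_mulBdd]
    refine integral_congr_ae ?_
    filter_upwards [(memLp_packet p).coeFn_toLp] with x hx
    rw [atom, hx, norm_packet, sq_abs]
  rw [h1, ofReal_integral_eq_lintegral_ofReal]
  · refine Integrable.integrableOn ?_
    refine (integrable_window_sub_sq p.1).bdd_mul (c := M ^ 2)
      (hη.pow 2).aestronglyMeasurable (Eventually.of_forall fun x => ?_)
    rw [Real.norm_eq_abs, abs_pow]
    exact pow_le_pow_left₀ (abs_nonneg _) (hM x) 2
  · exact Eventually.of_forall fun x => by positivity

/-- In the integral over `(q, ξ)` only `q > x - 1` contributes to the density at `x`, and `F` is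
nonincreasing. -/
theorem ConvexProfile.lintegral_atom_le (hF : ConvexProfile F s) (hβ : 0 < β) {η : ℝ → ℝ} {M : ℝ}
    (hη : Continuous η) (hM : ∀ x, |η x| ≤ M)
    (hw : MemLp (fun x => (η x : ℂ)) ⊤ halfMeasure) :
    ∫⁻ p, ENNReal.ofReal (F (phaseSymbol β p) * ‖mulBdd hw (atom p)‖ ^ 2) ≤
      ∫⁻ x in Ioi (0 : ℝ), ENNReal.ofReal (η x ^ 2) * momentumIntegral F (max (x - 1) 0 ^ β) := by
  set Φ : ℝ → ENNReal := fun q => momentumIntegral F (max q 0 ^ β)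
  have hΦ : Antitone Φ := fun q q' h => hF.antitone_momentumIntegral
    (Real.rpow_le_rpow (le_max_right _ _) (max_le_max h le_rfl) hβ.le)
  have hm1 : Measurable fun p : ℝ × ℝ => ENNReal.ofReal (F (phaseSymbol β p)) :=
    (hF.measurable.comp (measurable_phaseSymbol β)).ennreal_ofReal
  have hw' := window_continuous
  have hm2 : Measurable fun z : ℝ × ℝ =>
      ENNReal.ofReal (η z.2 ^ 2 * window (z.2 - z.1) ^ 2) := by
    refine Measurable.ennreal_ofReal (Continuous.measurable ?_)
    fun_prop
  have hm3 : Measurable fun q => ∫⁻ x in Ioi (0 : ℝ),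
      ENNReal.ofReal (η x ^ 2 * window (x - q) ^ 2) := hm2.lintegral_prod_right'
  have hm4 : ∀ q, Measurable fun ξ : ℝ => ENNReal.ofReal (F (phaseSymbol β (q, ξ))) := fun q =>
    hm1.comp measurable_prodMk_left
  have hm6 : Measurable fun p : ℝ × ℝ => ENNReal.ofReal (F (phaseSymbol β p)) *
      ∫⁻ x in Ioi (0 : ℝ), ENNReal.ofReal (η x ^ 2 * window (x - p.1) ^ 2) :=
    hm1.mul (hm3.comp measurable_fst)
  simp only [ENNReal.ofReal_mul (hF.nonneg _), ofReal_norm_sq_mulBdd_atom hη hM hw]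
  rw [Measure.volume_eq_prod, lintegral_prod _ hm6.aemeasurable]
  calc _ = ∫⁻ q, Φ q * ∫⁻ x in Ioi (0 : ℝ), ENNReal.ofReal (η x ^ 2 * window (x - q) ^ 2) := by
        refine lintegral_congr fun q => ?_
        exact lintegral_mul_const
          (∫⁻ x in Ioi (0 : ℝ), ENNReal.ofReal (η x ^ 2 * window (x - q) ^ 2)) (hm4 q)
    _ = ∫⁻ q, ∫⁻ x in Ioi (0 : ℝ), Φ q * ENNReal.ofReal (η x ^ 2 * window (x - q) ^ 2) := by
        refine lintegral_congr fun q => ?_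
        exact (lintegral_const_mul _ (hm2.comp measurable_prodMk_left)).symm
    _ = ∫⁻ x in Ioi (0 : ℝ), ∫⁻ q, Φ q * ENNReal.ofReal (η x ^ 2 * window (x - q) ^ 2) :=
        lintegral_lintegral_swap ((hΦ.measurable.comp measurable_fst).mul hm2).aemeasurable
    _ ≤ _ := by
        refine lintegral_mono fun x => ?_
        have hle : ∀ q, Φ q * ENNReal.ofReal (η x ^ 2 * window (x - q) ^ 2) ≤
            ENNReal.ofReal (η x ^ 2) * Φ (x - 1) * ENNReal.ofReal (window (x - q) ^ 2) :=
            fun q => by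
          rw [ENNReal.ofReal_mul (sq_nonneg _)]
          by_cases h0 : window (x - q) = 0
          · simp [h0]
          · -- the packet at `q` lives in `(q, q + 1)`
            have := (mem_Ioo_of_window_ne_zero h0).2
            have h1 : Φ q ≤ Φ (x - 1) := hΦ (by linarith)
            calc _ ≤ Φ (x - 1) * (ENNReal.ofReal (η x ^ 2) * ENNReal.ofReal (window (x - q) ^ 2)) :=
                  mul_le_mul_left h1 _
              _ = _ := by ring
        refine (lintegral_mono hle).trans_eq ?_
        have hm5 : Measurable fun q => ENNReal.ofReal (window (x - q) ^ 2) :=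
          Measurable.ennreal_ofReal (Continuous.measurable (by fun_prop))
        have h1 := (integral_window_sub_left 1 x).2
        simp only [mul_one] at h1
        rw [lintegral_const_mul _ hm5, ← ofReal_integral_eq_lintegral_ofReal
          (integrable_window_sq.comp_sub_left x) (Eventually.of_forall fun q => sq_nonneg _), h1,
          ENNReal.ofReal_one, mul_one]

theorem setLIntegral_shift (f : ℝ → ENNReal) (a c : ℝ) :
    ∫⁻ x in Ioi (a + c), f (x - c) = ∫⁻ x in Ioi a, f x := by
  have hmp := (measurePreserving_sub_right volume c).setLIntegral_comp_preimage_emb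
    (measurableEmbedding_subRight c) f (Ioi a)
  have h2 : (fun x : ℝ => x - c) ⁻¹' Ioi a = Ioi (a + c) := by
    ext x
    simp only [mem_preimage, mem_Ioi]
    constructor <;> intro h <;> linarith
  rw [← hmp, h2]

/-- The shifted potential vanishes on `(0, 1]` and is a translate of `x ^ β` beyond. -/
theorem setLIntegral_shifted_potential (hβ : 0 < β) (Φ : ℝ → ENNReal) :
    ∫⁻ x in Ioi (0 : ℝ), Φ (max (x - 1) 0 ^ β) = Φ 0 + ∫⁻ x in Ioi (0 : ℝ), Φ (x ^ β) := by
  rw [← Ioc_union_Ioi_eq_Ioi (zero_le_one' ℝ),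
    lintegral_union measurableSet_Ioi (Ioc_disjoint_Ioi le_rfl)]
  congr 1
  · rw [setLIntegral_congr_fun (g := fun _ => Φ 0) measurableSet_Ioc fun x hx => ?_]
    · simp
    · rw [max_eq_right (by linarith [hx.2]), Real.zero_rpow hβ.ne']
  · have h := setLIntegral_shift (fun x => Φ (x ^ β)) 0 1
    rw [zero_add] at h
    rw [Ioc_union_Ioi_eq_Ioi (zero_le_one' ℝ), ← h]
    refine setLIntegral_congr_fun measurableSet_Ioi fun x hx => ?_
    have hx1 : (1 : ℝ) < x := hx
    rw [max_eq_left (by linarith)]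

variable {μ : ℕ → ℝ} {e : HilbertBasis ℕ ℂ L2Half} {η : ℝ → ℝ} {a M : ℝ}

/-- Localized upper bound, with the momentum integrated out. The shift `x - 1` of the potential
comes from the width of the window. -/
theorem IsEigenbasis.tsum_profile_le_momentumIntegral (he : IsEigenbasis C β μ e) (hC : 0 < C)
    (hβ : 0 < β) (hF : ConvexProfile F s) (hη : ContDiff ℝ ∞ η)
    (hηa : ∀ x, |deriv η x| ≤ a * η x) (hM : ∀ x, |η x| ≤ M)
    (hw : MemLp (fun x => (η x : ℂ)) ⊤ halfMeasure)
    (hfin : ∫⁻ x in Ioi (0 : ℝ), momentumIntegral F (max (x - 1) 0 ^ β) ≠ ⊤) :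
    ∑' j, ENNReal.ofReal (F (μ j + a ^ 2 + windowEnergy) * ‖mulBdd hw (e j)‖ ^ 2) ≤
      ∫⁻ x in Ioi (0 : ℝ), ENNReal.ofReal (η x ^ 2) * momentumIntegral F (max (x - 1) 0 ^ β) := by
  refine (he.tsum_profile_le hC hβ hF hη hηa hM hw ?_).trans
    (hF.lintegral_atom_le hβ hη.continuous hM hw)
  rwa [setLIntegral_phaseSymbol hF.measurable, ← setLIntegral_shift _ _ 1, neg_add_cancel]

/-- Upper bound for the sum over all eigenvalues, with the momentum integrated out. -/
theorem IsEigenbasis.tsum_le_momentumIntegral (he : IsEigenbasis C β μ e) (hC : 0 < C)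
    (hβ : 0 < β) (hF : ConvexProfile F s)
    (hfin : ∫⁻ x in Ioi (0 : ℝ), momentumIntegral F (max (x - 1) 0 ^ β) ≠ ⊤) :
    ∑' j, ENNReal.ofReal (F (μ j + windowEnergy)) ≤
      ∫⁻ x in Ioi (0 : ℝ), momentumIntegral F (max (x - 1) 0 ^ β) := by
  have hM : ∀ x : ℝ, |(fun _ => 1 : ℝ → ℝ) x| ≤ 1 := fun x => by simp
  have hw := memLp_top_of_bounded (η := fun _ => 1) continuous_const hM
  have h := he.tsum_profile_le_momentumIntegral (a := 0) hC hβ hF contDiff_const (by simp) hM hw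
    hfin
  have h1 : ∀ j, ‖mulBdd hw (e j)‖ ^ 2 = 1 := fun j => by
    have h2 := norm_sq_eq_integral (e j)
    rw [e.orthonormal.1 j] at h2
    rw [norm_sq_mulBdd]
    simpa using h2.symm
  simpa [h1] using h

/-- Lower bound for the sum over all eigenvalues, with the momentum integrated out. -/
theorem IsEigenbasis.momentumIntegral_le_tsum (he : IsEigenbasis C β μ e) (hC : 0 < C)
    (hβ : 0 < β) (hF : ConvexProfile F s) :
    ∫⁻ x in Ioi (2 : ℝ), momentumIntegral F (windowEnergy + C + x ^ β) ≤
      ∑' j, ENNReal.ofReal (F (μ j)) := by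
  refine le_trans ?_ (he.le_tsum_profile hC hβ hF)
  have hm : Measurable fun p : ℝ × ℝ => ENNReal.ofReal
      (F ((2 * Real.pi * p.2) ^ 2 + windowEnergy + (C + (p.1 + 1) ^ β))) := by
    refine (hF.measurable.comp ?_).ennreal_ofReal
    fun_prop
  have h1 := setLIntegral_fst hm (Ici 1)
  refine le_of_le_of_eq ?_ h1.symm
  rw [setLIntegral_congr Ioi_ae_eq_Ici.symm]
  have h2 := setLIntegral_shift (fun q => ∫⁻ ξ, ENNReal.ofReal
    (F ((2 * Real.pi * ξ) ^ 2 + windowEnergy + (C + (q + 1) ^ β)))) 1 1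
  rw [one_add_one_eq_two] at h2
  refine le_of_le_of_eq ?_ h2
  refine le_of_eq (lintegral_congr fun q => lintegral_congr fun ξ => ?_)
  rw [sub_add_cancel, add_assoc, add_assoc]

/-! ### The two profiles -/

theorem convexProfile_exp {τ : ℝ} (hτ : 0 < τ) :
    ConvexProfile (fun x => Real.exp (-τ * x)) (fun m => τ * Real.exp (-τ * m)) where
  measurable := by fun_prop
  nonneg x := (Real.exp_pos _).le
  slope_nonneg m := by positivity
  tangent m x := by
    have h1 := Real.add_one_le_exp (τ * (m - x))
    have h2 : Real.exp (-τ * x) = Real.exp (-τ * m) * Real.exp (τ * (m - x)) := by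
      rw [← Real.exp_add]; congr 1; ring
    have h3 := mul_le_mul_of_nonneg_left h1 (Real.exp_pos (-τ * m)).le
    rw [h2]
    linarith

/-- A Gaussian integral. -/
theorem momentumIntegral_exp {τ : ℝ} (hτ : 0 < τ) (E : ℝ) :
    momentumIntegral (fun x => Real.exp (-τ * x)) E =
      ENNReal.ofReal (1 / √(4 * Real.pi * τ)) * ENNReal.ofReal (Real.exp (-τ * E)) := by
  have hb : 0 < τ * (2 * Real.pi) ^ 2 := by positivity
  have h1 : ∀ ξ : ℝ, Real.exp (-τ * ((2 * Real.pi * ξ) ^ 2 + E)) =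
      Real.exp (-(τ * (2 * Real.pi) ^ 2) * ξ ^ 2) * Real.exp (-τ * E) := fun ξ => by
    rw [← Real.exp_add]; congr 1; ring
  unfold momentumIntegral
  simp only [h1]
  rw [← ofReal_integral_eq_lintegral_ofReal ((integrable_exp_neg_mul_sq hb).mul_const _)
    (Eventually.of_forall fun ξ => by positivity), integral_mul_const, integral_gaussian,
    ← ENNReal.ofReal_mul (by positivity)]
  congr 2
  rw [one_div, ← Real.sqrt_inv]
  congr 1
  have := Real.pi_pos
  field_simp
  norm_num

theorem convexProfile_riesz (Λ : ℝ) :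
    ConvexProfile (fun x => max (Λ - x) 0) (fun m => if m < Λ then 1 else 0) where
  measurable := by fun_prop
  nonneg x := le_max_right _ _
  slope_nonneg m := by split_ifs <;> norm_num
  tangent m x := by
    split_ifs with h
    · rw [max_eq_left (by linarith)]
      have := le_max_left (Λ - x) 0
      linarith
    · rw [max_eq_right (by linarith)]
      have := le_max_right (Λ - x) 0
      linarith

end

/-! ### Measures comparable on initial and final intervals -/

/-- Layer-cake formula: comparison of measures on the superlevel sets of `f ≤ 1` gives comparison of
integrals, with the same error. -/
theorem lintegral_le_of_superlevel_le {ν m : Measure ℝ} {R : ENNReal} {f : ℝ → ℝ}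
    (hf : Measurable f) (h0 : ∀ x, 0 ≤ f x) (h1 : ∀ x, f x ≤ 1)
    (h : ∀ t, ν {x | t < f x} ≤ m {x | t < f x} + R) :
    ∫⁻ x, ENNReal.ofReal (f x) ∂ν ≤ ∫⁻ x, ENNReal.ofReal (f x) ∂m + R := by
  have key : ∀ ρ : Measure ℝ, ∫⁻ x, ENNReal.ofReal (f x) ∂ρ =
      ∫⁻ t in Ioc (0 : ℝ) 1, ρ {x | t < f x} := fun ρ => by
    rw [lintegral_eq_lintegral_meas_lt ρ (Eventually.of_forall h0) hf.aemeasurable,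
      ← Ioc_union_Ioi_eq_Ioi (zero_le_one' ℝ),
      lintegral_union measurableSet_Ioi (Ioc_disjoint_Ioi le_rfl)]
    rw [setLIntegral_congr_fun (g := fun _ => 0) measurableSet_Ioi fun t ht => ?_]
    · simp
    · have : {x | t < f x} = ∅ := by
        ext x
        have h2 := h1 x
        have h3 : (1 : ℝ) < t := ht
        simp only [mem_ofPred_eq, mem_empty_iff_false, iff_false, not_lt]
        linarith
      rw [this, measure_empty]
  rw [key, key]
  calc _ ≤ ∫⁻ t in Ioc (0 : ℝ) 1, (m {x | t < f x} + R) := lintegral_mono fun t => h t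
    _ = _ := by
      rw [lintegral_add_right _ measurable_const]
      simp

/-- If `ν` exceeds a finite measure `m` by at most `R₁` on all initial and final intervals, and `m`
exceeds `ν` by at most `R₂` in total mass, then the integrals of a nonincreasing function `f` with
values in `[0, 1]` differ by at most `R₁ + R₂`. The lower bound for `ν` comes from the upper bound
for the integral of `1 - f`. -/
theorem lintegral_antitone_comparison {ν m : Measure ℝ} {R₁ R₂ : ENNReal} (hm : m univ ≠ ⊤)
    {f : ℝ → ℝ} (hf : Antitone f) (h0 : ∀ x, 0 ≤ f x) (h1 : ∀ x, f x ≤ 1)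
    (hlow : ∀ S : Set ℝ, IsLowerSet S → MeasurableSet S → ν S ≤ m S + R₁)
    (hupp : ∀ S : Set ℝ, IsUpperSet S → MeasurableSet S → ν S ≤ m S + R₁)
    (htot : m univ ≤ ν univ + R₂) :
    ∫⁻ x, ENNReal.ofReal (f x) ∂ν ≤ ∫⁻ x, ENNReal.ofReal (f x) ∂m + R₁ ∧
      ∫⁻ x, ENNReal.ofReal (f x) ∂m ≤ ∫⁻ x, ENNReal.ofReal (f x) ∂ν + (R₁ + R₂) := by
  have hfm := hf.measurable
  have hgm : Measurable fun x => 1 - f x := measurable_const.sub hfm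
  refine ⟨lintegral_le_of_superlevel_le hfm h0 h1 fun t => hlow _ (fun x y hyx hx =>
    lt_of_lt_of_le hx (hf hyx)) (measurableSet_lt measurable_const hfm), ?_⟩
  have h2 : ∫⁻ x, ENNReal.ofReal (1 - f x) ∂ν ≤ ∫⁻ x, ENNReal.ofReal (1 - f x) ∂m + R₁ :=
    lintegral_le_of_superlevel_le hgm (fun x => sub_nonneg.2 (h1 x)) (fun x => by linarith [h0 x])
      fun t => hupp _ (fun x y hxy hx => by
        have := hf hxy
        have hx' : t < 1 - f x := hx
        change t < 1 - f y
        linarith) (measurableSet_lt measurable_const hgm)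
  have hsplit : ∀ ρ : Measure ℝ, ρ univ =
      ∫⁻ x, ENNReal.ofReal (f x) ∂ρ + ∫⁻ x, ENNReal.ofReal (1 - f x) ∂ρ := fun ρ => by
    rw [← lintegral_add_left hfm.ennreal_ofReal, ← lintegral_one]
    refine lintegral_congr fun x => ?_
    rw [← ENNReal.ofReal_add (h0 x) (sub_nonneg.2 (h1 x))]
    simp
  have hfin : ∫⁻ x, ENNReal.ofReal (1 - f x) ∂m ≠ ⊤ := fun h => hm (by rw [hsplit, h, add_top])
  have h3 : ∫⁻ x, ENNReal.ofReal (f x) ∂m + ∫⁻ x, ENNReal.ofReal (1 - f x) ∂m ≤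
      (∫⁻ x, ENNReal.ofReal (f x) ∂ν + (R₁ + R₂)) + ∫⁻ x, ENNReal.ofReal (1 - f x) ∂m := by
    rw [← hsplit]
    refine htot.trans ?_
    rw [hsplit]
    calc _ ≤ ∫⁻ x, ENNReal.ofReal (f x) ∂ν + (∫⁻ x, ENNReal.ofReal (1 - f x) ∂m + R₁) + R₂ := by
          gcongr
      _ = _ := by ring
  exact (ENNReal.add_le_add_iff_right hfin).1 h3

/-! ### A slowly varying majorant of a step function -/

/-- The function `(1 + eʸ) / (1 + e²ʸ)`: it is at least `1` for `y ≤ 0`, it decays like `2 e⁻ʸ`, and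
its logarithmic derivative is bounded. -/
def stepMajorant (y : ℝ) : ℝ := (1 + Real.exp y) / (1 + Real.exp y ^ 2)

theorem contDiff_stepMajorant : ContDiff ℝ ∞ stepMajorant := by
  refine ContDiff.div ?_ ?_ fun y => by positivity
  · exact contDiff_const.add Real.contDiff_exp
  · exact contDiff_const.add (Real.contDiff_exp.pow 2)

theorem abs_stepMajorant_le (y : ℝ) : |stepMajorant y| ≤ 2 := by
  have h := Real.exp_pos y
  rw [stepMajorant, abs_of_pos (by positivity), div_le_iff₀ (by positivity)]
  nlinarith [sq_nonneg (Real.exp y - 1 / 4)]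

theorem hasDerivAt_stepMajorant (y : ℝ) : HasDerivAt stepMajorant
    (Real.exp y * (1 - 2 * Real.exp y - Real.exp y ^ 2) / (1 + Real.exp y ^ 2) ^ 2) y := by
  have h1 := (Real.hasDerivAt_exp y).const_add 1
  have h2 : HasDerivAt (fun y => 1 + Real.exp y ^ 2) (2 * Real.exp y * Real.exp y) y := by
    simpa using ((Real.hasDerivAt_exp y).fun_pow 2).const_add 1
  refine (h1.div h2 (by positivity)).congr_deriv ?_
  congr 1
  ring

theorem abs_deriv_stepMajorant_le (y : ℝ) : |deriv stepMajorant y| ≤ 2 * stepMajorant y := by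
  rw [(hasDerivAt_stepMajorant y).deriv, stepMajorant]
  set t := Real.exp y
  have ht : 0 < t := Real.exp_pos y
  have h2 : 2 * ((1 + t) / (1 + t ^ 2)) = 2 * (1 + t) * (1 + t ^ 2) / (1 + t ^ 2) ^ 2 := by
    field_simp
  rw [h2, abs_div, abs_of_pos (by positivity : 0 < (1 + t ^ 2) ^ 2)]
  refine div_le_div_of_nonneg_right ?_ (by positivity)
  rw [abs_le]
  constructor <;> nlinarith [pow_pos ht 2, pow_pos ht 3]

theorem one_le_stepMajorant {y : ℝ} (hy : y ≤ 0) : 1 ≤ stepMajorant y := by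
  have h := Real.exp_pos y
  have h1 := Real.exp_le_one_iff.2 hy
  rw [stepMajorant, le_div_iff₀ (by positivity)]
  nlinarith

theorem stepMajorant_sq_le_of_nonneg {y : ℝ} (hy : 0 ≤ y) :
    stepMajorant y ^ 2 ≤ 4 * Real.exp (-|y|) := by
  have h1 := Real.one_le_exp hy
  rw [stepMajorant, abs_of_nonneg hy, Real.exp_neg, div_pow, div_le_iff₀ (by positivity)]
  set t := Real.exp y
  have ht : 0 < t := by linarith
  rw [mul_assoc, ← div_eq_inv_mul, ← mul_div_assoc, le_div_iff₀ ht]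
  nlinarith [pow_pos ht 2, pow_pos ht 3, pow_pos ht 4]

theorem stepMajorant_sq_le_of_nonpos {y : ℝ} (hy : y ≤ 0) :
    stepMajorant y ^ 2 ≤ 1 + 4 * Real.exp (-|y|) := by
  have h1 := Real.exp_le_one_iff.2 hy
  rw [stepMajorant, abs_of_nonpos hy, neg_neg, div_pow, div_le_iff₀ (by positivity)]
  set t := Real.exp y
  have ht : 0 < t := Real.exp_pos y
  nlinarith [pow_pos ht 2, pow_pos ht 3, pow_pos ht 4, pow_pos ht 5]

theorem lintegral_exp_neg_abs : ∫⁻ y : ℝ, ENNReal.ofReal (4 * Real.exp (-|y|)) = 8 := by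
  have h : ∫ y : ℝ, Real.exp (-|y|) = 2 := by
    rw [integral_comp_abs (f := fun y => Real.exp (-y)), integral_exp_neg_Ioi_zero, mul_one]
  have hint : Integrable fun y : ℝ => Real.exp (-|y|) :=
    Integrable.of_integral_ne_zero (by rw [h]; norm_num)
  rw [← ofReal_integral_eq_lintegral_ofReal (hint.const_mul 4)
    (Eventually.of_forall fun y => by positivity), integral_const_mul, h]
  norm_num

/-! ### The diagonal of the heat kernel and its classical counterpart -/

section

/-- The measure on `(0, +∞)` with density the diagonal `∑ⱼ e^{-τ μⱼ} |eⱼ(x)|²` of the heat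
kernel. -/
def heatMeasure (μ : ℕ → ℝ) (e : HilbertBasis ℕ ℂ L2Half) (τ : ℝ) : Measure ℝ :=
  Measure.sum fun j => ENNReal.ofReal (Real.exp (-τ * μ j)) •
    halfMeasure.withDensity fun x => ENNReal.ofReal (‖e j x‖ ^ 2)

/-- The measure on `(0, +∞)` with density `(4πτ)^{-1/2} e^{-τ x ^ β}`. -/
def classicalMeasure (β τ : ℝ) : Measure ℝ :=
  ENNReal.ofReal (1 / √(4 * Real.pi * τ)) •
    halfMeasure.withDensity fun x => ENNReal.ofReal (Real.exp (-τ * x ^ β))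

variable {C β τ : ℝ} {μ : ℕ → ℝ} {e : HilbertBasis ℕ ℂ L2Half}

theorem measurable_norm_sq (u : L2Half) : Measurable fun x => ENNReal.ofReal (‖u x‖ ^ 2) :=
  ((Lp.stronglyMeasurable u).measurable.norm.pow_const 2).ennreal_ofReal

theorem lintegral_heatMeasure (μ : ℕ → ℝ) (e : HilbertBasis ℕ ℂ L2Half) (τ : ℝ) {f : ℝ → ENNReal}
    (hf : Measurable f) : ∫⁻ x, f x ∂heatMeasure μ e τ =
      ∑' j, ENNReal.ofReal (Real.exp (-τ * μ j)) *
        ∫⁻ x in Ioi (0 : ℝ), ENNReal.ofReal (‖e j x‖ ^ 2) * f x := by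
  rw [heatMeasure, lintegral_sum_measure]
  refine tsum_congr fun j => ?_
  rw [lintegral_smul_measure, lintegral_withDensity_eq_lintegral_mul _ (measurable_norm_sq _) hf]
  rfl

theorem lintegral_classicalMeasure (β τ : ℝ) {f : ℝ → ENNReal} (hf : Measurable f) :
    ∫⁻ x, f x ∂classicalMeasure β τ = ENNReal.ofReal (1 / √(4 * Real.pi * τ)) *
        ∫⁻ x in Ioi (0 : ℝ), ENNReal.ofReal (Real.exp (-τ * x ^ β)) * f x := by
  rw [classicalMeasure, lintegral_smul_measure,
    lintegral_withDensity_eq_lintegral_mul _ (by fun_prop) hf]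
  rfl

theorem lintegral_norm_sq_mul {w : ℝ → ℝ} {M : ℝ} (hw : Measurable w) (hM : ∀ x, |w x| ≤ M)
    (h0 : ∀ x, 0 ≤ w x) (u : L2Half) :
    ∫⁻ x in Ioi (0 : ℝ), ENNReal.ofReal (‖u x‖ ^ 2) * ENNReal.ofReal (w x) =
      ENNReal.ofReal (∫ x in Ioi (0 : ℝ), ‖u x‖ ^ 2 * w x) := by
  rw [ofReal_integral_eq_lintegral_ofReal]
  · simp only [ENNReal.ofReal_mul (sq_nonneg _)]
  · exact (integrable_norm_sq u).mul_bdd (c := M) hw.aestronglyMeasurable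
      (Eventually.of_forall hM)
  · exact Eventually.of_forall fun x => mul_nonneg (sq_nonneg _) (h0 x)

theorem heatMeasure_univ (μ : ℕ → ℝ) (e : HilbertBasis ℕ ℂ L2Half) (τ : ℝ) :
    heatMeasure μ e τ univ = ∑' j, ENNReal.ofReal (Real.exp (-τ * μ j)) := by
  rw [← lintegral_one, lintegral_heatMeasure μ e τ measurable_const]
  refine tsum_congr fun j => ?_
  have h := lintegral_norm_sq_mul (w := fun _ => 1) (M := 1) measurable_const (by simp) (by simp)
    (e j)
  have h2 := norm_sq_eq_integral (e j)
  rw [e.orthonormal.1 j] at h2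
  simp only [mul_one, ← h2, ENNReal.ofReal_one, one_pow] at h ⊢
  rw [h, mul_one]

theorem lintegral_exp_rpow (hβ : 0 < β) (hτ : 0 < τ) :
    ∫⁻ x in Ioi (0 : ℝ), ENNReal.ofReal (Real.exp (-τ * x ^ β)) =
      ENNReal.ofReal (τ ^ (-1 / β) * Real.Gamma (1 / β + 1)) := by
  rw [← integral_exp_neg_mul_rpow hβ hτ, ofReal_integral_eq_lintegral_ofReal]
  · have h := integrableOn_rpow_mul_exp_neg_mul_rpow (s := 0) (by norm_num) hβ hτ
    simp only [Real.rpow_zero, one_mul] at h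
    exact h
  · exact Eventually.of_forall fun x => (Real.exp_pos _).le

theorem classicalMeasure_univ (hβ : 0 < β) (hτ : 0 < τ) :
    classicalMeasure β τ univ = ENNReal.ofReal (1 / √(4 * Real.pi * τ)) *
      ENNReal.ofReal (τ ^ (-1 / β) * Real.Gamma (1 / β + 1)) := by
  rw [← lintegral_one, lintegral_classicalMeasure β τ measurable_const]
  simp only [mul_one, lintegral_exp_rpow hβ hτ]

/-- Translating the potential by `1` costs at most `1`, on any set. -/
theorem lintegral_shifted_exp_le (hβ : 0 < β) (hτ : 0 < τ) {h : ℝ → ENNReal} (hh : Measurable h)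
    (h1 : ∀ x, h x ≤ 1) :
    ∫⁻ x in Ioi (0 : ℝ), h x * ENNReal.ofReal (Real.exp (-τ * max (x - 1) 0 ^ β)) ≤
      (∫⁻ x in Ioi (0 : ℝ), h x * ENNReal.ofReal (Real.exp (-τ * x ^ β))) + 1 := by
  set g : ℝ → ENNReal := fun x => ENNReal.ofReal (Real.exp (-τ * max (x - 1) 0 ^ β))
  set E : ℝ → ENNReal := fun x => ENNReal.ofReal (Real.exp (-τ * x ^ β))
  have hg : Measurable g := by fun_prop
  have hE : Measurable E := by fun_prop
  have hEfin : ∫⁻ x in Ioi (0 : ℝ), E x ≠ ⊤ := by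
    rw [lintegral_exp_rpow hβ hτ]
    exact ENNReal.ofReal_ne_top
  have hle : ∀ x ∈ Ioi (0 : ℝ), E x ≤ g x := fun x hx => by
    have hx0 : (0 : ℝ) < x := hx
    refine ENNReal.ofReal_le_ofReal (Real.exp_le_exp.2 ?_)
    have := Real.rpow_le_rpow (le_max_right (x - 1) 0)
      (max_le (by linarith) hx0.le : max (x - 1) 0 ≤ x) hβ.le
    nlinarith
  have hdiff : ∫⁻ x in Ioi (0 : ℝ), (g x - E x) = 1 := by
    rw [lintegral_sub hE hEfin ((ae_restrict_iff' measurableSet_Ioi).2 (Eventually.of_forall hle))]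
    have h2 := setLIntegral_shifted_potential hβ fun y => ENNReal.ofReal (Real.exp (-τ * y))
    simp only [mul_zero, Real.exp_zero, ENNReal.ofReal_one] at h2
    rw [h2]
    exact ENNReal.add_sub_cancel_right hEfin
  calc _ ≤ ∫⁻ x in Ioi (0 : ℝ), (h x * E x + (g x - E x)) := by
        refine setLIntegral_mono' measurableSet_Ioi fun x hx => ?_
        calc h x * g x = h x * (E x + (g x - E x)) := by rw [add_tsub_cancel_of_le (hle x hx)]
          _ = h x * E x + h x * (g x - E x) := mul_add _ _ _
          _ ≤ _ := by
            gcongr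
            exact mul_le_of_le_one_left' (h1 x)
    _ = _ := by
        have hm : Measurable fun x => h x * E x := hh.mul hE
        rw [lintegral_add_left hm, hdiff]

theorem momentumIntegral_exp_ne_top (hβ : 0 < β) (hτ : 0 < τ) :
    ∫⁻ x in Ioi (0 : ℝ), momentumIntegral (fun x => Real.exp (-τ * x)) (max (x - 1) 0 ^ β) ≠ ⊤ := by
  simp only [momentumIntegral_exp hτ]
  rw [lintegral_const_mul' _ _ ENNReal.ofReal_ne_top]
  refine ENNReal.mul_ne_top ENNReal.ofReal_ne_top ?_
  have h := lintegral_shifted_exp_le hβ hτ (h := fun _ => 1) measurable_const fun _ => le_rfl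
  simp only [one_mul] at h
  refine (h.trans_lt ?_).ne
  rw [lintegral_exp_rpow hβ hτ]
  exact ENNReal.add_lt_top.2 ⟨ENNReal.ofReal_lt_top, ENNReal.one_lt_top⟩

/-- Localized upper bound for the heat kernel on the diagonal. -/
theorem IsEigenbasis.lintegral_heatMeasure_le (he : IsEigenbasis C β μ e) (hC : 0 < C) (hβ : 0 < β)
    (hτ : 0 < τ) {η : ℝ → ℝ} {a M : ℝ} (hη : ContDiff ℝ ∞ η) (hηa : ∀ x, |deriv η x| ≤ a * η x)
    (hM : ∀ x, |η x| ≤ M) :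
    ∫⁻ x, ENNReal.ofReal (η x ^ 2) ∂heatMeasure μ e τ ≤
      ENNReal.ofReal (Real.exp (τ * (a ^ 2 + windowEnergy))) *
        (ENNReal.ofReal (1 / √(4 * Real.pi * τ)) * ∫⁻ x in Ioi (0 : ℝ), ENNReal.ofReal (η x ^ 2) *
          ENNReal.ofReal (Real.exp (-τ * max (x - 1) 0 ^ β))) := by
  have hw := memLp_top_of_bounded hη.continuous hM
  have h := he.tsum_profile_le_momentumIntegral hC hβ (convexProfile_exp hτ) hη hηa hM hw
    (momentumIntegral_exp_ne_top hβ hτ)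
  simp only [momentumIntegral_exp hτ, mul_left_comm (ENNReal.ofReal (η _ ^ 2))] at h
  rw [lintegral_const_mul' _ _ ENNReal.ofReal_ne_top] at h
  refine le_trans (le_of_eq ?_) (mul_le_mul_right h _)
  have hηc := hη.continuous
  rw [lintegral_heatMeasure μ e τ (by fun_prop), ← ENNReal.tsum_mul_left]
  refine tsum_congr fun j => ?_
  have hM2 : ∀ x, |η x ^ 2| ≤ M ^ 2 := fun x => by
    rw [abs_pow]
    exact pow_le_pow_left₀ (abs_nonneg _) (hM x) 2
  rw [lintegral_norm_sq_mul (w := fun x => η x ^ 2) (hηc.pow 2).measurable hM2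
    (fun x => sq_nonneg _), norm_sq_mulBdd,
    ← ENNReal.ofReal_mul (Real.exp_pos _).le, ← ENNReal.ofReal_mul (Real.exp_pos _).le,
    ← mul_assoc, ← Real.exp_add]
  congr 2
  · congr 1
    ring
  · simp only [mul_comm]

/-- The error in the upper bound for the heat measure of an interval. Here
`τ ^ (-1 / β) Γ(1 / β + 1)` is the integral of `e^{-τ x ^ β}`, the shift `4 + windowEnergy` of the
energy comes from `|η'| ≤ 2 η`, and `9` is the sum of the excess `8` of the majorant and of the
cost `1` of translating the potential. -/
def intervalError (β τ : ℝ) : ℝ :=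
  1 / √(4 * Real.pi * τ) * (τ * (4 + windowEnergy) * Real.exp (4 + windowEnergy) *
    (τ ^ (-1 / β) * Real.Gamma (1 / β + 1)) + 9 * Real.exp (4 + windowEnergy))

/-- Upper bound for the heat measure of a set `S` whose indicator function lies below `η²`, with an
excess `d` of total mass at most `8`, the integral of `4 e^{-|y|}`. -/
theorem IsEigenbasis.heatMeasure_le_of_majorant (he : IsEigenbasis C β μ e) (hC : 0 < C)
    (hβ : 0 < β) (hτ : 0 < τ) (hτ1 : τ ≤ 1) {η d : ℝ → ℝ} {M : ℝ} (hη : ContDiff ℝ ∞ η)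
    (hηa : ∀ x, |deriv η x| ≤ 2 * η x) (hM : ∀ x, |η x| ≤ M) {S : Set ℝ} (hS : MeasurableSet S)
    (hS1 : ∀ x ∈ S, 1 ≤ η x ^ 2) (hSd : ∀ x ∈ S, η x ^ 2 ≤ 1 + d x)
    (hSc : ∀ x ∉ S, η x ^ 2 ≤ d x) (hd0 : ∀ x, 0 ≤ d x)
    (hd : ∫⁻ x, ENNReal.ofReal (d x) ≤ 8) :
    heatMeasure μ e τ S ≤ classicalMeasure β τ S + ENNReal.ofReal (intervalError β τ) := by
  have hκ := windowEnergy_nonneg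
  set c := 4 + windowEnergy with hc
  have hJ : 0 ≤ τ ^ (-1 / β) * Real.Gamma (1 / β + 1) :=
    mul_nonneg (by positivity) (Real.Gamma_pos_of_pos (by positivity)).le
  set J := τ ^ (-1 / β) * Real.Gamma (1 / β + 1) with hJdef
  set G := 1 / √(4 * Real.pi * τ) with hG
  have hG0 : 0 ≤ G := by positivity
  have hind : Measurable (S.indicator fun _ => (1 : ENNReal)) := measurable_const.indicator hS
  -- the integral of `η²` against the translated density
  have h1 : ∫⁻ x in Ioi (0 : ℝ), ENNReal.ofReal (η x ^ 2) *
      ENNReal.ofReal (Real.exp (-τ * max (x - 1) 0 ^ β)) ≤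
      (∫⁻ x in Ioi (0 : ℝ), S.indicator (fun _ => (1 : ENNReal)) x *
        ENNReal.ofReal (Real.exp (-τ * x ^ β))) + 9 := by
    have h2 : ∀ x, ENNReal.ofReal (η x ^ 2) *
        ENNReal.ofReal (Real.exp (-τ * max (x - 1) 0 ^ β)) ≤
        S.indicator (fun _ => (1 : ENNReal)) x *
          ENNReal.ofReal (Real.exp (-τ * max (x - 1) 0 ^ β)) + ENNReal.ofReal (d x) := fun x => by
      have h3 : ENNReal.ofReal (η x ^ 2) ≤
          S.indicator (fun _ => (1 : ENNReal)) x + ENNReal.ofReal (d x) := by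
        by_cases hx : x ∈ S
        · rw [indicator_of_mem hx, ← ENNReal.ofReal_one, ← ENNReal.ofReal_add zero_le_one (hd0 x)]
          exact ENNReal.ofReal_le_ofReal (hSd x hx)
        · rw [indicator_of_notMem hx, zero_add]
          exact ENNReal.ofReal_le_ofReal (hSc x hx)
      have h4 : ENNReal.ofReal (Real.exp (-τ * max (x - 1) 0 ^ β)) ≤ 1 := by
        rw [← ENNReal.ofReal_one]
        refine ENNReal.ofReal_le_ofReal (Real.exp_le_one_iff.2 ?_)
        have : 0 ≤ max (x - 1) 0 ^ β := by positivity
        nlinarith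
      calc _ ≤ (S.indicator (fun _ => (1 : ENNReal)) x + ENNReal.ofReal (d x)) *
            ENNReal.ofReal (Real.exp (-τ * max (x - 1) 0 ^ β)) := mul_le_mul_left h3 _
        _ ≤ _ := by
            rw [add_mul]
            gcongr
            exact mul_le_of_le_one_right' h4
    refine (lintegral_mono h2).trans ?_
    have hm : Measurable fun x => S.indicator (fun _ => (1 : ENNReal)) x *
        ENNReal.ofReal (Real.exp (-τ * max (x - 1) 0 ^ β)) := hind.mul (by fun_prop)
    rw [lintegral_add_left hm]
    have h5 := lintegral_shifted_exp_le hβ hτ hind fun x =>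
      indicator_le_self' (fun _ _ => zero_le) x
    calc _ ≤ ((∫⁻ x in Ioi (0 : ℝ), S.indicator (fun _ => (1 : ENNReal)) x *
          ENNReal.ofReal (Real.exp (-τ * x ^ β))) + 1) + 8 := by
          gcongr
          exact (setLIntegral_le_lintegral _ _).trans hd
      _ = _ := by
          rw [add_assoc]
          norm_num
  have h6 : classicalMeasure β τ S = ENNReal.ofReal G *
      ∫⁻ x in Ioi (0 : ℝ), S.indicator (fun _ => (1 : ENNReal)) x *
        ENNReal.ofReal (Real.exp (-τ * x ^ β)) := by
    rw [← lintegral_indicator_one hS]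
    refine (lintegral_classicalMeasure β τ hind).trans ?_
    congr 1
    simp only [mul_comm]
  have h7 : heatMeasure μ e τ S ≤ ENNReal.ofReal (Real.exp (τ * c)) *
      (classicalMeasure β τ S + ENNReal.ofReal (G * 9)) := by
    rw [h6, ENNReal.ofReal_mul hG0, show ENNReal.ofReal 9 = 9 by norm_num, ← mul_add]
    calc heatMeasure μ e τ S = ∫⁻ x, S.indicator (fun _ => (1 : ENNReal)) x ∂heatMeasure μ e τ :=
          (lintegral_indicator_one hS).symm
      _ ≤ ∫⁻ x, ENNReal.ofReal (η x ^ 2) ∂heatMeasure μ e τ := by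
          refine lintegral_mono fun x => ?_
          by_cases hx : x ∈ S
          · rw [indicator_of_mem hx, ← ENNReal.ofReal_one]
            exact ENNReal.ofReal_le_ofReal (hS1 x hx)
          · rw [indicator_of_notMem hx]
            exact zero_le
      _ ≤ _ := by
          refine (he.lintegral_heatMeasure_le hC hβ hτ hη hηa hM).trans ?_
          rw [show (2 : ℝ) ^ 2 + windowEnergy = c by rw [hc]; norm_num]
          gcongr
  have h8 : Real.exp (τ * c) ≤ 1 + τ * c * Real.exp c := by
    -- `1 - e^{-y} ≤ y` at `y = τ c`
    have h9 := Real.add_one_le_exp (-(τ * c))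
    have h10 : Real.exp (τ * c) ≤ Real.exp c := Real.exp_le_exp.2 (by nlinarith)
    have h11 : Real.exp (τ * c) * Real.exp (-(τ * c)) = 1 := by rw [← Real.exp_add]; simp
    have h12 : 0 ≤ τ * c := by positivity
    have h13 := mul_le_mul_of_nonneg_left h9 (Real.exp_pos (τ * c)).le
    have h14 := mul_le_mul_of_nonneg_left h10 h12
    linarith
  have h9 : classicalMeasure β τ S ≤ ENNReal.ofReal (G * J) := by
    refine (measure_mono (subset_univ S)).trans_eq ?_
    rw [classicalMeasure_univ hβ hτ, ← ENNReal.ofReal_mul hG0]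
  refine h7.trans ?_
  rw [mul_add]
  calc _ ≤ (1 + ENNReal.ofReal (τ * c * Real.exp c)) * classicalMeasure β τ S +
        ENNReal.ofReal (Real.exp c) * ENNReal.ofReal (G * 9) := by
        gcongr
        · rw [← ENNReal.ofReal_one, ← ENNReal.ofReal_add zero_le_one (by positivity)]
          exact ENNReal.ofReal_le_ofReal h8
        · nlinarith
    _ ≤ (classicalMeasure β τ S + ENNReal.ofReal (τ * c * Real.exp c) * ENNReal.ofReal (G * J)) +
        ENNReal.ofReal (Real.exp c) * ENNReal.ofReal (G * 9) := by
        rw [add_mul, one_mul]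
        gcongr
    _ = _ := by
        rw [← ENNReal.ofReal_mul (by positivity), ← ENNReal.ofReal_mul (by positivity), add_assoc,
          ← ENNReal.ofReal_add (by positivity) (by positivity), intervalError]
        congr 2
        ring

end

/-! ### Comparison on initial and final intervals -/

section

variable {C β τ : ℝ} {μ : ℕ → ℝ} {e : HilbertBasis ℕ ℂ L2Half}

/-- The comparison on a set separated from its complement by a point `b`; `ε = 1` if the set lies
to the left of `b`, and `ε = -1` if it lies to the right. -/
theorem IsEigenbasis.heatMeasure_le_of_separated (he : IsEigenbasis C β μ e) (hC : 0 < C)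
    (hβ : 0 < β) (hτ : 0 < τ) (hτ1 : τ ≤ 1) {S : Set ℝ} (hS : MeasurableSet S) {ε b : ℝ}
    (hε : |ε| = 1) (h1 : ∀ x ∈ S, ε * (x - b) ≤ 0) (h2 : ∀ x ∉ S, 0 ≤ ε * (x - b)) :
    heatMeasure μ e τ S ≤ classicalMeasure β τ S + ENNReal.ofReal (intervalError β τ) := by
  have habs : ∀ x, |ε * (x - b)| = |x - b| := fun x => by rw [abs_mul, hε, one_mul]
  refine he.heatMeasure_le_of_majorant hC hβ hτ hτ1 (η := fun x => stepMajorant (ε * (x - b)))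
    (d := fun x => 4 * Real.exp (-|x - b|)) (M := 2)
    (contDiff_stepMajorant.comp (contDiff_const.mul (contDiff_id.sub contDiff_const)))
    (fun x => ?_) (fun x => abs_stepMajorant_le _) hS (fun x hx => ?_) (fun x hx => ?_)
    (fun x hx => ?_) (fun x => by positivity) ?_
  · have h3 : HasDerivAt (fun x => ε * (x - b)) (ε * 1) x :=
      ((hasDerivAt_id x).sub_const b).const_mul ε
    have h4 := (hasDerivAt_stepMajorant (ε * (x - b))).comp x h3
    have h5 := abs_deriv_stepMajorant_le (ε * (x - b))
    rw [(hasDerivAt_stepMajorant _).deriv] at h5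
    have h6 := h4.deriv
    simp only [Function.comp_def] at h6
    rw [h6, abs_mul, mul_one, hε, mul_one]
    exact h5
  · exact one_le_pow₀ (one_le_stepMajorant (h1 x hx))
  · rw [← habs]
    exact stepMajorant_sq_le_of_nonpos (h1 x hx)
  · rw [← habs]
    exact stepMajorant_sq_le_of_nonneg (h2 x hx)
  · rw [lintegral_sub_right_eq_self (fun y => ENNReal.ofReal (4 * Real.exp (-|y|))) b,
      lintegral_exp_neg_abs]

theorem IsEigenbasis.heatMeasure_univ_le (he : IsEigenbasis C β μ e) (hC : 0 < C)
    (hβ : 0 < β) (hτ : 0 < τ) (hτ1 : τ ≤ 1) :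
    heatMeasure μ e τ univ ≤ classicalMeasure β τ univ + ENNReal.ofReal (intervalError β τ) :=
  he.heatMeasure_le_of_majorant hC hβ hτ hτ1 (η := fun _ => 1) (d := fun _ => 0) (M := 1)
    contDiff_const (by simp) (by simp) MeasurableSet.univ (by simp) (by simp) (by simp) (by simp)
    (by simp)

/-- A proper nonempty initial segment of `ℝ` is separated from its complement by a point. -/
theorem exists_separating_point {S : Set ℝ} (hS : IsLowerSet S) (hne : S.Nonempty)
    (huniv : S ≠ univ) : ∃ b, (∀ x ∈ S, x ≤ b) ∧ ∀ x ∉ S, b ≤ x := by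
  obtain ⟨y, hy⟩ := (ne_univ_iff_exists_notMem S).1 huniv
  have hub : ∀ y ∉ S, y ∈ upperBounds S := fun y hy x hx => by
    by_contra hlt
    exact hy (hS (not_le.1 hlt).le hx)
  exact ⟨sSup S, fun x hx => le_csSup ⟨y, hub y hy⟩ hx, fun x hx => csSup_le hne (hub x hx)⟩

theorem IsEigenbasis.heatMeasure_le_of_isLowerSet (he : IsEigenbasis C β μ e) (hC : 0 < C)
    (hβ : 0 < β) (hτ : 0 < τ) (hτ1 : τ ≤ 1) {S : Set ℝ} (hS : IsLowerSet S)
    (hSm : MeasurableSet S) :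
    heatMeasure μ e τ S ≤ classicalMeasure β τ S + ENNReal.ofReal (intervalError β τ) := by
  rcases S.eq_empty_or_nonempty with rfl | hne
  · simp
  by_cases hu : S = univ
  · rw [hu]
    exact he.heatMeasure_univ_le hC hβ hτ hτ1
  obtain ⟨b, h1, h2⟩ := exists_separating_point hS hne hu
  exact he.heatMeasure_le_of_separated hC hβ hτ hτ1 hSm (ε := 1) (b := b) (by simp)
    (fun x hx => by linarith [h1 x hx]) fun x hx => by linarith [h2 x hx]

theorem IsEigenbasis.heatMeasure_le_of_isUpperSet (he : IsEigenbasis C β μ e) (hC : 0 < C)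
    (hβ : 0 < β) (hτ : 0 < τ) (hτ1 : τ ≤ 1) {S : Set ℝ} (hS : IsUpperSet S)
    (hSm : MeasurableSet S) :
    heatMeasure μ e τ S ≤ classicalMeasure β τ S + ENNReal.ofReal (intervalError β τ) := by
  rcases Sᶜ.eq_empty_or_nonempty with h | hne
  · rw [compl_empty_iff.1 h]
    exact he.heatMeasure_univ_le hC hβ hτ hτ1
  by_cases hu : Sᶜ = univ
  · rw [compl_univ_iff.1 hu]
    simp
  obtain ⟨b, h1, h2⟩ := exists_separating_point hS.compl hne hu
  exact he.heatMeasure_le_of_separated hC hβ hτ hτ1 hSm (ε := -1) (b := b) (by simp)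
    (fun x hx => by linarith [h2 x (not_not.2 hx)]) fun x hx => by linarith [h1 x hx]

/-- The error in the lower bound for the full heat trace. -/
def totalError (C β τ : ℝ) : ℝ :=
  1 / √(4 * Real.pi * τ) *
    (2 + τ * (windowEnergy + C) * (τ ^ (-1 / β) * Real.Gamma (1 / β + 1)))

/-- Lower bound for the full heat trace: the classical mass lost on `(0, 2]` is at most `2`, and the
energy shift `windowEnergy + C` costs a relative error `τ (windowEnergy + C)`. -/
theorem IsEigenbasis.classicalMeasure_univ_le (he : IsEigenbasis C β μ e) (hC : 0 < C)
    (hβ : 0 < β) (hτ : 0 < τ) :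
    classicalMeasure β τ univ ≤ heatMeasure μ e τ univ + ENNReal.ofReal (totalError C β τ) := by
  have hκ := windowEnergy_nonneg
  have hJ : 0 ≤ τ ^ (-1 / β) * Real.Gamma (1 / β + 1) :=
    mul_nonneg (by positivity) (Real.Gamma_pos_of_pos (by positivity)).le
  have hJint := lintegral_exp_rpow hβ hτ
  set J := τ ^ (-1 / β) * Real.Gamma (1 / β + 1) with hJdef
  set G := 1 / √(4 * Real.pi * τ) with hG
  have hG0 : 0 ≤ G := by positivity
  have hlow := he.momentumIntegral_le_tsum hC hβ (convexProfile_exp hτ)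
  simp only [momentumIntegral_exp hτ] at hlow
  rw [lintegral_const_mul' _ _ ENNReal.ofReal_ne_top, ← heatMeasure_univ μ e] at hlow
  have hpt : ∀ x : ℝ, ENNReal.ofReal (Real.exp (-τ * x ^ β)) ≤
      ENNReal.ofReal (Real.exp (-τ * (windowEnergy + C + x ^ β))) +
        ENNReal.ofReal (τ * (windowEnergy + C)) * ENNReal.ofReal (Real.exp (-τ * x ^ β)) :=
    fun x => by
      rw [← ENNReal.ofReal_mul (by positivity),
        ← ENNReal.ofReal_add (by positivity) (by positivity)]
      refine ENNReal.ofReal_le_ofReal ?_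
      have h1 : Real.exp (-τ * (windowEnergy + C + x ^ β)) =
          Real.exp (-(τ * (windowEnergy + C))) * Real.exp (-τ * x ^ β) := by
        rw [← Real.exp_add]; congr 1; ring
      have h2 := mul_le_mul_of_nonneg_right (Real.add_one_le_exp (-(τ * (windowEnergy + C))))
        (Real.exp_pos (-τ * x ^ β)).le
      rw [h1]
      linarith
  have hm : Measurable fun x : ℝ =>
      ENNReal.ofReal (Real.exp (-τ * (windowEnergy + C + x ^ β))) := by fun_prop
  have hm' : Measurable fun x : ℝ => ENNReal.ofReal (Real.exp (-τ * x ^ β)) := by fun_prop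
  have h3 : ∫⁻ x in Ioi (0 : ℝ), ENNReal.ofReal (Real.exp (-τ * x ^ β)) ≤
      2 + ((∫⁻ x in Ioi (2 : ℝ), ENNReal.ofReal (Real.exp (-τ * (windowEnergy + C + x ^ β)))) +
        ENNReal.ofReal (τ * (windowEnergy + C)) * ENNReal.ofReal J) := by
    rw [← hJint]
    nth_rw 1 [← Ioc_union_Ioi_eq_Ioi (zero_le_two (α := ℝ))]
    rw [lintegral_union measurableSet_Ioi (Ioc_disjoint_Ioi le_rfl)]
    refine add_le_add ?_ ?_
    · calc _ ≤ ∫⁻ x in Ioc (0 : ℝ) 2, 1 := by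
            refine setLIntegral_mono' measurableSet_Ioc fun x hx => ?_
            rw [← ENNReal.ofReal_one]
            refine ENNReal.ofReal_le_ofReal (Real.exp_le_one_iff.2 ?_)
            have : 0 ≤ x ^ β := Real.rpow_nonneg hx.1.le β
            nlinarith
        _ = 2 := by simp
    · refine (lintegral_mono hpt).trans ?_
      rw [lintegral_add_left hm, lintegral_const_mul _ hm']
      gcongr
      exact zero_le_two
  rw [classicalMeasure_univ hβ hτ, ← hJint]
  calc _ ≤ ENNReal.ofReal G * (2 + ((∫⁻ x in Ioi (2 : ℝ),
        ENNReal.ofReal (Real.exp (-τ * (windowEnergy + C + x ^ β)))) +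
        ENNReal.ofReal (τ * (windowEnergy + C)) * ENNReal.ofReal J)) := mul_le_mul_right h3 _
    _ = ENNReal.ofReal G * (∫⁻ x in Ioi (2 : ℝ),
        ENNReal.ofReal (Real.exp (-τ * (windowEnergy + C + x ^ β)))) + ENNReal.ofReal G * (2 +
        ENNReal.ofReal (τ * (windowEnergy + C)) * ENNReal.ofReal J) := by ring
    _ ≤ _ := by
        refine add_le_add hlow (le_of_eq ?_)
        rw [totalError, ← hJdef, ENNReal.ofReal_mul hG0,
          ENNReal.ofReal_add zero_le_two (by positivity),
          ENNReal.ofReal_mul (p := τ * (windowEnergy + C)) (by positivity), ENNReal.ofReal_ofNat]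

/-! ### The truncated heat trace -/

theorem IsEigenbasis.summable_exp (he : IsEigenbasis C β μ e) (hC : 0 < C) (hβ : 0 < β)
    (hτ : 0 < τ) : Summable fun j => Real.exp (-τ * μ j) := by
  have h := he.tsum_le_momentumIntegral hC hβ (convexProfile_exp hτ)
    (momentumIntegral_exp_ne_top hβ hτ)
  have h1 : Summable fun j => Real.exp (-τ * (μ j + windowEnergy)) := by
    have h2 := ENNReal.summable_toReal (h.trans_lt
      (momentumIntegral_exp_ne_top hβ hτ).lt_top).ne
    refine h2.congr fun j => ?_
    rw [ENNReal.toReal_ofReal (Real.exp_pos _).le]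
  refine (h1.mul_left (Real.exp (τ * windowEnergy))).congr fun j => ?_
  rw [← Real.exp_add]
  congr 1
  ring

/-- A cut-off function, extended to the whole line by the value `1`. -/
def Cutoff.extend (χ : Cutoff) (x : ℝ) : ℝ := χ.toFun (max x 0)

theorem Cutoff.extend_of_pos (χ : Cutoff) {x : ℝ} (hx : 0 < x) : χ.extend x = χ.toFun x := by
  rw [extend, max_eq_left hx.le]

theorem Cutoff.extend_nonneg (χ : Cutoff) (x : ℝ) : 0 ≤ χ.extend x :=
  (χ.mem_Icc _ (le_max_right x 0)).1

theorem Cutoff.extend_le_one (χ : Cutoff) (x : ℝ) : χ.extend x ≤ 1 :=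
  (χ.mem_Icc _ (le_max_right x 0)).2

theorem Cutoff.antitone_extend (χ : Cutoff) : Antitone χ.extend := fun x y h =>
  χ.antitone (le_max_right x 0) (le_max_right y 0) (max_le_max h le_rfl)

/-- The truncated heat trace, as the integral of the cut-off function against the diagonal of the
heat kernel. -/
def truncatedTrace (μ : ℕ → ℝ) (e : HilbertBasis ℕ ℂ L2Half) (χ : Cutoff) (τ : ℝ) : ℝ :=
  ∑' j, Real.exp (-τ * μ j) * ∫ x in Ioi (0 : ℝ), ‖e j x‖ ^ 2 * χ.extend x

theorem Cutoff.abs_extend_le (χ : Cutoff) (x : ℝ) : |χ.extend x| ≤ 1 := by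
  rw [abs_of_nonneg (χ.extend_nonneg x)]
  exact χ.extend_le_one x

theorem Cutoff.integral_extend_nonneg (χ : Cutoff) (u : L2Half) :
    0 ≤ ∫ x in Ioi (0 : ℝ), ‖u x‖ ^ 2 * χ.extend x :=
  integral_nonneg fun x => mul_nonneg (sq_nonneg _) (χ.extend_nonneg x)

theorem Cutoff.integral_extend_le (χ : Cutoff) (u : L2Half) :
    ∫ x in Ioi (0 : ℝ), ‖u x‖ ^ 2 * χ.extend x ≤ ‖u‖ ^ 2 := by
  rw [norm_sq_eq_integral]
  refine integral_mono_of_nonneg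
    (Eventually.of_forall fun x => mul_nonneg (sq_nonneg _) (χ.extend_nonneg x))
    (integrable_norm_sq u)
    (Eventually.of_forall fun x => mul_le_of_le_one_right (sq_nonneg _) (χ.extend_le_one x))

theorem IsEigenbasis.hasSum_truncatedTrace (he : IsEigenbasis C β μ e) (hC : 0 < C) (hβ : 0 < β)
    (hτ : 0 < τ) (χ : Cutoff) :
    HasSum (fun j => Real.exp (-τ * μ j) * ∫ x in Ioi (0 : ℝ), ‖e j x‖ ^ 2 * χ.extend x)
      (truncatedTrace μ e χ τ) := by
  refine Summable.hasSum (Summable.of_nonneg_of_le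
    (fun j => mul_nonneg (Real.exp_pos _).le (χ.integral_extend_nonneg _))
    (fun j => mul_le_of_le_one_right (Real.exp_pos _).le ?_) (he.summable_exp hC hβ hτ))
  refine (χ.integral_extend_le _).trans_eq ?_
  rw [e.orthonormal.1 j, one_pow]

theorem IsEigenbasis.lintegral_heatMeasure_extend (he : IsEigenbasis C β μ e) (hC : 0 < C)
    (hβ : 0 < β) (hτ : 0 < τ) (χ : Cutoff) :
    ∫⁻ x, ENNReal.ofReal (χ.extend x) ∂heatMeasure μ e τ =
      ENNReal.ofReal (truncatedTrace μ e χ τ) := by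
  have hs := he.hasSum_truncatedTrace hC hβ hτ χ
  have hm := χ.antitone_extend.measurable
  rw [lintegral_heatMeasure μ e τ hm.ennreal_ofReal, ← hs.tsum_eq,
    ENNReal.ofReal_tsum_of_nonneg
      (fun j => mul_nonneg (Real.exp_pos _).le (χ.integral_extend_nonneg _)) hs.summable]
  refine tsum_congr fun j => ?_
  rw [lintegral_norm_sq_mul hm χ.abs_extend_le χ.extend_nonneg,
    ENNReal.ofReal_mul (Real.exp_pos _).le]

theorem lintegral_classicalMeasure_extend (hβ : 0 < β) (hτ : 0 < τ) (χ : Cutoff) :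
    ∫⁻ x, ENNReal.ofReal (χ.extend x) ∂classicalMeasure β τ =
      ENNReal.ofReal (1 / √(4 * Real.pi * τ) *
        ∫ x in Ioi (0 : ℝ), Real.exp (-τ * x ^ β) * χ.toFun x) := by
  have hm := χ.antitone_extend.measurable
  have h1 : ∫ x in Ioi (0 : ℝ), Real.exp (-τ * x ^ β) * χ.toFun x =
      ∫ x in Ioi (0 : ℝ), Real.exp (-τ * x ^ β) * χ.extend x :=
    setIntegral_congr_fun measurableSet_Ioi fun x hx => by rw [χ.extend_of_pos hx]
  have h2 := integrableOn_rpow_mul_exp_neg_mul_rpow (s := 0) (by norm_num) hβ hτ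
  simp only [Real.rpow_zero, one_mul] at h2
  rw [lintegral_classicalMeasure β τ hm.ennreal_ofReal, h1, ENNReal.ofReal_mul (by positivity),
    ofReal_integral_eq_lintegral_ofReal]
  · simp only [ENNReal.ofReal_mul (Real.exp_pos _).le]
  · exact h2.mul_bdd (c := 1) hm.aestronglyMeasurable (Eventually.of_forall χ.abs_extend_le)
  · exact Eventually.of_forall fun x => mul_nonneg (Real.exp_pos _).le (χ.extend_nonneg x)

/-- Comparison of the truncated heat trace with its classical value, for a fixed small time. -/
theorem IsEigenbasis.abs_truncatedTrace_sub_le (he : IsEigenbasis C β μ e) (hC : 0 < C)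
    (hβ : 0 < β) (hτ : 0 < τ) (hτ1 : τ ≤ 1) (χ : Cutoff) :
    |truncatedTrace μ e χ τ - 1 / √(4 * Real.pi * τ) *
      ∫ x in Ioi (0 : ℝ), Real.exp (-τ * x ^ β) * χ.toFun x| ≤
        intervalError β τ + totalError C β τ := by
  have hκ := windowEnergy_nonneg
  have hΓ : 0 ≤ Real.Gamma (1 / β + 1) := (Real.Gamma_pos_of_pos (by positivity)).le
  have hR1 : 0 ≤ intervalError β τ := by
    unfold intervalError
    positivity
  have hR2 : 0 ≤ totalError C β τ := by
    unfold totalError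
    positivity
  have hZ : 0 ≤ truncatedTrace μ e χ τ :=
    tsum_nonneg fun j => mul_nonneg (Real.exp_pos _).le (χ.integral_extend_nonneg _)
  have hW : 0 ≤ 1 / √(4 * Real.pi * τ) *
      ∫ x in Ioi (0 : ℝ), Real.exp (-τ * x ^ β) * χ.toFun x :=
    mul_nonneg (by positivity) (setIntegral_nonneg measurableSet_Ioi fun x hx =>
      mul_nonneg (Real.exp_pos _).le (χ.mem_Icc x (Ioi_subset_Ici_self hx)).1)
  have hfin : classicalMeasure β τ univ ≠ ⊤ := by
    rw [classicalMeasure_univ hβ hτ]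
    exact ENNReal.mul_ne_top ENNReal.ofReal_ne_top ENNReal.ofReal_ne_top
  obtain ⟨h1, h2⟩ := lintegral_antitone_comparison (ν := heatMeasure μ e τ) hfin χ.antitone_extend
    χ.extend_nonneg χ.extend_le_one
    (fun S => he.heatMeasure_le_of_isLowerSet hC hβ hτ hτ1)
    (fun S => he.heatMeasure_le_of_isUpperSet hC hβ hτ hτ1)
    (he.classicalMeasure_univ_le hC hβ hτ)
  rw [he.lintegral_heatMeasure_extend hC hβ hτ, lintegral_classicalMeasure_extend hβ hτ] at h1 h2
  rw [← ENNReal.ofReal_add hW hR1, ENNReal.ofReal_le_ofReal_iff (by positivity)] at h1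
  rw [← ENNReal.ofReal_add hR1 hR2, ← ENNReal.ofReal_add hZ (by positivity),
    ENNReal.ofReal_le_ofReal_iff (by positivity)] at h2
  rw [abs_le]
  constructor <;> linarith

/-- Both errors are combinations of `τ^{-1/2}` and `τ^{1/2 - 1/β}`. For `τ ≤ 1` the former is at
most `τ^{-γ}` as `γ ≥ 1/2`, and so is the latter as `γ ≥ 1/β`. -/
theorem intervalError_add_totalError_le (hC : 0 < C) (hβ : 0 < β) (hτ : 0 < τ) (hτ1 : τ ≤ 1) :
    intervalError β τ + totalError C β τ ≤
      (2 + 9 * Real.exp (4 + windowEnergy) + (windowEnergy + C + (4 + windowEnergy) *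
        Real.exp (4 + windowEnergy)) * Real.Gamma (1 / β + 1)) *
          τ ^ (-max (1 / β) (1 / 2)) := by
  have hκ := windowEnergy_nonneg
  have hΓ : 0 ≤ Real.Gamma (1 / β + 1) := (Real.Gamma_pos_of_pos (by positivity)).le
  set Γ := Real.Gamma (1 / β + 1)
  set c := 4 + windowEnergy
  have hG : 1 / √(4 * Real.pi * τ) ≤ τ ^ (-(1 / 2) : ℝ) := by
    rw [Real.rpow_neg hτ.le, ← Real.sqrt_eq_rpow, one_div]
    refine inv_anti₀ (Real.sqrt_pos.2 hτ) (Real.sqrt_le_sqrt ?_)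
    nlinarith [Real.pi_gt_three]
  have h1 : 1 / √(4 * Real.pi * τ) ≤ τ ^ (-max (1 / β) (1 / 2)) :=
    hG.trans (Real.rpow_le_rpow_of_exponent_ge hτ hτ1 (neg_le_neg (le_max_right _ _)))
  have h2 : 1 / √(4 * Real.pi * τ) * (τ * τ ^ (-1 / β)) ≤ τ ^ (-max (1 / β) (1 / 2)) := by
    calc _ ≤ τ ^ (-(1 / 2) : ℝ) * (τ * τ ^ (-1 / β)) := by gcongr
      _ = τ ^ (1 / 2 - 1 / β) := by
          nth_rw 2 [← Real.rpow_one τ]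
          rw [← Real.rpow_add hτ, ← Real.rpow_add hτ]
          congr 1
          ring
      _ ≤ _ := by
          refine Real.rpow_le_rpow_of_exponent_ge hτ hτ1 ?_
          have := le_max_left (1 / β) (1 / 2)
          linarith
  have h3 : intervalError β τ + totalError C β τ =
      (2 + 9 * Real.exp c) * (1 / √(4 * Real.pi * τ)) + (windowEnergy + C + c * Real.exp c) * Γ *
        (1 / √(4 * Real.pi * τ) * (τ * τ ^ (-1 / β))) := by
    unfold intervalError totalError
    ring
  rw [h3]
  exact (add_le_add (mul_le_mul_of_nonneg_left h1 (by positivity))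
    (mul_le_mul_of_nonneg_left h2 (by positivity))).trans_eq (by ring)

theorem IsEigenbasis.heatOperator_apply (he : IsEigenbasis C β μ e) (hC : 0 < C) (hβ : 0 < β)
    (hτ : 0 < τ) (j : ℕ) :
    heatOperator (schrodinger C β) τ (e j) = (Real.exp (-τ * μ j) : ℂ) • e j :=
  heatOperator_apply_eigenvector (isInvOneAdd_resolvent hC hβ) (isSelfAdjoint_resolvent C β)
    (he.pos j) (he.resolvent_apply j) hτ

theorem inner_cutoff (χ : Cutoff) (u : L2Half) :
    ⟪χ.mulOperator u, u⟫_ℂ = ((∫ x in Ioi (0 : ℝ), ‖u x‖ ^ 2 * χ.extend x : ℝ) : ℂ) := by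
  rw [L2.inner_def, ← integral_complex_ofReal]
  refine integral_congr_ae ?_
  filter_upwards [coeFn_mulBdd χ.memLp_top u, ae_restrict_mem measurableSet_Ioi] with x h1 hx
  have h2 : χ.mulOperator u x = χ.toFun x * u x := h1
  rw [h2, χ.extend_of_pos hx, RCLike.inner_apply, map_mul, Complex.conj_ofReal, mul_left_comm,
    Complex.mul_conj, Complex.normSq_eq_norm_sq]
  push_cast
  ring

/-- The trace of `e^{-τP} χ`, computed from the expansion `∑ⱼ e^{-τμⱼ} ⟪χ eⱼ, ·⟫ eⱼ`. -/
theorem IsEigenbasis.hasTrace_truncatedHeat (he : IsEigenbasis C β μ e) (hC : 0 < C) (hβ : 0 < β)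
    (hτ : 0 < τ) (χ : Cutoff) :
    HasTrace (truncatedHeat C β χ τ) (truncatedTrace μ e χ τ : ℂ) := by
  have hsum := he.summable_exp hC hβ hτ
  refine hasTrace_of_hasSum
    (x := fun j => (Real.exp (-τ * μ j) : ℂ) • χ.mulOperator (e j)) (y := fun j => e j) ?_ ?_ ?_
  · refine Summable.of_nonneg_of_le (fun j => by positivity) (fun j => ?_)
      (hsum.mul_right ‖χ.mulOperator‖)
    rw [e.orthonormal.1 j, mul_one, norm_smul, Complex.norm_real, Real.norm_of_nonneg
      (Real.exp_pos _).le]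
    refine mul_le_mul_of_nonneg_left ?_ (Real.exp_pos _).le
    simpa [e.orthonormal.1 j] using χ.mulOperator.le_opNorm (e j)
  · intro u
    change HasSum _ (heatOperator (schrodinger C β) τ (χ.mulOperator u))
    have h1 := (e.hasSum_repr (χ.mulOperator u)).mapL (heatOperator (schrodinger C β) τ)
    convert h1 using 1
    ext1 j
    have h2 : ⟪e j, χ.mulOperator u⟫_ℂ = ⟪χ.mulOperator (e j), u⟫_ℂ :=
      inner_mulBdd χ.memLp_top (e j) u
    rw [map_smul, he.heatOperator_apply hC hβ hτ, e.repr_apply_apply, h2, inner_smul_left,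
      Complex.conj_ofReal, smul_smul, mul_comm]
  · have h := (Complex.hasSum_ofReal.2 (he.hasSum_truncatedTrace hC hβ hτ χ))
    convert h using 1
    ext1 j
    rw [inner_smul_left, Complex.conj_ofReal, inner_cutoff, ← Complex.ofReal_mul]

/-- Exponential decay for large times. -/
theorem IsEigenbasis.abs_truncatedTrace_le (he : IsEigenbasis C β μ e) (hC : 0 < C) (hβ : 0 < β)
    (hmono : Monotone μ) (hτ : 1 ≤ τ) (χ : Cutoff) :
    |truncatedTrace μ e χ τ| ≤
      (Real.exp (μ 0) * ∑' j, Real.exp (-1 * μ j)) * Real.exp (-μ 0 * τ) := by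
  have hτ0 : 0 < τ := by linarith
  have h1 := he.hasSum_truncatedTrace hC hβ hτ0 χ
  have hZ : 0 ≤ truncatedTrace μ e χ τ :=
    tsum_nonneg fun j => mul_nonneg (Real.exp_pos _).le (χ.integral_extend_nonneg _)
  have h2 := (he.summable_exp hC hβ one_pos).hasSum.mul_left (Real.exp (-μ 0 * (τ - 1)))
  rw [abs_of_nonneg hZ]
  refine (hasSum_le (fun j => ?_) h1 h2).trans_eq ?_
  · refine (mul_le_of_le_one_right (Real.exp_pos _).le ((χ.integral_extend_le _).trans_eq ?_)).trans
      ?_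
    · rw [e.orthonormal.1 j, one_pow]
    · rw [← Real.exp_add]
      refine Real.exp_le_exp.2 ?_
      have := hmono (Nat.zero_le j)
      nlinarith
  · have : Real.exp (-μ 0 * (τ - 1)) = Real.exp (μ 0) * Real.exp (-μ 0 * τ) := by
      rw [← Real.exp_add]; congr 1; ring
    rw [this]
    ring

end

/-! ### A Tauberian lemma for first difference quotients -/

/-- If `N` is squeezed between the difference quotients of `R`, and `R x ~ a x ^ (p + 1)`, then
`N x ~ (p + 1) a x ^ p`. -/
theorem tendsto_div_rpow_of_difference_quotients {N R : ℝ → ℝ} {a p : ℝ}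
    (hR : Tendsto (fun x => R x / x ^ (p + 1)) atTop (𝓝 a))
    (hup : ∀ x h, 0 < h → h * N x ≤ R (x + h) - R x)
    (hlo : ∀ x h, 0 < h → R x - R (x - h) ≤ h * N x) :
    Tendsto (fun x => N x / x ^ p) atTop (𝓝 (a * (p + 1))) := by
  have hder : Tendsto (fun t : ℝ => t⁻¹ * (a * (1 + t) ^ (p + 1) - a)) (𝓝[≠] 0)
      (𝓝 (a * (p + 1))) := by
    have h1 : HasDerivAt (fun x : ℝ => a * x ^ (p + 1)) (a * (p + 1)) 1 := by
      simpa using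
        (Real.hasDerivAt_rpow_const (x := 1) (p := p + 1) (Or.inl one_ne_zero)).const_mul a
    simpa using hasDerivAt_iff_tendsto_slope_zero.1 h1
  -- the difference quotient of `R` with step `t x`
  have hquot : ∀ t : ℝ, -1 < t → Tendsto (fun x => t⁻¹ * (R (x + t * x) - R x) / x ^ (p + 1)) atTop
      (𝓝 (t⁻¹ * (a * (1 + t) ^ (p + 1) - a))) := fun t ht => by
    have ht1 : 0 < 1 + t := by linarith
    have h1 : Tendsto (fun x => (1 + t) * x) atTop atTop :=
      tendsto_id.const_mul_atTop ht1
    have h2 := (((hR.comp h1).mul_const ((1 + t) ^ (p + 1))).sub hR).const_mul t⁻¹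
    refine h2.congr' ?_
    filter_upwards [eventually_gt_atTop 0] with x hx
    have h3 : (1 + t) * x = x + t * x := by ring
    have h4 : 0 < (1 + t) ^ (p + 1) := Real.rpow_pos_of_pos ht1 _
    have h5 : 0 < x ^ (p + 1) := Real.rpow_pos_of_pos hx _
    simp only [Function.comp_apply]
    rw [Real.mul_rpow ht1.le hx.le, h3]
    field_simp
  have hpow : ∀ x : ℝ, 0 < x → x ^ (p + 1) = x ^ p * x := fun x hx => by
    rw [Real.rpow_add hx, Real.rpow_one]
  refine tendsto_order.2 ⟨fun c hc => ?_, fun c hc => ?_⟩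
  · have h1 := (hder.mono_left (nhdsWithin_mono 0 fun t (ht : t ∈ Iio (0 : ℝ)) =>
      ne_of_lt ht)).eventually (eventually_gt_nhds hc)
    obtain ⟨t, ⟨ht1, ht2⟩, ht0⟩ := ((h1.and (eventually_nhdsWithin_of_eventually_nhds
      (eventually_gt_nhds (by norm_num : (-1 : ℝ) < 0)))).and self_mem_nhdsWithin).exists
    have ht0' : t < 0 := ht0
    filter_upwards [(hquot t ht2).eventually (eventually_gt_nhds ht1), eventually_gt_atTop 0]
      with x hx hx0
    refine hx.trans_le ?_
    have h2 := hlo x (-t * x) (by nlinarith)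
    rw [show x - -t * x = x + t * x by ring] at h2
    rw [hpow x hx0, div_le_div_iff₀ (by positivity) (by positivity)]
    have h3 : t⁻¹ * (R (x + t * x) - R x) ≤ x * N x := by
      rw [inv_mul_eq_div, div_le_iff_of_neg ht0']
      linarith
    nlinarith [Real.rpow_pos_of_pos hx0 p]
  · have h1 := (hder.mono_left (nhdsWithin_mono 0 fun t (ht : t ∈ Ioi (0 : ℝ)) =>
      ne_of_gt ht)).eventually (eventually_lt_nhds hc)
    obtain ⟨t, ht1, ht0⟩ := (h1.and self_mem_nhdsWithin).exists
    have ht0' : 0 < t := ht0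
    filter_upwards [(hquot t (by linarith)).eventually (eventually_lt_nhds ht1),
      eventually_gt_atTop 0] with x hx hx0
    refine lt_of_le_of_lt ?_ hx
    have h2 := hup x (t * x) (by positivity)
    rw [hpow x hx0, div_le_div_iff₀ (by positivity) (by positivity)]
    have h3 : x * N x ≤ t⁻¹ * (R (x + t * x) - R x) := by
      rw [le_inv_mul_iff₀ ht0']
      linarith
    nlinarith [Real.rpow_pos_of_pos hx0 p]

theorem tendsto_shift_rpow_div (c p : ℝ) :
    Tendsto (fun x : ℝ => (x + c) ^ p / x ^ p) atTop (𝓝 1) := by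
  have h1 : Tendsto (fun x : ℝ => 1 + c / x) atTop (𝓝 1) := by
    simpa using (tendsto_const_nhds (x := (1 : ℝ))).add (tendsto_id.const_div_atTop c)
  have h2 := h1.rpow_const (p := p) (Or.inl one_ne_zero)
  rw [Real.one_rpow] at h2
  refine h2.congr' ?_
  filter_upwards [eventually_gt_atTop 0, eventually_gt_atTop (-c)] with x hx hxc
  rw [← Real.div_rpow (by linarith) hx.le, add_div, div_self hx.ne']

theorem tendsto_shift_rpow_div_of_lt (c : ℝ) {p q : ℝ} (hpq : p < q) :
    Tendsto (fun x : ℝ => (x + c) ^ p / x ^ q) atTop (𝓝 0) := by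
  have h := (tendsto_shift_rpow_div c p).mul (tendsto_rpow_neg_atTop (sub_pos.2 hpq))
  rw [mul_zero] at h
  refine h.congr' ?_
  filter_upwards [eventually_gt_atTop 0] with x hx
  rw [neg_sub, Real.rpow_sub hx]
  have := Real.rpow_pos_of_pos hx p
  field_simp

/-! ### The classical Riesz means -/

/-- The integral of `(Λ - E - (2πξ)²)₊`: a quadratic polynomial, integrated between its roots. -/
theorem momentumIntegral_riesz {Λ E : ℝ} :
    momentumIntegral (fun x => max (Λ - x) 0) E =
      ENNReal.ofReal (2 / (3 * Real.pi)) * ENNReal.ofReal (max (Λ - E) 0 ^ (3 / 2 : ℝ)) := by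
  have hpi := Real.pi_pos
  unfold momentumIntegral
  rcases le_or_gt (Λ - E) 0 with hD | hD
  · rw [max_eq_right hD, Real.zero_rpow (by norm_num), ENNReal.ofReal_zero, mul_zero]
    refine (lintegral_congr fun ξ => ?_).trans lintegral_zero
    beta_reduce
    rw [max_eq_right (by nlinarith [sq_nonneg (2 * Real.pi * ξ)]), ENNReal.ofReal_zero]
  rw [max_eq_left hD.le]
  set D := Λ - E with hDdef
  set r := √D / (2 * Real.pi) with hr
  have hr0 : 0 < r := by positivity
  have hrD : (2 * Real.pi * r) ^ 2 = D := by
    rw [hr, mul_div_cancel₀ _ (by positivity), Real.sq_sqrt hD.le]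
  have hf : ∀ ξ, max (Λ - ((2 * Real.pi * ξ) ^ 2 + E)) 0 =
      (Icc (-r) r).indicator (fun ξ => D - (2 * Real.pi) ^ 2 * ξ ^ 2) ξ := fun ξ => by
    by_cases hξ : ξ ∈ Icc (-r) r
    · rw [indicator_of_mem hξ, max_eq_left]
      · rw [hDdef]; ring
      · have h1 : ξ ^ 2 ≤ r ^ 2 := sq_le_sq.2 (by rw [abs_of_pos hr0]; exact abs_le.2 hξ)
        have h2 := mul_le_mul_of_nonneg_left h1 (sq_nonneg (2 * Real.pi))
        nlinarith
    · rw [indicator_of_notMem hξ, max_eq_right]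
      have h1 : r ^ 2 ≤ ξ ^ 2 := sq_le_sq.2 (by
        rw [abs_of_pos hr0]
        by_contra hlt
        exact hξ (abs_le.1 (not_le.1 hlt).le))
      have h2 := mul_le_mul_of_nonneg_left h1 (sq_nonneg (2 * Real.pi))
      nlinarith
  have hcont : Continuous fun ξ : ℝ => D - (2 * Real.pi) ^ 2 * ξ ^ 2 := by fun_prop
  simp only [hf]
  rw [← ofReal_integral_eq_lintegral_ofReal, ← ENNReal.ofReal_mul (by positivity),
    integral_indicator measurableSet_Icc, integral_Icc_eq_integral_Ioc,
    ← intervalIntegral.integral_of_le (by linarith)]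
  · congr 1
    rw [intervalIntegral.integral_sub (by simp)
      (Continuous.intervalIntegrable (by fun_prop) _ _), intervalIntegral.integral_const_mul,
      integral_pow, intervalIntegral.integral_const]
    have h3 : D ^ (3 / 2 : ℝ) = D * √D := by
      rw [Real.sqrt_eq_rpow, ← Real.rpow_one_add' hD.le (by norm_num)]
      norm_num
    have h4 : √D = 2 * Real.pi * r := by
      rw [hr]; field_simp
    rw [h3, h4, ← hrD]
    simp only [smul_eq_mul]
    push_cast
    field_simp
    ring
  · exact (hcont.integrableOn_Icc).integrable_indicator measurableSet_Icc
  · exact Eventually.of_forall fun ξ => by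
      simp only [Pi.zero_apply]
      rw [← hf]
      exact le_max_right _ _

section

/-- The integral `∫₀^∞ (Λ - x ^ β)₊^{3/2} dx` at `Λ = 1`. -/
def rieszConstant (β : ℝ) : ℝ := ∫ x in Ioi (0 : ℝ), max (1 - x ^ β) 0 ^ (3 / 2 : ℝ)

theorem integrableOn_riesz {β : ℝ} (hβ : 0 < β) {Λ : ℝ} (hΛ : 0 ≤ Λ) :
    IntegrableOn (fun x : ℝ => max (Λ - x ^ β) 0 ^ (3 / 2 : ℝ)) (Ioi 0) := by
  set r := Λ ^ (1 / β)
  have hr : 0 ≤ r := by positivity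
  have hc : Continuous fun x : ℝ => max (Λ - x ^ β) 0 ^ (3 / 2 : ℝ) := by
    refine Continuous.rpow_const ?_ fun _ => Or.inr (by norm_num)
    exact (continuous_const.sub (Real.continuous_rpow_const hβ.le)).max continuous_const
  rw [← Ioc_union_Ioi_eq_Ioi hr]
  refine IntegrableOn.union ?_ ?_
  · exact hc.integrableOn_Icc.mono_set Ioc_subset_Icc_self
  · refine integrableOn_zero.congr_fun (fun x hx => ?_) measurableSet_Ioi
    have hx' : r < x := hx
    have h1 : r ^ β ≤ x ^ β := Real.rpow_le_rpow hr hx'.le hβ.le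
    rw [← Real.rpow_mul hΛ, one_div_mul_cancel hβ.ne', Real.rpow_one] at h1
    rw [max_eq_right (by linarith), Real.zero_rpow (by norm_num)]

/-- Homogeneity of the classical Riesz mean: the substitution `x = Λ^{1/β} y`. -/
theorem integral_riesz {β : ℝ} (hβ : 0 < β) {Λ : ℝ} (hΛ : 0 < Λ) :
    ∫ x in Ioi (0 : ℝ), max (Λ - x ^ β) 0 ^ (3 / 2 : ℝ) =
      rieszConstant β * Λ ^ (1 / 2 + 1 / β + 1) := by
  have hb : 0 < Λ ^ (1 / β) := by positivity
  have h1 := integral_comp_mul_left_Ioi' (fun x : ℝ => max (Λ - x ^ β) 0 ^ (3 / 2 : ℝ)) 0 hb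
  rw [mul_zero] at h1
  rw [← h1, smul_eq_mul, setIntegral_congr_fun (g := fun x : ℝ =>
    Λ ^ (3 / 2 : ℝ) * max (1 - x ^ β) 0 ^ (3 / 2 : ℝ)) measurableSet_Ioi fun x hx => ?_,
    integral_const_mul, ← mul_assoc, ← Real.rpow_add hΛ, mul_comm, rieszConstant]
  · congr 2
    ring
  · have hx0 : (0 : ℝ) ≤ x := le_of_lt hx
    beta_reduce
    rw [Real.mul_rpow hb.le hx0, ← Real.rpow_mul hΛ.le, one_div_mul_cancel hβ.ne', Real.rpow_one,
      ← Real.mul_rpow hΛ.le (le_max_right _ _), mul_max_of_nonneg _ _ hΛ.le, mul_zero, mul_sub,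
      mul_one]

theorem lintegral_riesz {β : ℝ} (hβ : 0 < β) {Λ : ℝ} (hΛ : 0 < Λ) :
    ∫⁻ x in Ioi (0 : ℝ), ENNReal.ofReal (max (Λ - x ^ β) 0 ^ (3 / 2 : ℝ)) =
      ENNReal.ofReal (rieszConstant β * Λ ^ (1 / 2 + 1 / β + 1)) := by
  rw [← integral_riesz hβ hΛ, ofReal_integral_eq_lintegral_ofReal (integrableOn_riesz hβ hΛ.le)]
  exact Eventually.of_forall fun x => Real.rpow_nonneg (le_max_right _ _) _

theorem rieszConstant_nonneg (β : ℝ) : 0 ≤ rieszConstant β :=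
  integral_nonneg fun _ => Real.rpow_nonneg (le_max_right _ _) _

/-- The substitution `y = x ^ β` turns the constant into a Beta integral. -/
theorem rieszConstant_eq {β : ℝ} (hβ : 0 < β) :
    rieszConstant β = 1 / β * ProbabilityTheory.beta (1 / β) (5 / 2) := by
  have hβ' : 0 < 1 / β := by positivity
  have h1 := integral_comp_rpow_Ioi_of_pos
    (g := fun y : ℝ => 1 / β * (y ^ (1 / β - 1) * max (1 - y) 0 ^ (3 / 2 : ℝ))) hβ
  have h2 : rieszConstant β =
      ∫ y in Ioi (0 : ℝ), 1 / β * (y ^ (1 / β - 1) * max (1 - y) 0 ^ (3 / 2 : ℝ)) := by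
    rw [← h1, rieszConstant]
    refine setIntegral_congr_fun measurableSet_Ioi fun x hx => ?_
    have hx0 : (0 : ℝ) < x := hx
    have h3 : x ^ (β - 1) * (x ^ β) ^ (1 / β - 1) = 1 := by
      rw [← Real.rpow_mul hx0.le, ← Real.rpow_add hx0]
      have : β - 1 + β * (1 / β - 1) = 0 := by
        field_simp
        ring
      rw [this, Real.rpow_zero]
    simp only [smul_eq_mul]
    calc _ = (x ^ (β - 1) * (x ^ β) ^ (1 / β - 1)) * max (1 - x ^ β) 0 ^ (3 / 2 : ℝ) := by
          rw [h3, one_mul]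
      _ = _ := by field_simp
  rw [h2, integral_const_mul, ProbabilityTheory.beta_eq_betaIntegralReal _ _ hβ' (by norm_num)]
  congr 1
  have h4 : ∫ y in Ioi (0 : ℝ), y ^ (1 / β - 1) * max (1 - y) 0 ^ (3 / 2 : ℝ) =
      ∫ y in Ioc (0 : ℝ) 1, y ^ (1 / β - 1) * (1 - y) ^ (3 / 2 : ℝ) := by
    rw [setIntegral_eq_of_subset_of_forall_sdiff_eq_zero measurableSet_Ioi
      (Ioc_subset_Ioi_self : Ioc (0 : ℝ) 1 ⊆ Ioi 0) fun y hy => ?_]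
    · refine setIntegral_congr_fun measurableSet_Ioc fun y hy => ?_
      have := hy.2
      rw [max_eq_left (by linarith)]
    · have : 1 < y := by
        by_contra hle
        exact hy.2 ⟨hy.1, not_lt.1 hle⟩
      rw [max_eq_right (by linarith), Real.zero_rpow (by norm_num), mul_zero]
  rw [h4, Complex.betaIntegral, intervalIntegral.integral_of_le zero_le_one,
    ← Complex.ofReal_re (∫ y in Ioc (0 : ℝ) 1, y ^ (1 / β - 1) * (1 - y) ^ (3 / 2 : ℝ)),
    ← integral_complex_ofReal]
  congr 1
  refine setIntegral_congr_fun measurableSet_Ioc fun y hy => ?_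
  have := hy.2
  rw [Complex.ofReal_mul, Complex.ofReal_cpow hy.1.le, Complex.ofReal_cpow (by linarith)]
  push_cast
  norm_num

/-- The functional equations of the Gamma function turn the constant of the Riesz means, times the
exponent from the Tauberian lemma, into the Weyl constant. -/
theorem rieszConstant_mul {β : ℝ} (hβ : 0 < β) :
    2 / (3 * Real.pi) * rieszConstant β * (1 / 2 + 1 / β + 1) =
      1 / (Real.pi * β) * ProbabilityTheory.beta (3 / 2) (1 / β) := by
  have hpi := Real.pi_pos
  have h0 : (3 / 2 + 1 / β : ℝ) ≠ 0 := by positivity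
  have hG := Real.Gamma_pos_of_pos (s := 3 / 2 + 1 / β) (by positivity)
  rw [rieszConstant_eq hβ, ProbabilityTheory.beta, ProbabilityTheory.beta,
    show (5 / 2 : ℝ) = 3 / 2 + 1 by norm_num, Real.Gamma_add_one (by norm_num),
    show 1 / β + (3 / 2 + 1) = (3 / 2 + 1 / β) + 1 by ring, Real.Gamma_add_one h0]
  field_simp
  ring

/-! ### Riesz means and the Weyl law -/

/-- The Riesz mean `∑ⱼ (Λ - μⱼ)₊`. -/
def rieszMean (μ : ℕ → ℝ) (Λ : ℝ) : ℝ := ∑' j, max (Λ - μ j) 0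

section Counting

variable {μ : ℕ → ℝ}

theorem finite_setOf_le (hlim : Tendsto μ atTop atTop) (Λ : ℝ) : {j | μ j ≤ Λ}.Finite := by
  have h := hlim.eventually_gt_atTop Λ
  rw [← Nat.cofinite_eq_atTop] at h
  refine h.subset fun j hj => ?_
  exact not_lt.2 (show μ j ≤ Λ from hj)

theorem hasSum_rieszMean (hlim : Tendsto μ atTop atTop) (Λ : ℝ) :
    HasSum (fun j => max (Λ - μ j) 0) (rieszMean μ Λ) := by
  have hfin := finite_setOf_le hlim Λ
  refine (summable_of_ne_finset_zero (s := hfin.toFinset) fun j hj => ?_).hasSum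
  have hlt : Λ < μ j := not_le.1 fun hle => hj (hfin.mem_toFinset.2 hle)
  exact max_eq_right (by linarith)

open Classical in
theorem hasSum_countingFunction (hlim : Tendsto μ atTop atTop) (Λ : ℝ) :
    HasSum (fun j => if μ j ≤ Λ then (1 : ℝ) else 0) (countingFunction μ Λ) := by
  have hfin := finite_setOf_le hlim Λ
  have h : HasSum (fun j => if μ j ≤ Λ then (1 : ℝ) else 0) (∑ j ∈ hfin.toFinset, _) :=
    hasSum_sum_of_ne_finset_zero fun j hj => if_neg fun hle => hj (hfin.mem_toFinset.2 hle)
  convert h using 1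
  rw [Finset.sum_congr rfl fun j hj => if_pos (show μ j ≤ Λ from hfin.mem_toFinset.1 hj),
    Finset.sum_const,
    nsmul_eq_mul, mul_one, countingFunction, ncard_eq_toFinset_card _ hfin]

/-- The counting function is at most the forward difference quotient of the Riesz mean, by convexity
of `Λ ↦ (Λ - μⱼ)₊`. -/
theorem mul_countingFunction_le (hlim : Tendsto μ atTop atTop) (Λ h : ℝ) (hh : 0 < h) :
    h * countingFunction μ Λ ≤ rieszMean μ (Λ + h) - rieszMean μ Λ := by
  classical
  refine hasSum_le (fun j => ?_) ((hasSum_countingFunction hlim Λ).mul_left h)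
    ((hasSum_rieszMean hlim (Λ + h)).sub (hasSum_rieszMean hlim Λ))
  split_ifs with hj
  · rw [max_eq_left (by linarith), max_eq_left (by linarith)]
    linarith
  · rw [max_eq_right (by linarith : Λ - μ j ≤ 0), mul_zero, sub_zero]
    exact le_max_right _ _

/-- The counting function is at least the backward difference quotient of the Riesz mean. -/
theorem le_mul_countingFunction (hlim : Tendsto μ atTop atTop) (Λ h : ℝ) (hh : 0 < h) :
    rieszMean μ Λ - rieszMean μ (Λ - h) ≤ h * countingFunction μ Λ := by
  classical
  refine hasSum_le (fun j => ?_) ((hasSum_rieszMean hlim Λ).sub (hasSum_rieszMean hlim (Λ - h)))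
    ((hasSum_countingFunction hlim Λ).mul_left h)
  split_ifs with hj
  · rw [max_eq_left (by linarith)]
    have := le_max_left (Λ - h - μ j) 0
    linarith
  · rw [max_eq_right (by linarith), max_eq_right (by linarith)]
    simp

end Counting

variable {C β : ℝ} {μ : ℕ → ℝ} {e : HilbertBasis ℕ ℂ L2Half}

theorem ofReal_rieszMean (hlim : Tendsto μ atTop atTop) (Λ : ℝ) :
    ∑' j, ENNReal.ofReal (max (Λ - μ j) 0) = ENNReal.ofReal (rieszMean μ Λ) := by
  rw [rieszMean, ENNReal.ofReal_tsum_of_nonneg (fun j => le_max_right _ _)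
    (hasSum_rieszMean hlim Λ).summable]

/-- Upper bound for the Riesz means. The term of lower order comes from the interval `(0, 1]`, on
which the shifted potential vanishes. -/
theorem IsEigenbasis.rieszMean_le (he : IsEigenbasis C β μ e) (hC : 0 < C) (hβ : 0 < β)
    (hlim : Tendsto μ atTop atTop) {Λ : ℝ} (hΛ : 0 < Λ) :
    rieszMean μ (Λ - windowEnergy) ≤ 2 / (3 * Real.pi) * Λ ^ (3 / 2 : ℝ) +
      2 / (3 * Real.pi) * rieszConstant β * Λ ^ (1 / 2 + 1 / β + 1) := by
  have hpi := Real.pi_pos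
  have hI := rieszConstant_nonneg β
  have hval : ∫⁻ x in Ioi (0 : ℝ),
      momentumIntegral (fun x => max (Λ - x) 0) (max (x - 1) 0 ^ β) =
      ENNReal.ofReal (2 / (3 * Real.pi) * Λ ^ (3 / 2 : ℝ) +
        2 / (3 * Real.pi) * rieszConstant β * Λ ^ (1 / 2 + 1 / β + 1)) := by
    rw [setLIntegral_shifted_potential hβ]
    simp only [momentumIntegral_riesz]
    rw [lintegral_const_mul' _ _ ENNReal.ofReal_ne_top, lintegral_riesz hβ hΛ, sub_zero,
      max_eq_left hΛ.le, ← ENNReal.ofReal_mul (by positivity), ← ENNReal.ofReal_mul (by positivity),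
      ← ENNReal.ofReal_add (by positivity) (by positivity), mul_assoc]
  have h := he.tsum_le_momentumIntegral hC hβ (convexProfile_riesz Λ)
    (by rw [hval]; exact ENNReal.ofReal_ne_top)
  rw [hval] at h
  simp only [← sub_sub, sub_right_comm Λ] at h
  rw [ofReal_rieszMean hlim, ENNReal.ofReal_le_ofReal_iff (by positivity)] at h
  exact h

/-- Lower bound for the Riesz means. The term of lower order comes from the interval `(0, 2]`, on
which no wave packets are used. -/
theorem IsEigenbasis.le_rieszMean (he : IsEigenbasis C β μ e) (hC : 0 < C) (hβ : 0 < β)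
    (hlim : Tendsto μ atTop atTop) {Λ : ℝ} (hΛ : 0 < Λ) :
    2 / (3 * Real.pi) * rieszConstant β * Λ ^ (1 / 2 + 1 / β + 1) -
      4 / (3 * Real.pi) * Λ ^ (3 / 2 : ℝ) ≤ rieszMean μ (Λ + (windowEnergy + C)) := by
  have hpi := Real.pi_pos
  have hI := rieszConstant_nonneg β
  have hR : 0 ≤ rieszMean μ (Λ + (windowEnergy + C)) := tsum_nonneg fun j => le_max_right _ _
  have h := he.momentumIntegral_le_tsum hC hβ (convexProfile_riesz (Λ + (windowEnergy + C)))
  have h0 : ∀ y, Λ + (windowEnergy + C) - (windowEnergy + C + y) = Λ - y := fun y => by ring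
  simp only [momentumIntegral_riesz, ofReal_rieszMean hlim, h0] at h
  rw [lintegral_const_mul' _ _ ENNReal.ofReal_ne_top] at h
  have h1 : ENNReal.ofReal (rieszConstant β * Λ ^ (1 / 2 + 1 / β + 1)) ≤
      ENNReal.ofReal (2 * Λ ^ (3 / 2 : ℝ)) +
        ∫⁻ x in Ioi (2 : ℝ), ENNReal.ofReal (max (Λ - x ^ β) 0 ^ (3 / 2 : ℝ)) := by
    rw [← lintegral_riesz hβ hΛ, ← Ioc_union_Ioi_eq_Ioi (zero_le_two (α := ℝ)),
      lintegral_union measurableSet_Ioi (Ioc_disjoint_Ioi le_rfl)]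
    gcongr
    calc _ ≤ ∫⁻ x in Ioc (0 : ℝ) 2, ENNReal.ofReal (Λ ^ (3 / 2 : ℝ)) := by
          refine setLIntegral_mono' measurableSet_Ioc fun x hx => ENNReal.ofReal_le_ofReal ?_
          refine Real.rpow_le_rpow (le_max_right _ _) (max_le ?_ hΛ.le) (by norm_num)
          have := Real.rpow_nonneg hx.1.le β
          linarith
      _ = _ := by
          rw [ENNReal.ofReal_mul zero_le_two, ENNReal.ofReal_ofNat, mul_comm]
          simp
  have h2 := (mul_le_mul_right h1 (ENNReal.ofReal (2 / (3 * Real.pi)))).trans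
    ((mul_add _ _ _).trans_le (add_le_add_right h _))
  rw [← ENNReal.ofReal_mul (by positivity), ← ENNReal.ofReal_mul (by positivity),
    ← ENNReal.ofReal_add (by positivity) hR, ENNReal.ofReal_le_ofReal_iff (by positivity)] at h2
  have h3 : 2 / (3 * Real.pi) * (2 * Λ ^ (3 / 2 : ℝ)) = 4 / (3 * Real.pi) * Λ ^ (3 / 2 : ℝ) := by
    ring
  rw [h3, ← mul_assoc] at h2
  linarith

theorem IsEigenbasis.tendsto_rieszMean (he : IsEigenbasis C β μ e) (hC : 0 < C) (hβ : 0 < β)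
    (hlim : Tendsto μ atTop atTop) :
    Tendsto (fun Λ => rieszMean μ Λ / Λ ^ (1 / 2 + 1 / β + 1)) atTop
      (𝓝 (2 / (3 * Real.pi) * rieszConstant β)) := by
  set q := 1 / 2 + 1 / β + 1
  have hq : (3 / 2 : ℝ) < q := by
    have : 0 < 1 / β := by positivity
    simp only [q]
    linarith
  set κ := windowEnergy
  set k := 2 / (3 * Real.pi) * rieszConstant β
  have hlow : Tendsto (fun Λ : ℝ => k * ((Λ + -(κ + C)) ^ q / Λ ^ q) -
      4 / (3 * Real.pi) * ((Λ + -(κ + C)) ^ (3 / 2 : ℝ) / Λ ^ q)) atTop (𝓝 k) := by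
    simpa using ((tendsto_shift_rpow_div (-(κ + C)) q).const_mul k).sub
      ((tendsto_shift_rpow_div_of_lt (-(κ + C)) hq).const_mul (4 / (3 * Real.pi)))
  have hupp : Tendsto (fun Λ : ℝ => 2 / (3 * Real.pi) * ((Λ + κ) ^ (3 / 2 : ℝ) / Λ ^ q) +
      k * ((Λ + κ) ^ q / Λ ^ q)) atTop (𝓝 k) := by
    simpa using ((tendsto_shift_rpow_div_of_lt κ hq).const_mul (2 / (3 * Real.pi))).add
      ((tendsto_shift_rpow_div κ q).const_mul k)
  refine tendsto_of_tendsto_of_tendsto_of_le_of_le' hlow hupp ?_ ?_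
  · filter_upwards [eventually_gt_atTop 0, eventually_gt_atTop (κ + C)] with Λ h0 h1
    have h2 := he.le_rieszMean hC hβ hlim (Λ := Λ + -(κ + C)) (by linarith)
    rw [neg_add_cancel_right] at h2
    rw [← mul_div_assoc, ← mul_div_assoc, ← sub_div]
    exact div_le_div_of_nonneg_right h2 (by positivity)
  · filter_upwards [eventually_gt_atTop 0] with Λ h0
    have hκ := windowEnergy_nonneg
    have h2 := he.rieszMean_le hC hβ hlim (Λ := Λ + κ) (by linarith)
    rw [add_sub_cancel_right] at h2
    rw [← mul_div_assoc, ← mul_div_assoc, ← add_div]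
    exact div_le_div_of_nonneg_right h2 (by positivity)

theorem IsEigenbasis.isEquivalent_countingFunction (he : IsEigenbasis C β μ e) (hC : 0 < C)
    (hβ : 0 < β) (hlim : Tendsto μ atTop atTop) :
    Asymptotics.IsEquivalent atTop (fun x : ℝ => (countingFunction μ x : ℝ))
      (fun x : ℝ => 1 / (Real.pi * β) * ProbabilityTheory.beta (3 / 2) (1 / β) *
        x ^ (1 / 2 + 1 / β)) := by
  have hA : 0 < 1 / (Real.pi * β) * ProbabilityTheory.beta (3 / 2) (1 / β) :=
    mul_pos (by positivity) (ProbabilityTheory.beta_pos (by norm_num) (by positivity))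
  have h := tendsto_div_rpow_of_difference_quotients (he.tendsto_rieszMean hC hβ hlim)
    (mul_countingFunction_le hlim) (le_mul_countingFunction hlim)
  rw [rieszConstant_mul hβ] at h
  refine Asymptotics.isEquivalent_of_tendsto_one ?_
  have h2 := h.div_const (1 / (Real.pi * β) * ProbabilityTheory.beta (3 / 2) (1 / β))
  rw [div_self hA.ne'] at h2
  refine h2.congr fun x => ?_
  simp only [Pi.div_apply]
  rw [div_div, mul_comm]

end

end HalfLine

end

theorem proposition4 (C β : ℝ) (hC : 0 < C) (hβ : 0 < β) :
    ∃ (μ : ℕ → ℝ) (Z : HalfLine.Cutoff → ℝ → ℝ),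
      -- the spectrum is discrete and positive, with ordered eigenvalues `μ 0 ≤ μ 1 ≤ ⋯`
      HalfLine.IsEigenvalueSequence (HalfLine.schrodinger C β) μ ∧ 0 < μ 0 ∧
      -- `Z χ τ` is the truncated heat trace
      (∀ (χ : HalfLine.Cutoff) (τ : ℝ), 0 < τ →
        HalfLine.HasTrace (HalfLine.truncatedHeat C β χ τ) (Z χ τ : ℂ)) ∧
      -- small times, uniformly in `χ`
      (∃ K : ℝ, ∀ (χ : HalfLine.Cutoff) (τ : ℝ), 0 < τ → τ ≤ 1 →
        |Z χ τ - 1 / √(4 * Real.pi * τ) *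
            ∫ x in Set.Ioi (0 : ℝ), Real.exp (-τ * x ^ β) * χ.toFun x|
          ≤ K * τ ^ (-max (1 / β) (1 / 2))) ∧
      -- large times, uniformly in `χ`
      (∃ K : ℝ, ∀ (χ : HalfLine.Cutoff) (τ : ℝ), 1 ≤ τ →
        |Z χ τ| ≤ K * Real.exp (-μ 0 * τ)) ∧
      -- Weyl law for the counting function
      Asymptotics.IsEquivalent Filter.atTop
        (fun x : ℝ => (HalfLine.countingFunction μ x : ℝ))
        (fun x : ℝ => 1 / (Real.pi * β) * ProbabilityTheory.beta (3 / 2) (1 / β) *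
          x ^ (1 / 2 + 1 / β)) := by
  obtain ⟨μ, e, hmono, hlim, he⟩ := HalfLine.exists_isEigenbasis hC hβ
  refine ⟨μ, HalfLine.truncatedTrace μ e, he.isEigenvalueSequence hC hβ hmono hlim, he.pos 0,
    fun χ τ hτ => he.hasTrace_truncatedHeat hC hβ hτ χ,
    ⟨_, fun χ τ hτ hτ1 => (he.abs_truncatedTrace_sub_le hC hβ hτ hτ1 χ).trans
      (HalfLine.intervalError_add_totalError_le hC hβ hτ hτ1)⟩,
    ⟨_, fun χ τ hτ => he.abs_truncatedTrace_le hC hβ hmono hτ χ⟩,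
    he.isEquivalent_countingFunction hC hβ hlim⟩
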